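/- **Setting.** $G$ is a finite graph with a breadth-first spanning tree $T$, and $K_b$ pairwise disjoint connected *base fragments* with rooted spanning trees in $G$ are given. Before the first phase every base fragment is a fragment; its slots are computed by interval allocation over $T$. In each phase the current fragments are arranged (by the fragment-merging step of the phase) in rooted virtual subtrees of depth at most $3$, whose edges are edges of $G$ between the fragments, and each subtree is merged into one new fragment, whose leader is the leader of the root fragment of the subtree (the leader of a fragment is the root vertex of one of its base fragments). At the end of the phase the *slot-set generation procedure* computes new slots. Communicating only through convergecast and broadcast cycles that use the current slots (messages are pipelined over $T$, one slot after the other, and the root of $T$ stores a single message), and over the virtual subtree edges, it proceeds as follows: (1) fragments count their children; (2) in three iterations, the numbers of required slots are summed from child fragments to parent fragments, and all partial sums are cached; (3) each new leader requests an interval of the required length, receives it from the root of $T$, and keeps its first slot; (4) in three iterations, each fragment reserves the beginning of its interval for its own base fragments and passes the rest on to its child fragments, using the cached sums; (5) each old leader distributes single slots to the base fragments of its old fragment; finally the slot and the identity (routing label) of each new leader are announced in its new fragment. **Slot sets.** Two conventions for counting slots are considered. Either the base fragment whose root is the leader has a query slot of its own, and a fragment with $k$ base fragments needs $k+1$ slots,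 or that base fragment uses the slot of the leader, and $k$ slots are needed. Let $e=1$ in the first case and $e=0$ in the second. A slot assignment is a *correct p-q slot set* for the current fragments if each fragment $F$ with $k_F$ base fragments has a range $\{j_F, j_F+1,\dots,j_F+k_F+e-1\}\subseteq\{1,\dots,2K_b\}$ of consecutive slots such that the first slot $j_F$ is held by the leader of $F$; the remaining $k_F+e-1$ slots are assigned bijectively to the base fragments of $F$ (all of them if $e=1$, all except the leader's if $e=0$); ranges of different fragments are disjoint; and every base fragment of $F$ knows $j_F$ and the leader of $F$. **Claim.** In both conventions, for every $t\ge 0$ and every sequence of virtual subtrees in the first $t$ phases, the slots computed by the setup (for $t=0$) and by the slot-set generation procedure (after each of the phases) form a correct p-q slot set for the fragments after $t$ phases. -/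

import Mathlib

namespace SlotGen

universe u w

/-! ### Rooted forests, the breadth-first tree and the base fragments -/

/-- `climb par k v` is the `k`-th ancestor of `v` for the parent map `par`, if it exists. -/
def climb {V : Type u} (par : V → Option V) : ℕ → V → Option V
  | 0, v => some v
  | k + 1, v => (par v).bind (climb par k)

/-- The vertices whose parent is `v`. -/
def children {V : Type u} [Fintype V] [LinearOrder V] (par : V → Option V) (v : V) : Finset V :=
  Finset.univ.filter (fun x => par x = some v)

/-- The children of `v` in the order in which `v` scans them (by identifier). -/
def childList {V : Type u} [Fintype V] [LinearOrder V] (par : V → Option V) (v : V) : List V :=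
  (children par v).sort (· ≤ ·)

/-- A breadth-first spanning tree of `G`; every vertex knows its depth. -/
structure BFSTree {V : Type u} (G : SimpleGraph V) where
  root : V
  parent : V → Option V
  depth : V → ℕ
  parent_root : parent root = none
  parent_adj : ∀ v, v ≠ root → ∃ p, parent v = some p ∧ G.Adj v p ∧ depth v = depth p + 1
  depth_root : depth root = 0
  depth_eq_dist : ∀ v, depth v = G.dist root v

/-- The overall depth `d(T)`. -/
def BFSTree.height {V : Type u} [Fintype V] {G : SimpleGraph V} (T : BFSTree G) : ℕ :=
  Finset.univ.sup T.depth

/-- `x` lies on the tree path from the root to `y`. This is the test which tree routing performs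
at `x` on a message addressed to `y`. -/
def BFSTree.OnPath {V : Type u} {G : SimpleGraph V} (T : BFSTree G) (x y : V) : Prop :=
  climb T.parent (T.depth y - T.depth x) y = some x

instance {V : Type u} [DecidableEq V] {G : SimpleGraph V} (T : BFSTree G) (x y : V) :
    Decidable (T.OnPath x y) :=
  inferInstanceAs (Decidable (climb T.parent (T.depth y - T.depth x) y = some x))

/-- Pairwise disjoint base fragments, indexed by `β`, each with a rooted spanning tree made of
edges of `G`. Vertices with `base v = none` belong to no base fragment (small components). -/
structure BaseFragments {V : Type u} (G : SimpleGraph V) (β : Type w) where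
  base : V → Option β
  root : β → V
  parent : V → Option V
  base_root : ∀ b, base (root b) = some b
  parent_root : ∀ b, parent (root b) = none
  parent_adj : ∀ v b, base v = some b → v ≠ root b →
    ∃ p, parent v = some p ∧ G.Adj v p ∧ base p = some b
  parent_outside : ∀ v, base v = none → parent v = none
  reaches_root : ∀ v b, base v = some b → ∃ k, climb parent k v = some (root b)

/-- The base fragment of which `v` is the root vertex, if there is one. -/
def BaseFragments.rootIndex {V : Type u} [DecidableEq V] {G : SimpleGraph V} {β : Type w}
    (B : BaseFragments G β) (v : V) : Option β :=
  (B.base v).filter (fun b => decide (B.root b = v))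

/-! ### Computations along rooted trees -/

/-- Convergecast of `f` along a rooted forest: the value that `v` upcasts to its parent, as known
after `n` rounds. `none` means that no input was met. -/
def gather {V : Type u} [Fintype V] [LinearOrder V] {M : Type*} (par : V → Option V)
    (f : M → M → M) (x : V → Option M) : ℕ → V → Option M
  | 0, v => x v
  | n + 1, v => ((childList par v).map (gather par f x n)).foldl (Option.merge f) (x v)

/-- Broadcast along a rooted forest: the message known to `v` after `n` rounds, where `x` is the
message held by the roots. -/
def spread {V : Type u} {M : Type*} (par : V → Option V) (x : V → Option M) :
    ℕ → V → Option M
  | 0, v => x v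
  | n + 1, v =>
    match par v with
    | none => x v
    | some p => spread par x n p

/-- Splitting of intervals down a rooted forest, after `n` rounds. `cache v` is the length that
`v` has requested from its parent, `top` gives the bottoms of the intervals of the roots, and the
value at `v` is the bottom of the interval of `v`. A vertex serves its children one after the
other, starting from the bottom of its own interval. -/
def splitDown {V : Type u} [Fintype V] [LinearOrder V] (par : V → Option V) (cache : V → ℕ)
    (top : V → Option ℕ) : ℕ → V → Option ℕ
  | 0, v => top v
  | n + 1, v =>
    match par v with
    | none => top v
    | some p => (splitDown par cache top n p).map
        (fun N => N + ∑ x ∈ (children par p).filter (fun x => x < v), cache x)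

/-! ### The pipelined exchange over the breadth-first tree -/

/-- What `v` upcasts to its `T`-parent in round `t`: it aggregates its own message for that round
with the messages that its `T`-children sent in the round before. -/
def upcast {V : Type u} [Fintype V] [LinearOrder V] {G : SimpleGraph V} {A : Type*}
    (T : BFSTree G) (comb : Option A → Option A → Option A) (inj : ℕ → V → Option A) :
    ℕ → V → Option A
  | 0, v => inj 0 v
  | t + 1, v =>
    ((childList T.parent v).map (upcast T comb inj t)).foldl comb (inj (t + 1) v)

/-- The local state of the tree root before round `t`, when `inp` is the stream of messages
arriving there. -/
def rootState {σ A O : Type*} (step : σ → Option A → σ × O) (s : σ) (inp : ℕ → Option A) : ℕ → σ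
  | 0 => s
  | t + 1 => (step (rootState step s inp t) (inp t)).1

/-- The message handled by `v` in round `t` on its way down the tree; `out` is the stream of
addressed messages issued by the tree root. Every message follows the tree path to its address. -/
def downcast {V : Type u} [DecidableEq V] {G : SimpleGraph V} {R : Type*} (T : BFSTree G)
    (out : ℕ → Option (R × V)) : ℕ → V → Option (R × V)
  | 0, v => if v = T.root then out 0 else none
  | t + 1, v =>
    match T.parent v with
    | none => out (t + 1)
    | some p => (downcast T out t p).filter (fun m => decide (T.OnPath v m.2))

/-- The extrinsic step of a cycle, with slots in `1, …, 2 K_b`: messages are injected, upcast to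
the tree root, processed there by `step`, and the replies are routed down the tree. The result is
the first message that is delivered to each vertex. -/
def exchange {V : Type u} [Fintype V] [LinearOrder V] {G : SimpleGraph V} {σ A R : Type*}
    (T : BFSTree G) (Kb : ℕ) (comb : Option A → Option A → Option A) (inj : ℕ → V → Option A)
    (s : σ) (step : σ → Option A → σ × Option (R × V)) (v : V) : Option R :=
  let inp : ℕ → Option A := fun t => upcast T comb inj t T.root
  let out : ℕ → Option (R × V) := fun t => (step (rootState step s inp t) (inp t)).2
  ((List.range (2 * Kb + 2 * T.height + 1)).filterMap
    (fun t => ((downcast T out t v).filter (fun m => decide (m.2 = v))).map Prod.fst)).head?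

/-! ### Slots -/

/-- The two ways to count slots: the base fragment whose root is the leader either uses the
leader's slot, so that a fragment of `k` base fragments needs `k` slots, or has a query slot of
its own, so that `k + 1` slots are needed. -/
inductive Convention where
  | shared
  | separate

/-- The number of query slots (`0` or `1`) reserved for the base fragment of a leader. -/
def Convention.extra : Convention → ℕ
  | .shared => 0
  | .separate => 1

/-- The slot data. The root vertex of the base fragment `b` knows the slot `fslot b` of its
fragment, its own query slot `qslot b` and the (routing label of the) leader `lbl b` of its
fragment; if it is a leader, then it also knows the number `size b` of base fragments of its
fragment, and `fslot b` is its publishing slot. -/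
structure Slots (V : Type u) (β : Type w) where
  fslot : β → ℕ
  qslot : β → ℕ
  lbl : β → V
  size : β → ℕ

/-- The root vertex of `b` is the leader of its fragment. -/
def IsLeader {V : Type u} {G : SimpleGraph V} {β : Type w} (B : BaseFragments G β)
    (S : Slots V β) (b : β) : Prop :=
  S.lbl b = B.root b

instance {V : Type u} [DecidableEq V] {G : SimpleGraph V} {β : Type w} (B : BaseFragments G β)
    (S : Slots V β) (b : β) : Decidable (IsLeader B S b) :=
  inferInstanceAs (Decidable (S.lbl b = B.root b))

/-- The root vertex of `b` uses a query slot. -/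
def HasQuery {V : Type u} {G : SimpleGraph V} {β : Type w} (B : BaseFragments G β)
    (c : Convention) (S : Slots V β) (b : β) : Prop :=
  c.extra = 1 ∨ ¬ IsLeader B S b

instance {V : Type u} [DecidableEq V] {G : SimpleGraph V} {β : Type w} (B : BaseFragments G β)
    (c : Convention) (S : Slots V β) (b : β) : Decidable (HasQuery B c S b) :=
  inferInstanceAs (Decidable (c.extra = 1 ∨ ¬ IsLeader B S b))

/-- In round `t` the window of slot `i` is at the depth of `v`. -/
def AtSlot {V : Type u} [Fintype V] {G : SimpleGraph V} (T : BFSTree G) (i t : ℕ) (v : V) : Prop :=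
  t + T.depth v = T.height + i

instance {V : Type u} [Fintype V] {G : SimpleGraph V} (T : BFSTree G) (i t : ℕ) (v : V) :
    Decidable (AtSlot T i t v) :=
  inferInstanceAs (Decidable (t + T.depth v = T.height + i))

/-! ### Communication cycles -/

/-- Aggregation of labelled partial outcomes by a vertex of the breadth-first tree. -/
def aggregate {V : Type u} {M : Type*} [DecidableEq M] (f : M → M → M) :
    Option (M × V) → Option (M × V) → Option (M × V)
  | none, y => y
  | some x, none => some x
  | some (a, l), some (b, l') => if f a b = a then some (a, l) else some (f a b, l')

/-- The intrinsic step of a convergecast cycle: the partial outcome upcast by each vertex inside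
its base fragment. -/
def intrinsic {V : Type u} [Fintype V] [LinearOrder V] {G : SimpleGraph V} {β : Type w}
    {M : Type*} (B : BaseFragments G β) (f : M → M → M) (x : V → Option M) : V → Option M :=
  gather B.parent f x (Fintype.card V)

/-- The extrinsic step of a convergecast cycle. The root of every base fragment injects its
partial outcome, labelled with its leader, in the slot of its fragment; the tree root sends each
outcome to the leader with which it is labelled. The result is what each vertex receives. -/
def extrinsic {V : Type u} [Fintype V] [LinearOrder V] {G : SimpleGraph V} {β : Type w}
    [Fintype β] {M : Type*} [DecidableEq M] (T : BFSTree G) (B : BaseFragments G β)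
    (S : Slots V β) (f : M → M → M) (y : V → Option M) : V → Option M :=
  exchange T (Fintype.card β) (aggregate f)
    (fun t v => (B.rootIndex v).bind (fun b =>
      if AtSlot T (S.fslot b) t v then (y v).map (fun m => (m, S.lbl b)) else none))
    () (fun _ a => ((), a))

/-- A convergecast cycle. The outcome for a fragment is found at its leader. -/
def convergecast {V : Type u} [Fintype V] [LinearOrder V] {G : SimpleGraph V} {β : Type w}
    [Fintype β] {M : Type*} [DecidableEq M] (T : BFSTree G) (B : BaseFragments G β)
    (S : Slots V β) (f : M → M → M) (x : V → Option M) : V → Option M :=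
  extrinsic T B S f (intrinsic B f x)

/-- Messages upcast in a cycle with publishing slots and query slots. -/
inductive Msg (V : Type u) (P Q : Type*) where
  | publish (m : P) : Msg V P Q
  | query (q : Q) (label : V) : Msg V P Q

/-- The messages injected in a cycle with publishing and query slots: leaders publish `m b` in
their publishing slot, base fragment roots send the query `q b` in their query slot. -/
def pqInject {V : Type u} [Fintype V] [LinearOrder V] {G : SimpleGraph V} {β : Type w}
    {P Q : Type*} (T : BFSTree G) (B : BaseFragments G β) (c : Convention) (S : Slots V β)
    (m : β → P) (q : β → Q) (t : ℕ) (v : V) : Option (Msg V P Q) :=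
  (B.rootIndex v).bind (fun b =>
    if IsLeader B S b ∧ AtSlot T (S.fslot b) t v then some (Msg.publish (m b))
    else if HasQuery B c S b ∧ AtSlot T (S.qslot b) t v then some (Msg.query (q b) (B.root b))
    else none)

/-- The tree root in a broadcast cycle: it stores the last published message (`none`: nothing, or
an empty message) and sends it in reply to every query. -/
def broadcastStep {V : Type u} {M : Type*} (s : Option M) :
    Option (Msg V (Option M) Unit) → Option M × Option (Option M × V)
  | none => (s, none)
  | some (Msg.publish m) => (m, none)
  | some (Msg.query _ l) => (s, some (s, l))

/-- A broadcast cycle. The leader `b` publishes `m b` (an empty message if `m b = none`); the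
result is the message which each vertex receives from the leader of its fragment. -/
def broadcast {V : Type u} [Fintype V] [LinearOrder V] {G : SimpleGraph V} {β : Type w}
    [Fintype β] {M : Type*} (T : BFSTree G) (B : BaseFragments G β) (c : Convention)
    (S : Slots V β) (m : β → Option M) : V → Option M :=
  let reply : V → Option (Option M) :=
    exchange T (Fintype.card β) Option.or (pqInject T B c S m (fun _ => ())) none broadcastStep
  spread B.parent
    (fun v => (B.rootIndex v).bind (fun b => if IsLeader B S b then m b else (reply v).join))
    (Fintype.card V)

/-- The tree root in an interval allocation cycle. The range bottom is undefined (`none`) after an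
empty message from a fragment that does not participate. -/
def allocStep {V : Type u} (bottom : Option ℕ) :
    Option (Msg V (Option ℕ) ℕ) → Option ℕ × Option (Option ℕ × V)
  | none => (bottom, none)
  | some (Msg.publish N) => (N, none)
  | some (Msg.query s l) => (bottom.map (fun N => N + s), some (bottom, l))

/-- An interval allocation cycle. The leader `b` distributes an interval with bottom `m b` among
the base fragments of its fragment (and does not participate if `m b = none`), where the base
fragment `b` requests the length `s b`. The result is the bottom of the interval that the root of
`b` claims. A base fragment without a query slot takes its part from the beginning of the interval
of its leader, which is its own root vertex. -/
def allocate {V : Type u} [Fintype V] [LinearOrder V] {G : SimpleGraph V} {β : Type w}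
    [Fintype β] (T : BFSTree G) (B : BaseFragments G β) (c : Convention) (S : Slots V β)
    (m : β → Option ℕ) (s : β → ℕ) (b : β) : Option ℕ :=
  let published : β → Option ℕ := fun b =>
    if HasQuery B c S b then m b else (m b).map (fun N => N + s b)
  let reply : V → Option (Option ℕ) :=
    exchange T (Fintype.card β) Option.or (pqInject T B c S published s) (some 1) allocStep
  if HasQuery B c S b then (reply (B.root b)).join else m b

/-- The variant of interval allocation without publishing slots: the leaders `b` for which `s b`
is defined request intervals of length `s b`, using their current slots as query slots, from the
range that starts at `1`. -/
def allocateLeaders {V : Type u} [Fintype V] [LinearOrder V] {G : SimpleGraph V} {β : Type w}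
    [Fintype β] (T : BFSTree G) (B : BaseFragments G β) (S : Slots V β) (s : β → Option ℕ)
    (b : β) : Option ℕ :=
  let reply : V → Option (Option ℕ) :=
    exchange T (Fintype.card β) Option.or
      (fun t v => (B.rootIndex v).bind (fun b =>
        if IsLeader B S b ∧ AtSlot T (S.fslot b) t v then
          (s b).map (fun n => Msg.query n (B.root b)) else none))
      (some 1) allocStep
  (reply (B.root b)).join

/-! ### Setup -/

/-- The slots of the first phase, where every base fragment is a fragment. They are computed by
interval allocation over `T`: the root of every base fragment requests an interval (of length `1`,
or of length `2` if it needs a query slot besides its publishing slot). -/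
def setup {V : Type u} [Fintype V] [LinearOrder V] {G : SimpleGraph V} {β : Type w}
    (T : BFSTree G) (B : BaseFragments G β) (c : Convention) : Slots V β :=
  let request : V → Option ℕ := fun v => (B.rootIndex v).map (fun _ => 1 + c.extra)
  let cache : V → ℕ := fun v =>
    (gather T.parent (· + ·) request (Fintype.card V) v).getD 0
  let bottom : V → Option ℕ :=
    splitDown T.parent cache (fun v => if v = T.root then some 1 else none) (Fintype.card V)
  let slot : β → ℕ := fun b =>
    (bottom (B.root b)).getD 0 + ∑ x ∈ children T.parent (B.root b), cache x
  { fslot := slot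
    qslot := fun b => slot b + c.extra
    lbl := B.root
    size := fun _ => 1 }

/-! ### Fragments and virtual subtrees

A fragment is denoted by the base fragment whose root is its leader: `frag b` is the fragment that
contains `b`, and `F` is a fragment if `frag F = F`. In a phase, the fragments are arranged in
virtual subtrees: `mw F = none` if `F` is the root of its subtree, and `mw F = some (x, y)` if the
edge from `x` in `F` to `y` connects `F` to its parent. -/

/-- The bound on the depth of the virtual subtrees. -/
def maxDepth : ℕ := 3

/-- The parent of the fragment `F` in its subtree; a root is mapped to itself. -/
def virtualParent {V : Type u} {G : SimpleGraph V} {β : Type w} (B : BaseFragments G β)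
    (frag : β → β) (mw : β → Option (V × V)) (F : β) : β :=
  (((mw F).bind (fun e => B.base e.2)).map frag).getD F

/-- The fragments after merging each subtree; the leader of the root fragment is the leader. -/
def merge {V : Type u} {G : SimpleGraph V} {β : Type w} (B : BaseFragments G β)
    (frag : β → β) (mw : β → Option (V × V)) (b : β) : β :=
  (virtualParent B frag mw)^[maxDepth] (frag b)

/-- `mw` arranges the fragments in rooted subtrees of depth at most `maxDepth`, whose edges are
edges of the graph. -/
structure IsSubtreePartition {V : Type u} {G : SimpleGraph V} {β : Type w}
    (B : BaseFragments G β) (frag : β → β) (mw : β → Option (V × V)) : Prop where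
  edge : ∀ F x y, frag F = F → mw F = some (x, y) →
    G.Adj x y ∧ (∃ b, B.base x = some b ∧ frag b = F) ∧ ∃ b, B.base y = some b
  depth : ∀ F, frag F = F → mw ((virtualParent B frag mw)^[maxDepth] F) = none

/-- The vertex at the parent's end of the edge to the parent fragment, for the vertex `x` at the
child's end of such an edge. -/
def link {V : Type u} [DecidableEq V] {G : SimpleGraph V} {β : Type w} (B : BaseFragments G β)
    (frag : β → β) (mw : β → Option (V × V)) (x : V) : Option V :=
  (B.base x).bind (fun b => (mw (frag b)).bind (fun e => if e.1 = x then some e.2 else none))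

/-- The vertices of child fragments which are connected to `y` by subtree edges. -/
def linked {V : Type u} [Fintype V] [DecidableEq V] (lk : V → Option V) (y : V) : Finset V :=
  Finset.univ.filter (fun x => lk x = some y)

/-! ### The slot set generation procedure -/

/-- Step 1: child fragments ping their parents, and a convergecast cycle counts the pings. -/
def countChildren {V : Type u} [Fintype V] [LinearOrder V] {G : SimpleGraph V} {β : Type w}
    [Fintype β] (T : BFSTree G) (B : BaseFragments G β) (S : Slots V β) (lk : V → Option V)
    (b : β) : ℕ :=
  (convergecast T B S (· + ·) (fun y => some (linked lk y).card) (B.root b)).getD 0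

/-- What is stored during step 2: by the child's end of a subtree edge, the size it has requested;
by all vertices, the sum of the sizes that they have upcast; by base fragment roots, the sum of the
sizes that they have injected; by leaders, the sum of the sizes received and their number; and by
all vertices, the size that their fragment has published when it became ready. -/
structure Requests (V : Type u) (β : Type w) where
  edgeCache : V → Option ℕ
  vertexCache : V → ℕ
  baseCache : β → ℕ
  sum : β → ℕ
  count : β → ℕ
  ready : V → Option ℕ

/-- Step 2(d): the leaders of fragments that have heard from all their children, and are not roots
of subtrees, publish the size of the interval that their fragment is going to request. -/
def publishReady {V : Type u} [Fintype V] [LinearOrder V] {G : SimpleGraph V} {β : Type w}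
    [Fintype β] (T : BFSTree G) (B : BaseFragments G β) (c : Convention) (S : Slots V β)
    (mw : β → Option (V × V)) (nchild sum count : β → ℕ) : V → Option ℕ :=
  broadcast T B c S (fun b =>
    if count b = nchild b ∧ (mw b).isSome then some (S.size b + sum b) else none)

/-- The start of step 2: nothing is cached, and the leaf fragments are ready. -/
def requestsInit {V : Type u} [Fintype V] [LinearOrder V] {G : SimpleGraph V} {β : Type w}
    [Fintype β] (T : BFSTree G) (B : BaseFragments G β) (c : Convention) (S : Slots V β)
    (mw : β → Option (V × V)) (nchild : β → ℕ) : Requests V β :=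
  { edgeCache := fun _ => none
    vertexCache := fun _ => 0
    baseCache := fun _ => 0
    sum := fun _ => 0
    count := fun _ => 0
    ready := publishReady T B c S mw nchild (fun _ => 0) (fun _ => 0) }

/-- One iteration of step 2. -/
def requestsStep {V : Type u} [Fintype V] [LinearOrder V] {G : SimpleGraph V} {β : Type w}
    [Fintype β] (T : BFSTree G) (B : BaseFragments G β) (c : Convention) (S : Slots V β)
    (mw : β → Option (V × V)) (lk : V → Option V) (nchild : β → ℕ) (q : Requests V β) :
    Requests V β :=
  -- (a) fragments that have become ready send their requests over the subtree edges
  let sent : V → Option ℕ := fun x =>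
    if (lk x).isSome ∧ (q.edgeCache x).isNone then q.ready x else none
  let senders : V → Finset V := fun y => (linked lk y).filter (fun x => (sent x).isSome)
  -- (b) sums of sizes and numbers of messages inside the base fragments
  let up : V → Option (ℕ × ℕ) := intrinsic B (· + ·) (fun y =>
    if (senders y).Nonempty then some (∑ x ∈ senders y, (sent x).getD 0, (senders y).card)
    else none)
  -- (c) the active base fragments inform the leader of their fragment
  let got : V → Option (ℕ × ℕ) := extrinsic T B S (· + ·) up
  let sum : β → ℕ := fun b => q.sum b + ((got (B.root b)).getD (0, 0)).1
  let count : β → ℕ := fun b => q.count b + ((got (B.root b)).getD (0, 0)).2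
  { edgeCache := fun x => (q.edgeCache x).or (sent x)
    vertexCache := fun v => q.vertexCache v + ((up v).getD (0, 0)).1
    baseCache := fun b => q.baseCache b + ((up (B.root b)).getD (0, 0)).1
    sum := sum
    count := count
    ready := publishReady T B c S mw nchild sum count }

/-- One iteration of step 4. Here `fresh b` is the bottom of the interval which the leader `b` has
received in step 3 or in the previous iteration; the result is what leaders receive in this
iteration. -/
def distributeStep {V : Type u} [Fintype V] [LinearOrder V] {G : SimpleGraph V} {β : Type w}
    [Fintype β] (T : BFSTree G) (B : BaseFragments G β) (c : Convention) (S : Slots V β)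
    (mw : β → Option (V × V)) (lk : V → Option V) (q : Requests V β) (fresh : β → Option ℕ)
    (b : β) : Option ℕ :=
  -- (a) the beginning of the interval is reserved for the fragment itself
  let rest : β → Option ℕ := fun F =>
    (fresh F).map (fun N => N + S.size F + (if (mw F).isNone then c.extra else 0))
  -- (b) the rest is divided among the base fragments, according to the cached requests
  let claimed : β → Option ℕ := allocate T B c S rest q.baseCache
  -- (c) and inside each base fragment
  let bottom : V → Option ℕ :=
    splitDown B.parent q.vertexCache (fun v => (B.rootIndex v).bind claimed) (Fintype.card V)
  -- (d) and over the subtree edges, from where the child fragments send it to their leaders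
  let answer : V → Option ℕ := fun x =>
    (q.edgeCache x).bind (fun _ => (lk x).bind (fun y => (bottom y).map (fun N =>
      N + ∑ z ∈ children B.parent y, q.vertexCache z
        + ∑ z ∈ (linked lk y).filter (fun z => z < x), (q.edgeCache z).getD 0)))
  convergecast T B S (fun a _ => a) answer (B.root b)

/-- The iterations of step 4: what the leaders have received in the last iteration, and what they
have received in total. -/
def distribute {V : Type u} [Fintype V] [LinearOrder V] {G : SimpleGraph V} {β : Type w}
    [Fintype β] (T : BFSTree G) (B : BaseFragments G β) (c : Convention) (S : Slots V β)
    (mw : β → Option (V × V)) (lk : V → Option V) (q : Requests V β) (start : β → Option ℕ) :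
    ℕ → (β → Option ℕ) × (β → Option ℕ)
  | 0 => (start, start)
  | n + 1 =>
    let prev := distribute T B c S mw lk q start n
    let fresh : β → Option ℕ := distributeStep T B c S mw lk q prev.1
    (fresh, fun b => (prev.2 b).or (fresh b))

/-- One step of the announcement over the virtual subtrees of the slot and the label of the new
leader, with the old slots: leaders that know them broadcast them, they are sent over the subtree
edges to the child fragments, and there to the leaders. -/
def announceStep {V : Type u} [Fintype V] [LinearOrder V] {G : SimpleGraph V} {β : Type w}
    [Fintype β] (T : BFSTree G) (B : BaseFragments G β) (c : Convention) (S : Slots V β)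
    (lk : V → Option V) (known : β → Option (ℕ × V)) (b : β) : Option (ℕ × V) :=
  let heard : V → Option (ℕ × V) := broadcast T B c S known
  let got : V → Option (ℕ × V) :=
    convergecast T B S (fun a _ => a) (fun x => (lk x).bind heard)
  (known b).or (got (B.root b))

/-- The whole procedure: the slots of the next phase, computed with the slots `S` of the current
phase. -/
def generate {V : Type u} [Fintype V] [LinearOrder V] {G : SimpleGraph V} {β : Type w}
    [Fintype β] (T : BFSTree G) (B : BaseFragments G β) (c : Convention) (frag : β → β)
    (mw : β → Option (V × V)) (S : Slots V β) : Slots V β :=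
  let lk : V → Option V := link B frag mw
  -- steps 1 and 2
  let nchild : β → ℕ := countChildren T B S lk
  let q : Requests V β :=
    (requestsStep T B c S mw lk nchild)^[maxDepth] (requestsInit T B c S mw nchild)
  -- step 3: the leaders of the root fragments become the new leaders
  let start : β → Option ℕ := allocateLeaders T B S (fun b =>
    if (mw b).isNone then some (S.size b + q.sum b + c.extra) else none)
  -- step 4
  let bottom : β → Option ℕ := (distribute T B c S mw lk q start maxDepth).2
  -- step 5: a new leader keeps the first slot, and its own base fragment may do without another
  let slot : β → Option ℕ := allocate T B c S
    (fun b => (bottom b).map (fun N => N + (if (mw b).isNone then 1 else 0)))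
    (fun b => if IsLeader B S b ∧ (mw b).isNone then c.extra else 1)
  -- announcement of the slots and labels of the new leaders
  let known : β → Option (ℕ × V) := (announceStep T B c S lk)^[maxDepth] (fun b =>
    if IsLeader B S b ∧ (mw b).isNone then (bottom b).map (fun N => (N, B.root b)) else none)
  let heard : V → Option (ℕ × V) := broadcast T B c S known
  { fslot := fun b => ((heard (B.root b)).map Prod.fst).getD 0
    qslot := fun b => (slot b).getD 0
    lbl := fun b => ((heard (B.root b)).map Prod.snd).getD (S.lbl b)
    size := fun b => S.size b + q.sum b }

/-! ### The phases and the correctness of slot sets -/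

/-- The fragments after `t` phases, where `mw s` is the result of the tree partition in the phase
number `s` (counted from `0`). Before the first phase, every base fragment is a fragment. -/
def fragAfter {V : Type u} {G : SimpleGraph V} {β : Type w} (B : BaseFragments G β)
    (mw : ℕ → β → Option (V × V)) : ℕ → β → β
  | 0 => id
  | t + 1 => merge B (fragAfter B mw t) (mw t)

/-- The slots after `t` phases. -/
def slotsAfter {V : Type u} [Fintype V] [LinearOrder V] {G : SimpleGraph V} {β : Type w}
    [Fintype β] (T : BFSTree G) (B : BaseFragments G β) (c : Convention)
    (mw : ℕ → β → Option (V × V)) : ℕ → Slots V β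
  | 0 => setup T B c
  | t + 1 => generate T B c (fragAfter B mw t) (mw t) (slotsAfter T B c mw t)

/-- The number of base fragments in the fragment `F`. -/
def fragSize {β : Type w} [Fintype β] [DecidableEq β] (frag : β → β) (F : β) : ℕ :=
  (Finset.univ.filter (fun b => frag b = F)).card

/-- The publish-query range of the fragment `F`: it starts with the slot held by the leader. -/
def pqRange {V : Type u} {β : Type w} [Fintype β] [DecidableEq β] (c : Convention)
    (frag : β → β) (S : Slots V β) (F : β) : Finset ℕ :=
  Finset.Ico (S.fslot F) (S.fslot F + (fragSize frag F + c.extra))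

/-- `S` is a correct publish-query slot set for the fragments given by `frag`. -/
structure IsPQSlotSet {V : Type u} {G : SimpleGraph V} {β : Type w} [Fintype β] [DecidableEq β]
    (B : BaseFragments G β) (c : Convention) (frag : β → β) (S : Slots V β) : Prop where
  /-- The leader of every fragment belongs to it. -/
  leader_mem : ∀ b, frag (frag b) = frag b
  /-- Every base fragment knows the leader of its fragment and the slot of that leader. -/
  knows_leader : ∀ b, S.lbl b = B.root (frag b) ∧ S.fslot b = S.fslot (frag b)
  /-- All slots are between `1` and `2 K_b`. -/
  range_subset : ∀ F, frag F = F → pqRange c frag S F ⊆ Finset.Icc 1 (2 * Fintype.card β)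
  /-- The ranges of different fragments are disjoint. -/
  range_disjoint : ∀ F F', frag F = F → frag F' = F' → F ≠ F' →
    Disjoint (pqRange c frag S F) (pqRange c frag S F')
  /-- The slots of a range after the first one are assigned to the base fragments of the fragment,
  one to each, except that in the shared convention the base fragment of the leader has no slot
  besides the slot of the leader. -/
  query_slots : ∀ F, frag F = F →
    Set.BijOn S.qslot {b | frag b = F ∧ (c.extra = 1 ∨ b ≠ F)}
      (pqRange c frag S F \ {S.fslot F} : Finset ℕ)

end SlotGen

set_option linter.unusedSectionVars false

namespace SlotGen

universe u w

/-! ### Rooted forests -/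

section Forest

variable {V : Type u} {par : V → Option V}

/-! The proof is an induction on the phases. Correctness of the slots alone is not inductive, since
the new leaders compute the lengths of their requests; the invariant is `IsPQSlotSet` together with
the fact that every leader `F` stores `fragSize frag F` in `size F`. The base case is
`isPQSlotSet_setup`, the step is `isPQSlotSet_generate` with `generate_size`.

A correct slot set makes each communication cycle equal to a closed formula, and from then on the
network plays no role. A message of slot `i` reaches the tree root in round `T.height + i`, whatever
the depth of its sender. In a convergecast, messages meet there only if they belong to the same
fragment. In a cycle with publishing and query slots they never meet, and a range is an unbroken
run: the leader publishes, then each remaining slot carries one query. So the single message stored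
by the tree root belongs to the right fragment whenever a query is answered. This gives
`convergecast_rel`, `broadcast_eq`, `allocate_eq` and `allocateLeaders_eq`.

For the subtrees, three iterations suffice because a fragment that has not sent its request within
`i` iterations has a path of length `i` below it. Hence step 2 caches the exact subtree sizes
(`cachesFilled_requests`). In step 3 a new fragment with `k ≥ 1` base fragments requests `k + e ≤
2k` slots, so the total is at most `2 K_b`. In step 4 each fragment keeps the beginning of its
interval, and consecutive pieces of the rest go to its children (`exists_nestedIntervals`). The kept
parts in such a nested family are disjoint, by `IsForest.reserved_disjoint`; this principle is used
for the breadth-first tree, for the trees of base fragments and for the virtual subtrees.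

Finally, the query slots of a new fragment are distinct, lie in its range and avoid the first slot.
There are as many of them as remaining slots, so they form a bijection. -/

theorem climb_one (v : V) : climb par 1 v = par v := by
  cases h : par v <;> simp [climb, h]

theorem climb_add (m n : ℕ) (v : V) :
    climb par (m + n) v = (climb par m v).bind (climb par n) := by
  induction m generalizing v with
  | zero => simp [climb]
  | succ m ih =>
    rw [Nat.add_right_comm]
    cases h : par v <;> simp [climb, h, ih]

theorem climb_succ_of_par {v u : V} (h : par v = some u) (n : ℕ) :
    climb par (n + 1) v = climb par n u := by
  simp [climb, h]

theorem climb_succ_of_none {v : V} (h : par v = none) (n : ℕ) : climb par (n + 1) v = none := by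
  simp [climb, h]

theorem climb_succ_right (n : ℕ) (v : V) :
    climb par (n + 1) v = (climb par n v).bind par := by
  rw [climb_add]; congr 1; funext x; exact climb_one x

/-- Every vertex has finitely many ancestors. -/
def IsForest (par : V → Option V) : Prop := ∀ v, ∃ n, climb par n v = none

open Classical in
/-- The number of vertices on the path from `v` to its root. -/
noncomputable def IsForest.level (hp : IsForest par) (v : V) : ℕ := Nat.find (hp v)

theorem IsForest.level_eq (hp : IsForest par) {v u : V} (h : par v = some u) :
    hp.level v = hp.level u + 1 := by
  classical
  unfold IsForest.level
  rw [Nat.find_comp_succ (hp v) ((hp u).imp fun n hn => by rwa [climb_succ_of_par h])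
    (by simp [climb])]
  congr 1
  simp only [climb_succ_of_par h]

theorem IsForest.level_climb (hp : IsForest par) {k : ℕ} {v u : V}
    (h : climb par k v = some u) : hp.level v = hp.level u + k := by
  induction k generalizing v with
  | zero => simp_all [climb]
  | succ k ih =>
    cases hv : par v with
    | none => simp [climb, hv] at h
    | some p =>
      rw [climb_succ_of_par hv] at h
      rw [hp.level_eq hv, ih h]; omega

theorem IsForest.induction (hp : IsForest par) {P : V → Prop}
    (step : ∀ v, (∀ u, par v = some u → P u) → P v) (v : V) : P v := by
  induction h : hp.level v using Nat.strong_induction_on generalizing v with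
  | _ n ih =>
    refine step v fun u hu => ih _ ?_ u rfl
    rw [← h, hp.level_eq hu]; omega

/-- `u` is an ancestor of `v`, or `v` itself. -/
def Anc (par : V → Option V) (u v : V) : Prop := ∃ k, climb par k v = some u

theorem Anc.refl (v : V) : Anc par v v := ⟨0, rfl⟩

theorem Anc.of_par {v u : V} (h : par v = some u) : Anc par u v := ⟨1, by rw [climb_one, h]⟩

theorem Anc.trans {x y z : V} (h : Anc par x y) (h' : Anc par y z) : Anc par x z := by
  obtain ⟨k, hk⟩ := h
  obtain ⟨l, hl⟩ := h'
  exact ⟨l + k, by rw [climb_add, hl]; exact hk⟩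

theorem Anc.eq_of_none {x v : V} (h : Anc par x v) (hv : par v = none) : x = v := by
  obtain ⟨k, hk⟩ := h
  cases k with
  | zero => simpa [climb, eq_comm] using hk
  | succ k => simp [climb, hv] at hk

theorem Anc.cases_par {x v u : V} (h : Anc par x v) (hv : par v = some u) :
    x = v ∨ Anc par x u := by
  obtain ⟨k, hk⟩ := h
  cases k with
  | zero => left; simpa [climb, eq_comm] using hk
  | succ k => right; exact ⟨k, by rwa [climb_succ_of_par hv] at hk⟩

theorem Anc.cases_child {x v : V} (h : Anc par x v) :
    x = v ∨ ∃ c, par c = some x ∧ Anc par c v := by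
  obtain ⟨k, hk⟩ := h
  cases k with
  | zero => left; simpa [climb, eq_comm] using hk
  | succ k =>
    right
    rw [climb_succ_right] at hk
    obtain ⟨c, hc, hx⟩ := Option.bind_eq_some_iff.1 hk
    exact ⟨c, hx, k, hc⟩

theorem Anc.total {x y v : V} (hx : Anc par x v) (hy : Anc par y v) :
    Anc par x y ∨ Anc par y x := by
  obtain ⟨k, hk⟩ := hx
  obtain ⟨l, hl⟩ := hy
  rcases le_total k l with h | h
  · right; refine ⟨l - k, ?_⟩
    rw [← Nat.add_sub_cancel' h, climb_add, hk] at hl; exact hl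
  · left; refine ⟨k - l, ?_⟩
    rw [← Nat.add_sub_cancel' h, climb_add, hl] at hk; exact hk

theorem IsForest.not_anc (hp : IsForest par) {c v : V} (h : par c = some v) : ¬ Anc par c v := by
  rintro ⟨k, hk⟩
  have := hp.level_climb hk
  have := hp.level_eq h
  omega

/-- Ancestors of one vertex are comparable. If one sibling were a proper ancestor of the other, it
would also be an ancestor of their common parent, which is a cycle. -/
theorem IsForest.sibling_eq (hp : IsForest par) {c c' v w : V} (hc : par c = some v)
    (hc' : par c' = some v) (h : Anc par c w) (h' : Anc par c' w) : c = c' := by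
  rcases h.total h' with h | h
  · exact (h.cases_par hc').resolve_right (hp.not_anc hc)
  · exact ((h.cases_par hc).resolve_right (hp.not_anc hc')).symm

theorem IsForest.exists_root (hp : IsForest par) (v : V) : ∃ r, par r = none ∧ Anc par r v := by
  induction v using hp.induction with
  | _ v ih =>
    cases h : par v with
    | none => exact ⟨v, h, Anc.refl v⟩
    | some u =>
      obtain ⟨r, hr, ha⟩ := ih u h
      exact ⟨r, hr, ha.trans (Anc.of_par h)⟩

/-- The `k + 1` vertices on the path have different levels, hence are distinct. This is why
`Fintype.card V` rounds are enough for every computation along a tree. -/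
theorem IsForest.climb_lt_card [Fintype V] (hp : IsForest par) {k : ℕ} {v u : V}
    (h : climb par k v = some u) : k < Fintype.card V := by
  have hs : ∀ i : Fin (k + 1), ∃ x, climb par i v = some x := by
    intro i
    rw [← Nat.add_sub_cancel' (Nat.lt_succ_iff.1 i.2), climb_add] at h
    obtain ⟨x, hx, -⟩ := Option.bind_eq_some_iff.1 h
    exact ⟨x, hx⟩
  choose g hg using hs
  have : Function.Injective g := by
    intro i j hij
    have h1 := hp.level_climb (hg i)
    have h2 := hp.level_climb (hg j)
    rw [hij] at h1
    exact Fin.ext (by omega)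
  simpa using Fintype.card_le_of_injective g this

theorem IsForest.climb_card [Fintype V] (hp : IsForest par) (v : V) :
    climb par (Fintype.card V) v = none := by
  cases h : climb par (Fintype.card V) v with
  | none => rfl
  | some u => exact absurd (hp.climb_lt_card h) (lt_irrefl _)

/-! ### Subtrees: sums and nested sets -/

open Classical in
/-- The vertices of the subtree rooted at `v`. -/
noncomputable def desc [Fintype V] (par : V → Option V) (v : V) : Finset V :=
  Finset.univ.filter (fun w => Anc par v w)

theorem mem_desc [Fintype V] {v w : V} : w ∈ desc par v ↔ Anc par v w := by
  simp [desc]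

/-- A subtree is its root together with the subtrees of the children, and acyclicity makes this
union disjoint. Every convergecast follows this recursion. -/
theorem IsForest.sum_desc [Fintype V] [DecidableEq V] {M : Type*} [AddCommMonoid M]
    (hp : IsForest par) (f : V → M) (v : V) :
    ∑ w ∈ desc par v, f w =
      f v + ∑ c ∈ Finset.univ.filter (fun c => par c = some v), ∑ w ∈ desc par c, f w := by
  have h : desc par v = insert v
      ((Finset.univ.filter (fun c => par c = some v)).biUnion (desc par)) := by
    ext w
    simp only [mem_desc, Finset.mem_insert, Finset.mem_biUnion, Finset.mem_filter,
      Finset.mem_univ, true_and]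
    constructor
    · intro hw
      exact hw.cases_child.imp Eq.symm id
    · rintro (rfl | ⟨c, hc, hw⟩)
      · exact Anc.refl _
      · exact (Anc.of_par hc).trans hw
  rw [h, Finset.sum_insert, Finset.sum_biUnion]
  · intro c hc c' hc' hne
    rw [Function.onFun, Finset.disjoint_left]
    intro w hw hw'
    simp only [Finset.coe_filter, Finset.mem_univ, true_and, Set.mem_ofPred_eq] at hc hc'
    exact hne (hp.sibling_eq hc hc' (mem_desc.1 hw) (mem_desc.1 hw'))
  · simp only [mem_desc, Finset.mem_biUnion, Finset.mem_filter,
      Finset.mem_univ, true_and, not_exists, not_and]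
    exact fun c hc => hp.not_anc hc

/-- Suppose that the set of every vertex contains the sets of its children, that the sets of
siblings are disjoint, and that every vertex reserves a part which no child shares. Then
the reserved parts are pairwise disjoint. -/
theorem IsForest.reserved_disjoint (hp : IsForest par) {I O : V → Set ℕ} {P : V → Prop}
    (hP : ∀ v u, par v = some u → P v → P u)
    (hsub : ∀ v u, par v = some u → I v ⊆ I u)
    (hsib : ∀ v w u s, par v = some u → par w = some u → s ∈ I v → s ∈ I w → v = w)
    (hroot : ∀ v w s, P v → P w → par v = none → par w = none → s ∈ I v → s ∈ I w → v = w)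
    (hO : ∀ v, O v ⊆ I v)
    (hOc : ∀ v u s, par v = some u → s ∈ O u → s ∉ I v)
    {v w : V} (hv : P v) (hw : P w) {s : ℕ} (hsv : s ∈ O v) (hsw : s ∈ O w) : v = w := by
  -- Inclusions compose along ancestor paths.
  have up : ∀ x y, Anc par x y → I y ⊆ I x ∧ (P y → P x) := by
    intro x y
    induction y using hp.induction with
    | _ y ih =>
      intro h
      cases hy : par y with
      | none => rw [h.eq_of_none hy]; exact ⟨subset_rfl, id⟩
      | some u =>
        rcases h.cases_par hy with rfl | h
        · exact ⟨subset_rfl, id⟩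
        · exact ⟨(hsub _ _ hy).trans (ih u hy h).1, (ih u hy h).2 ∘ hP _ _ hy⟩
  -- Sets that share a point lie on one path: two branches would separate at distinct siblings or at
  -- distinct roots, whose sets are disjoint.
  have comparable : ∀ x y, P x → P y → s ∈ I x → s ∈ I y → Anc par x y ∨ Anc par y x := by
    intro x
    induction x using hp.induction with
    | _ x ih =>
      intro y hx hy hsx hsy
      cases h : par x with
      | none =>
        obtain ⟨r, hr, ha⟩ := hp.exists_root y
        left
        rwa [hroot x r s hx ((up _ _ ha).2 hy) h hr hsx ((up _ _ ha).1 hsy)]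
      | some u =>
        rcases ih u h y (hP _ _ h hx) hy (hsub _ _ h hsx) hsy with ha | ha
        · rcases ha.cases_child with rfl | ⟨c, hc, hcy⟩
          · exact Or.inr (Anc.of_par h)
          · left
            rwa [hsib x c u s h hc hsx ((up _ _ hcy).1 hsy)]
        · exact Or.inr (ha.trans (Anc.of_par h))
  -- If `x` is a proper ancestor of `y`, then `s` lies in the set of the child of `x` towards `y`,
  -- and the reserved part of `x` avoids that set.
  have key : ∀ x y, s ∈ O x → s ∈ O y → Anc par x y → x = y := by
    intro x y hx hy ha
    rcases ha.cases_child with rfl | ⟨c, hc, hcy⟩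
    · rfl
    · exact absurd ((up _ _ hcy).1 (hO _ hy)) (hOc _ _ _ hc hx)
  rcases comparable v w hv hw (hO _ hsv) (hO _ hsw) with h | h
  · exact key v w hsv hsw h
  · exact (key w v hsw hsv h).symm

theorem desc_of_no_children [Fintype V] {v : V} (h : ∀ w, climb par 1 w ≠ some v) : desc par v = {v} := by
  ext w
  simp only [mem_desc, Finset.mem_singleton]
  constructor
  · intro hw
    rcases hw.cases_child with rfl | ⟨c, hc, -⟩
    · rfl
    · exact absurd (by rw [climb_one, hc]) (h c)
  · rintro rfl
    exact Anc.refl _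

theorem spread_eq {M : Type*} {x : V → Option M} {k n : ℕ} {v r : V} (hr : par r = none)
    (hk : climb par k v = some r) (hn : k ≤ n) : spread par x n v = x r := by
  induction n generalizing k v with
  | zero =>
    obtain rfl : k = 0 := by omega
    simp_all [climb, spread]
  | succ n ih =>
    cases h : par v with
    | none =>
      have : r = v := Anc.eq_of_none ⟨k, hk⟩ h
      simp [spread, h, this]
    | some p =>
      cases k with
      | zero => simp_all [climb]
      | succ k =>
        simp only [spread, h]
        exact ih (by rwa [climb_succ_of_par h] at hk) (by omega)

theorem IsForest.spread_card [Fintype V] (hp : IsForest par) {M : Type*} {x : V → Option M} {v r : V}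
    (hr : par r = none) (h : Anc par r v) : spread par x (Fintype.card V) v = x r := by
  obtain ⟨k, hk⟩ := h
  exact spread_eq hr hk (hp.climb_lt_card hk).le

end Forest

/-! ### Consecutive intervals -/

/-- The order of service is given by a separate `key`, since children are served by identifier but
base fragments and leaders by slot. -/
theorem prefix_sum_add_le {ι κ : Type*} [LinearOrder κ] (A : Finset ι) (key : ι → κ)
    (len : ι → ℕ) {i : ι} (hi : i ∈ A) {j : κ} (h : key i < j) :
    ∑ x ∈ A.filter (fun x => key x < key i), len x + len i ≤
      ∑ x ∈ A.filter (fun x => key x < j), len x := by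
  classical
  have hn : i ∉ A.filter (fun x => key x < key i) := by simp
  rw [add_comm, ← Finset.sum_insert hn]
  refine Finset.sum_le_sum_of_subset fun x hx => ?_
  rcases Finset.mem_insert.1 hx with rfl | hx
  · simp [hi, h]
  · simp only [Finset.mem_filter] at hx ⊢
    exact ⟨hx.1, hx.2.trans h⟩

theorem prefix_sum_add_le_total {ι κ : Type*} [LinearOrder κ] (A : Finset ι) (key : ι → κ)
    (len : ι → ℕ) {i : ι} (hi : i ∈ A) :
    ∑ x ∈ A.filter (fun x => key x < key i), len x + len i ≤ ∑ x ∈ A, len x := by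
  classical
  have hn : i ∉ A.filter (fun x => key x < key i) := by simp
  rw [add_comm, ← Finset.sum_insert hn]
  refine Finset.sum_le_sum_of_subset fun x hx => ?_
  rcases Finset.mem_insert.1 hx with rfl | hx
  · exact hi
  · exact (Finset.mem_filter.1 hx).1

/-- Intervals which are laid out one after the other are disjoint. -/
theorem prefix_interval_inj {ι κ : Type*} [LinearOrder κ] (A : Finset ι) (key : ι → κ)
    (len : ι → ℕ) {i j : ι} (hi : i ∈ A) (hj : j ∈ A) (hinj : key i = key j → i = j) {N s : ℕ}
    (h1 : N + ∑ x ∈ A.filter (fun x => key x < key i), len x ≤ s)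
    (h2 : s < N + ∑ x ∈ A.filter (fun x => key x < key i), len x + len i)
    (h3 : N + ∑ x ∈ A.filter (fun x => key x < key j), len x ≤ s)
    (h4 : s < N + ∑ x ∈ A.filter (fun x => key x < key j), len x + len j) : i = j := by
  rcases lt_trichotomy (key i) (key j) with h | h | h
  · have := prefix_sum_add_le A key len hi h
    omega
  · exact hinj h
  · have := prefix_sum_add_le A key len hj h
    omega

/-! ### Accumulation along rooted trees -/

/-- `ρ` relates the values combined by `comb` to what they stand for in a commutative monoid. -/
structure Accumulates {X N : Type*} [AddCommMonoid N] (comb : X → X → X) (e : X)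
    (ρ : X → N → Prop) : Prop where
  zero : ρ e 0
  add : ∀ {x y m n}, ρ x m → ρ y n → ρ (comb x y) (m + n)

theorem Accumulates.foldl {X N ι : Type*} [AddCommMonoid N] {comb : X → X → X} {e : X}
    {ρ : X → N → Prop} (h : Accumulates comb e ρ) {g : ι → X} {val : ι → N} {l : List ι}
    (hg : ∀ i ∈ l, ρ (g i) (val i)) {x : X} {n : N} (hx : ρ x n) :
    ρ ((l.map g).foldl comb x) (n + (l.map val).sum) := by
  induction l generalizing x n with
  | nil => simpa using hx
  | cons i l ih =>
    simp only [List.map_cons, List.foldl_cons, List.sum_cons, ← add_assoc]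
    exact ih (fun j hj => hg j (by simp [hj])) (h.add hx (hg i (by simp)))

section Trees

variable {V : Type u} [Fintype V] [LinearOrder V] {par : V → Option V}

theorem mem_children {v x : V} : x ∈ children par v ↔ par x = some v := by
  simp [children]

theorem sum_childList {N : Type*} [AddCommMonoid N] (val : V → N) (v : V) :
    ((childList par v).map val).sum = ∑ c ∈ children par v, val c := by
  rw [Finset.sum_eq_multiset_sum, ← Finset.sort_eq (children par v) (· ≤ ·), Multiset.map_coe,
    Multiset.sum_coe]
  rfl

theorem mem_childList {v x : V} : x ∈ childList par v ↔ par x = some v := by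
  simp [childList, mem_children]

theorem IsForest.sum_desc_children {N : Type*} [AddCommMonoid N] (hp : IsForest par) (f : V → N)
    (v : V) : ∑ w ∈ desc par v, f w = f v + ∑ c ∈ children par v, ∑ w ∈ desc par c, f w :=
  hp.sum_desc f v

/-- Information rises by one level per round. The hypothesis `hn` says that nothing lies `n + 1`
levels below `v`, so after `n` rounds the whole subtree of `v` has been heard. -/
theorem gather_rel (hp : IsForest par) {M N : Type*} [AddCommMonoid N] {f : M → M → M}
    {ρ : Option M → N → Prop} (hρ : Accumulates (Option.merge f) none ρ) {x : V → Option M}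
    {val : V → N} (hx : ∀ v, ρ (x v) (val v)) (n : ℕ) (v : V)
    (hn : ∀ w, climb par (n + 1) w ≠ some v) :
    ρ (gather par f x n v) (∑ w ∈ desc par v, val w) := by
  induction n generalizing v with
  | zero => simpa [gather, desc_of_no_children hn] using hx v
  | succ n ih =>
    rw [hp.sum_desc_children, ← sum_childList]
    refine hρ.foldl (fun c hc => ih c fun w hw => hn w ?_) (hx v)
    rw [climb_succ_right, hw]
    exact mem_childList.1 hc

theorem gather_card_rel (hp : IsForest par) {M N : Type*} [AddCommMonoid N] {f : M → M → M}
    {ρ : Option M → N → Prop} (hρ : Accumulates (Option.merge f) none ρ) {x : V → Option M}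
    {val : V → N} (hx : ∀ v, ρ (x v) (val v)) (v : V) :
    ρ (gather par f x (Fintype.card V) v) (∑ w ∈ desc par v, val w) := by
  refine gather_rel hp hρ hx _ v fun w hw => ?_
  have := hp.climb_lt_card hw
  omega

/-! ### Splitting intervals down a forest -/

theorem splitDown_succ {cache : V → ℕ} {top : V → Option ℕ} (n : ℕ) (v : V)
    (h : climb par (n + 1) v = none) :
    splitDown par cache top (n + 1) v = splitDown par cache top n v := by
  induction n generalizing v with
  | zero =>
    rw [climb_one] at h
    simp [splitDown, h]
  | succ n ih =>
    cases hv : par v with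
    | none => simp [splitDown, hv]
    | some p =>
      rw [climb_succ_of_par hv] at h
      have := ih p h
      rw [splitDown, splitDown]
      simp only [hv, this]

theorem splitDown_of_none {cache : V → ℕ} {top : V → Option ℕ} {v : V} (n : ℕ)
    (h : par v = none) : splitDown par cache top n v = top v := by
  cases n <;> simp [splitDown, h]

/-- After `Fintype.card V` rounds the values are stationary, so the recursion holds with the same
number of rounds on both sides. -/
theorem IsForest.splitDown_of_par (hp : IsForest par) {cache : V → ℕ} {top : V → Option ℕ}
    {v p : V} (h : par v = some p) :
    splitDown par cache top (Fintype.card V) v =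
      (splitDown par cache top (Fintype.card V) p).map
        (fun N => N + ∑ x ∈ (children par p).filter (fun x => x < v), cache x) := by
  rw [← splitDown_succ _ _ (by rw [climb_succ_right, hp.climb_card]; rfl), splitDown]
  simp only [h]

/-- The parts which the vertices keep when intervals are split down a rooted forest. -/
theorem IsForest.splitDown_kept (hp : IsForest par) {cache own : V → ℕ} {top : V → Option ℕ}
    (hc : ∀ v, cache v = own v + ∑ x ∈ children par v, cache x) {b : V → ℕ} {P : V → Prop}
    (hb : ∀ v, P v → splitDown par cache top (Fintype.card V) v = some (b v))
    (hP : ∀ v u, par v = some u → (P v ↔ P u))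
    (hroot : ∀ v w s, P v → P w → par v = none → par w = none → b v ≤ s → s < b v + cache v →
      b w ≤ s → s < b w + cache w → v = w) :
    (∀ r v, Anc par r v → P v → b r ≤ b v ∧ b v + cache v ≤ b r + cache r) ∧
    ∀ v w s, P v → P w → b v + ∑ x ∈ children par v, cache x ≤ s → s < b v + cache v →
      b w + ∑ x ∈ children par w, cache x ≤ s → s < b w + cache w → v = w := by
  have hbc : ∀ v u, par v = some u → P v →
      b v = b u + ∑ x ∈ (children par u).filter (fun x => x < v), cache x := by
    intro v u h hv
    have h1 := hp.splitDown_of_par (cache := cache) (top := top) h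
    rw [hb v hv, hb u ((hP v u h).1 hv)] at h1
    simpa using h1
  -- Children are served from the bottom, so the part that `u` keeps is the top end of its interval,
  -- above all the children's parts.
  have hle : ∀ v u, par v = some u → P v →
      b u ≤ b v ∧ b v + cache v ≤ b u + ∑ x ∈ children par u, cache x := by
    intro v u h hv
    have h1 := prefix_sum_add_le_total (children par u) id cache (mem_children.2 h)
    have h2 := hbc v u h hv
    simp only [id] at h1
    omega
  refine ⟨fun r v => ?_, fun v w s hv hw h1 h2 h3 h4 => ?_⟩
  · induction v using hp.induction with
    | _ v ih =>
      intro ha hv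
      cases h : par v with
      | none => rw [ha.eq_of_none h]; simp
      | some u =>
        rcases ha.cases_par h with rfl | ha
        · simp
        · have h1 := ih u h ha ((hP v u h).1 hv)
          have h2 := hle v u h hv
          have h3 := hc u
          omega
  -- Only the trees on which `P` holds have intervals, so `P` is made part of the sets.
  · refine hp.reserved_disjoint (P := P) (I := fun v => {s | P v ∧ b v ≤ s ∧ s < b v + cache v})
      (O := fun v => {s | P v ∧ b v + ∑ x ∈ children par v, cache x ≤ s ∧ s < b v + cache v})
      (fun v u h => (hP v u h).1) ?_ ?_ ?_ ?_ ?_ hv hw (s := s) ⟨hv, h1, h2⟩ ⟨hw, h3, h4⟩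
    · rintro v u h s ⟨hv, h1, h2⟩
      have h3 := hle v u h hv
      have h4 := hc u
      exact ⟨(hP v u h).1 hv, by omega, by omega⟩
    · rintro v w u s h h' ⟨hv, h1, h2⟩ ⟨hw, h3, h4⟩
      rw [hbc v u h hv] at h1 h2
      rw [hbc w u h' hw] at h3 h4
      exact prefix_interval_inj (children par u) id cache (mem_children.2 h) (mem_children.2 h')
        id h1 h2 h3 h4
    · rintro v w s hv hw h h' ⟨-, h1, h2⟩ ⟨-, h3, h4⟩
      exact hroot v w s hv hw h h' h1 h2 h3 h4
    · rintro v s ⟨hv, h1, h2⟩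
      exact ⟨hv, by omega, h2⟩
    · rintro v u s h ⟨-, h1, h2⟩ ⟨hv, h3, h4⟩
      have := hle v u h hv
      omega

end Trees

/-! ### The breadth-first tree -/

section BFS

variable {V : Type u} {G : SimpleGraph V} (T : BFSTree G)

theorem BFSTree.parent_eq_none {v : V} : T.parent v = none ↔ v = T.root := by
  constructor
  · intro h
    by_contra hv
    obtain ⟨p, hp, -⟩ := T.parent_adj v hv
    simp [h] at hp
  · rintro rfl
    exact T.parent_root

theorem BFSTree.depth_parent {v p : V} (h : T.parent v = some p) :
    T.depth v = T.depth p + 1 := by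
  have hv : v ≠ T.root := fun hv => by simp [T.parent_eq_none.2 hv] at h
  obtain ⟨q, hq, -, hd⟩ := T.parent_adj v hv
  rw [h] at hq
  cases hq
  exact hd

theorem BFSTree.isForest : IsForest T.parent := by
  intro v
  induction h : T.depth v generalizing v with
  | zero =>
    refine ⟨1, ?_⟩
    rw [climb_one]
    cases hp : T.parent v with
    | none => rfl
    | some p => have := T.depth_parent hp; omega
  | succ n ih =>
    cases hp : T.parent v with
    | none => exact ⟨1, by rw [climb_one, hp]⟩
    | some p =>
      have := T.depth_parent hp
      obtain ⟨k, hk⟩ := ih p (by omega)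
      exact ⟨k + 1, by rw [climb_succ_of_par hp, hk]⟩

theorem BFSTree.anc_root (v : V) : Anc T.parent T.root v := by
  obtain ⟨r, hr, ha⟩ := T.isForest.exists_root v
  rwa [← T.parent_eq_none.1 hr]

theorem BFSTree.depth_climb {k : ℕ} {v u : V} (h : climb T.parent k v = some u) :
    T.depth v = T.depth u + k := by
  induction k generalizing v with
  | zero => simp_all [climb]
  | succ k ih =>
    cases hv : T.parent v with
    | none => simp [climb, hv] at h
    | some p =>
      rw [climb_succ_of_par hv] at h
      rw [T.depth_parent hv, ih h]; omega

theorem BFSTree.onPath_refl (v : V) : T.OnPath v v := by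
  simp [BFSTree.OnPath, climb]

theorem BFSTree.onPath_parent {u p v : V} (h : T.OnPath u v) (hp : T.parent u = some p) :
    T.OnPath p v := by
  have h1 := T.depth_climb h
  have h2 := T.depth_parent hp
  rw [BFSTree.OnPath, show T.depth v - T.depth p = T.depth v - T.depth u + 1 by omega,
    climb_succ_right, h]
  exact hp

theorem BFSTree.depth_le_height [Fintype V] (v : V) : T.depth v ≤ T.height :=
  Finset.le_sup (f := T.depth) (Finset.mem_univ v)

theorem BFSTree.desc_root [Fintype V] : desc T.parent T.root = Finset.univ := by
  ext v
  simp [mem_desc, T.anc_root v]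

end BFS

/-! ### The exchange over the breadth-first tree -/

/-- Combinations in which at most one part carries a message. -/
def SoleMessage {A : Type*} (x : Option A) (s : Multiset A) : Prop :=
  s.card ≤ 1 → s = x.elim 0 (fun a => {a})

theorem soleMessage_self {A : Type*} (x : Option A) : SoleMessage x (x.elim 0 (fun a => {a})) :=
  fun _ => rfl

/-- Nothing is claimed about two colliding messages, so any `comb` with neutral element `none`
qualifies. -/
theorem accumulates_soleMessage {A : Type*} {comb : Option A → Option A → Option A}
    (h1 : ∀ x, comb none x = x) (h2 : ∀ x, comb x none = x) :
    Accumulates comb none SoleMessage where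
  zero := fun _ => rfl
  add := by
    intro x y m n hx hy h
    rw [Multiset.card_add] at h
    have hx := hx (by omega)
    have hy := hy (by omega)
    cases x with
    | none => simp_all
    | some a =>
      cases y with
      | none => simp_all
      | some b =>
        rw [hx, hy] at h
        simp at h

theorem SoleMessage.eq {A : Type*} {x y : Option A}
    (h : SoleMessage x (y.elim 0 (fun a => {a}))) : x = y := by
  cases y with
  | none =>
    have := h (by simp)
    cases x <;> simp_all
  | some b =>
    have := h (by simp)
    cases x <;> simp_all

section Exchange

variable {V : Type u} [Fintype V] [LinearOrder V] {G : SimpleGraph V} (T : BFSTree G)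

/-- Here `r` is the round of arrival at the tree root. In a pipelined upcast the quantity `t +
T.depth v` is constant along the way, so only messages with the same `r` are combined. Vertices
deeper than `r` would have to start before round `0` and must contribute nothing. -/
theorem upcast_rel {A N : Type*} [AddCommMonoid N] {comb : Option A → Option A → Option A}
    {ρ : Option A → N → Prop} (hρ : Accumulates comb none ρ) {inj : ℕ → V → Option A}
    {val : V → N} {r : ℕ} (hinj : ∀ t v, t + T.depth v = r → ρ (inj t v) (val v))
    (hval : ∀ v, r < T.depth v → val v = 0) (t : ℕ) (v : V) (ht : t + T.depth v = r) :
    ρ (upcast T comb inj t v) (∑ w ∈ desc T.parent v, val w) := by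
  induction t generalizing v with
  | zero =>
    rw [T.isForest.sum_desc_children, Finset.sum_eq_zero, add_zero, upcast]
    · exact hinj _ _ ht
    · intro c hc
      refine Finset.sum_eq_zero fun w hw => hval _ ?_
      obtain ⟨k, hk⟩ := mem_desc.1 hw
      have h1 := T.depth_climb hk
      have h2 := T.depth_parent (mem_children.1 hc)
      omega
  | succ t ih =>
    rw [T.isForest.sum_desc_children, upcast, ← sum_childList]
    refine hρ.foldl (fun c hc => ih c ?_) (hinj _ _ ht)
    have := T.depth_parent (mem_childList.1 hc)
    omega

theorem upcast_root_rel {A N : Type*} [AddCommMonoid N] {comb : Option A → Option A → Option A}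
    {ρ : Option A → N → Prop} (hρ : Accumulates comb none ρ) {inj : ℕ → V → Option A}
    {val : V → N} {r : ℕ} (hinj : ∀ t v, t + T.depth v = r → ρ (inj t v) (val v))
    (hval : ∀ v, r < T.depth v → val v = 0) :
    ρ (upcast T comb inj r T.root) (∑ w, val w) := by
  rw [← T.desc_root]
  exact upcast_rel T hρ hinj hval r T.root (by simp [T.depth_root])

/-- If at most one vertex sends a message in a slot, then it arrives at the tree root. -/
theorem upcast_root_sole {A : Type*} {comb : Option A → Option A → Option A}
    (h1 : ∀ x, comb none x = x) (h2 : ∀ x, comb x none = x) {inj : ℕ → V → Option A}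
    {μ : V → Option A} {r : ℕ} (hinj : ∀ t v, t + T.depth v = r → inj t v = μ v)
    (hμ : ∀ v, r < T.depth v → μ v = none) {m : Option A}
    (hm : (m = none ∧ ∀ w, μ w = none) ∨ ∃ w, μ w = m ∧ ∀ w' ≠ w, μ w' = none) :
    upcast T comb inj r T.root = m := by
  refine SoleMessage.eq ?_
  have := upcast_root_rel T (accumulates_soleMessage h1 h2) (inj := inj) (r := r)
    (val := fun v => (μ v).elim 0 (fun a => {a}))
    (fun t v h => by rw [hinj t v h]; exact soleMessage_self _) (fun v h => by simp [hμ v h])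
  convert this using 1
  rcases hm with ⟨rfl, h⟩ | ⟨w, rfl, h⟩
  · simp [h]
  · rw [Finset.sum_eq_single w (fun w' _ hw => by simp [h w' hw]) (by simp)]

/-- The tree root issues at most one message per round and each moves down one level per round, so
there are no collisions on the way down. A message for `w` passes `v` with delay `T.depth v`. -/
theorem downcast_filter {R : Type*} {out : ℕ → Option (R × V)} {w : V} (t : ℕ) {v : V}
    (h : T.OnPath v w) :
    (downcast T out t v).filter (fun m => decide (m.2 = w)) =
      if T.depth v ≤ t then (out (t - T.depth v)).filter (fun m => decide (m.2 = w))
      else none := by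
  induction t generalizing v with
  | zero =>
    by_cases hv : v = T.root
    · subst hv
      simp [downcast, T.depth_root]
    · have : 0 < T.depth v := by
        obtain ⟨p, -, -, hd⟩ := T.parent_adj v hv
        omega
      rw [if_neg (by omega)]
      simp [downcast, hv]
  | succ t ih =>
    cases hp : T.parent v with
    | none =>
      obtain rfl := T.parent_eq_none.1 hp
      simp [downcast, T.depth_root, hp]
    | some p =>
      have hd := T.depth_parent hp
      have := ih (T.onPath_parent h hp)
      simp only [downcast, hp, Option.filter_filter]
      rw [show t + 1 - T.depth v = t - T.depth p by omega]
      simp only [show T.depth v ≤ t + 1 ↔ T.depth p ≤ t by omega]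
      rw [← this]
      -- Since `v` is on the path to `w`, the routing test at `v` never drops a message for `w`.
      congr 1
      funext m
      by_cases hm : m.2 = w
      · simp [hm, h]
      · simp [hm]

theorem delivered_eq {R : Type*} {out : ℕ → Option (R × V)} (t : ℕ) (v : V) :
    ((downcast T out t v).filter (fun m => decide (m.2 = v))).map Prod.fst =
      if T.depth v ≤ t then
        ((out (t - T.depth v)).filter (fun m => decide (m.2 = v))).map Prod.fst
      else none := by
  rw [downcast_filter T t (T.onPath_refl v)]
  split <;> rfl

/-- The messages sent down by the tree root. -/
def rootOutput {σ A R : Type*} (comb : Option A → Option A → Option A) (inj : ℕ → V → Option A)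
    (s : σ) (step : σ → Option A → σ × Option (R × V)) (r : ℕ) : Option (R × V) :=
  (step (rootState step s (fun t => upcast T comb inj t T.root) r)
    (upcast T comb inj r T.root)).2

/-- All replies addressed to `v` are assumed equal, so it does not matter which of them is the
first. -/
theorem exchange_eq_some {σ A R : Type*} {Kb : ℕ} {comb : Option A → Option A → Option A}
    {inj : ℕ → V → Option A} {s : σ} {step : σ → Option A → σ × Option (R × V)} {v : V} {m : R}
    {r : ℕ} (hr : r ≤ 2 * Kb + T.height) (hm : rootOutput T comb inj s step r = some (m, v))
    (huniq : ∀ r' m', rootOutput T comb inj s step r' = some (m', v) → m' = m) :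
    exchange T Kb comb inj s step v = some m := by
  have key : ∀ l : List R, m ∈ l → (∀ m' ∈ l, m' = m) → l.head? = some m := by
    intro l h1 h2
    cases l with
    | nil => simp at h1
    | cons a l => simp [h2 a (by simp)]
  refine key _ ?_ ?_
  · rw [List.mem_filterMap]
    -- The delivery round is at most `2 * Kb + 2 * T.height`, the last round of the exchange.
    refine ⟨r + T.depth v, ?_, ?_⟩
    · have := T.depth_le_height v
      rw [List.mem_range]; omega
    · change Option.map Prod.fst (Option.filter _ (downcast T (rootOutput T comb inj s step) _ v)) = _
      rw [delivered_eq]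
      simp [hm]
  · intro m' h
    rw [List.mem_filterMap] at h
    obtain ⟨t, -, h⟩ := h
    change Option.map Prod.fst (Option.filter _ (downcast T (rootOutput T comb inj s step) _ v)) = _ at h
    rw [delivered_eq] at h
    split at h
    · obtain ⟨⟨a, l⟩, ha, rfl⟩ := Option.map_eq_some_iff.1 h
      obtain ⟨ha, hl⟩ := Option.filter_eq_some_iff.1 ha
      obtain rfl : l = v := by simpa using hl
      exact huniq _ _ ha
    · simp at h

theorem exchange_eq_none {σ A R : Type*} {Kb : ℕ} {comb : Option A → Option A → Option A}
    {inj : ℕ → V → Option A} {s : σ} {step : σ → Option A → σ × Option (R × V)} {v : V}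
    (h : ∀ r m, rootOutput T comb inj s step r ≠ some (m, v)) :
    exchange T Kb comb inj s step v = none := by
  refine List.head?_eq_none_iff.2 (List.filterMap_eq_nil_iff.2 fun t _ => ?_)
  change Option.map Prod.fst (Option.filter _ (downcast T (rootOutput T comb inj s step) _ v)) = _
  rw [delivered_eq]
  split
  · rw [Option.map_eq_none_iff, Option.filter_eq_none_iff]
    rintro ⟨a, l⟩ ha
    intro hl
    obtain rfl : l = v := by simpa using hl
    exact h _ _ ha
  · rfl

end Exchange

/-! ### Base fragments -/

section Base

variable {V : Type u} {G : SimpleGraph V} {β : Type w} (B : BaseFragments G β)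

theorem BaseFragments.root_injective : Function.Injective B.root := by
  intro b b' h
  have := B.base_root b
  rw [h, B.base_root] at this
  exact (Option.some.inj this).symm

theorem BaseFragments.rootIndex_eq_some [DecidableEq V] {v : V} {b : β} :
    B.rootIndex v = some b ↔ v = B.root b := by
  rw [BaseFragments.rootIndex, Option.filter_eq_some_iff]
  constructor
  · rintro ⟨-, h⟩
    simpa [eq_comm] using h
  · rintro rfl
    exact ⟨B.base_root b, by simp⟩

theorem BaseFragments.rootIndex_root [DecidableEq V] (b : β) :
    B.rootIndex (B.root b) = some b :=
  B.rootIndex_eq_some.2 rfl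

theorem BaseFragments.rootIndex_eq_none [DecidableEq V] {v : V} :
    B.rootIndex v = none ↔ ∀ b, v ≠ B.root b := by
  rw [Option.eq_none_iff_forall_ne_some]
  exact forall_congr' fun b => not_congr B.rootIndex_eq_some

theorem BaseFragments.base_parent {v u : V} (h : B.parent v = some u) : B.base u = B.base v := by
  cases hv : B.base v with
  | none => simp [B.parent_outside v hv] at h
  | some b =>
    have hr : v ≠ B.root b := by
      rintro rfl
      simp [B.parent_root] at h
    obtain ⟨p, hp, -, hb⟩ := B.parent_adj v b hv hr
    rw [h] at hp
    cases hp
    exact hb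

theorem BaseFragments.isForest : IsForest B.parent := by
  intro v
  cases hv : B.base v with
  | none => exact ⟨1, by rw [climb_one, B.parent_outside v hv]⟩
  | some b =>
    obtain ⟨k, hk⟩ := B.reaches_root v b hv
    exact ⟨k + 1, by rw [climb_succ_right, hk]; exact B.parent_root b⟩

theorem BaseFragments.base_anc {u v : V} (h : Anc B.parent u v) : B.base u = B.base v := by
  obtain ⟨k, hk⟩ := h
  induction k generalizing v with
  | zero => simp_all [climb]
  | succ k ih =>
    cases hv : B.parent v with
    | none => simp [climb, hv] at hk
    | some p =>
      rw [climb_succ_of_par hv] at hk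
      rw [ih hk, B.base_parent hv]

theorem BaseFragments.anc_root_iff {v : V} {b : β} :
    Anc B.parent (B.root b) v ↔ B.base v = some b := by
  constructor
  · intro h
    rw [← B.base_anc h, B.base_root]
  · exact B.reaches_root v b

theorem BaseFragments.eq_root_of_none {v : V} {b : β} (hv : B.base v = some b)
    (h : B.parent v = none) : v = B.root b :=
  ((B.anc_root_iff.2 hv).eq_of_none h).symm

theorem BaseFragments.desc_root [Fintype V] [DecidableEq β] (b : β) :
    desc B.parent (B.root b) = Finset.univ.filter (fun v => B.base v = some b) := by
  ext v
  simp [mem_desc, B.anc_root_iff]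

theorem BaseFragments.sum_rootIndex [Fintype V] [DecidableEq V] [Fintype β] {N : Type*}
    [AddCommMonoid N] (g : β → N) : ∑ v, (B.rootIndex v).elim 0 g = ∑ b, g b := by
  have h1 : ∑ b, g b = ∑ v ∈ Finset.univ.image B.root, (B.rootIndex v).elim 0 g := by
    rw [Finset.sum_image B.root_injective.injOn]
    simp [B.rootIndex_root]
  rw [h1]
  symm
  refine Finset.sum_subset (Finset.subset_univ _) fun v _ hv => ?_
  rw [B.rootIndex_eq_none.2]
  · rfl
  · rintro b rfl
    exact hv (Finset.mem_image_of_mem _ (Finset.mem_univ b))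

/-- Sums over the vertices of a fragment. -/
theorem BaseFragments.sum_fragment [Fintype V] [Fintype β] [DecidableEq β] {N : Type*}
    [AddCommMonoid N] (frag : β → β) (F : β) (g : V → N) :
    ∑ b ∈ Finset.univ.filter (fun b => frag b = F), ∑ v ∈ desc B.parent (B.root b), g v =
      ∑ v ∈ Finset.univ.filter (fun v => (B.base v).map frag = some F), g v := by
  classical
  simp only [B.desc_root]
  rw [← Finset.sum_biUnion]
  · refine Finset.sum_congr ?_ fun _ _ => rfl
    ext v
    simp [and_comm]
  · intro b _ b' _ hne
    rw [Function.onFun, Finset.disjoint_left]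
    intro v hv hv'
    simp only [Finset.mem_filter, Finset.mem_univ, true_and] at hv hv'
    rw [hv] at hv'
    exact hne (Option.some.inj hv')

end Base

/-! ### Correct slot sets -/

section SlotSet

variable {V : Type u} {G : SimpleGraph V} {β : Type w} [Fintype β] [DecidableEq β]
  {B : BaseFragments G β} {c : Convention} {frag : β → β} {S : Slots V β}

theorem Convention.extra_le_one (c : Convention) : c.extra ≤ 1 := by
  cases c <;> simp [Convention.extra]

theorem one_le_fragSize {F : β} (hF : frag F = F) : 1 ≤ fragSize frag F :=
  Finset.card_pos.2 ⟨F, by simp [hF]⟩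

theorem fslot_mem_pqRange {F : β} (hF : frag F = F) : S.fslot F ∈ pqRange c frag S F := by
  have := one_le_fragSize hF
  rw [pqRange, Finset.mem_Ico]
  omega

namespace IsPQSlotSet

theorem isLeader_iff (h : IsPQSlotSet B c frag S) {b : β} : IsLeader B S b ↔ frag b = b := by
  rw [IsLeader, (h.knows_leader b).1]
  exact B.root_injective.eq_iff

theorem hasQuery_iff (h : IsPQSlotSet B c frag S) {b : β} : HasQuery B c S b ↔ c.extra = 1 ∨ frag b ≠ b := by
  rw [HasQuery, h.isLeader_iff]

theorem fslot_le (h : IsPQSlotSet B c frag S) {F : β} (hF : frag F = F) : S.fslot F ≤ 2 * Fintype.card β :=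
  (Finset.mem_Icc.1 (h.range_subset F hF (fslot_mem_pqRange hF))).2

theorem fslot_inj (h : IsPQSlotSet B c frag S) {F F' : β} (hF : frag F = F) (hF' : frag F' = F')
    (he : S.fslot F = S.fslot F') : F = F' := by
  by_contra hne
  have h1 : S.fslot F ∈ pqRange c frag S F := fslot_mem_pqRange hF
  rw [he] at h1
  exact Finset.disjoint_left.1 (h.range_disjoint F F' hF hF' hne) h1 (fslot_mem_pqRange hF')

theorem fslot_eq_iff (h : IsPQSlotSet B c frag S) {b F : β} (hF : frag F = F) : S.fslot b = S.fslot F ↔ frag b = F := by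
  rw [(h.knows_leader b).2]
  constructor
  · exact h.fslot_inj (h.leader_mem b) hF
  · rintro rfl
    rfl

theorem query_cond (h : IsPQSlotSet B c frag S) {b : β} (hq : HasQuery B c S b) :
    b ∈ {x | frag x = frag b ∧ (c.extra = 1 ∨ x ≠ frag b)} :=
  ⟨rfl, (h.hasQuery_iff.1 hq).imp id Ne.symm⟩

theorem qslot_mem (h : IsPQSlotSet B c frag S) {b : β} (hq : HasQuery B c S b) :
    S.qslot b ∈ pqRange c frag S (frag b) ∧ S.qslot b ≠ S.fslot (frag b) := by
  have := (h.query_slots (frag b) (h.leader_mem b)).mapsTo (h.query_cond hq)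
  simpa using this

theorem fslot_lt_qslot (h : IsPQSlotSet B c frag S) {b : β} (hq : HasQuery B c S b) : S.fslot (frag b) < S.qslot b := by
  obtain ⟨h1, h2⟩ := h.qslot_mem hq
  rw [pqRange, Finset.mem_Ico] at h1
  omega

theorem qslot_le (h : IsPQSlotSet B c frag S) {b : β} (hq : HasQuery B c S b) : S.qslot b ≤ 2 * Fintype.card β :=
  (Finset.mem_Icc.1 (h.range_subset _ (h.leader_mem b) (h.qslot_mem hq).1)).2

theorem qslot_ne_fslot (h : IsPQSlotSet B c frag S) {b F : β} (hq : HasQuery B c S b) (hF : frag F = F) :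
    S.qslot b ≠ S.fslot F := by
  intro he
  by_cases hb : frag b = F
  · subst hb
    exact (h.qslot_mem hq).2 he
  · have h1 := (h.qslot_mem hq).1
    rw [he] at h1
    exact Finset.disjoint_left.1 (h.range_disjoint _ F (h.leader_mem b) hF hb) h1 (fslot_mem_pqRange hF)

theorem qslot_inj (h : IsPQSlotSet B c frag S) {b b' : β} (hq : HasQuery B c S b) (hq' : HasQuery B c S b')
    (he : S.qslot b = S.qslot b') : b = b' := by
  by_cases hb : frag b = frag b'
  · refine (h.query_slots (frag b) (h.leader_mem b)).injOn (h.query_cond hq) ?_ he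
    rw [hb]
    exact h.query_cond hq'
  · have h1 := (h.qslot_mem hq).1
    rw [he] at h1
    exact absurd (h.qslot_mem hq').1
      (Finset.disjoint_left.1 (h.range_disjoint _ _ (h.leader_mem b) (h.leader_mem b') hb) h1)

/-- This is the surjectivity of the slot assignment: between the publication of `F` and the end of
its range no slot is idle. -/
theorem exists_query (h : IsPQSlotSet B c frag S) {F : β} (hF : frag F = F) {i : ℕ} (h1 : S.fslot F < i)
    (h2 : i < S.fslot F + (fragSize frag F + c.extra)) :
    ∃ b, frag b = F ∧ HasQuery B c S b ∧ S.qslot b = i := by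
  obtain ⟨b, ⟨hb, hb'⟩, rfl⟩ := (h.query_slots F hF).surjOn (show i ∈ _ by
    simp only [Finset.coe_sdiff, pqRange, Finset.coe_Ico, Finset.coe_singleton, Set.mem_sdiff,
      Set.mem_Ico, Set.mem_singleton_iff]
    omega)
  refine ⟨b, hb, h.hasQuery_iff.2 (hb'.imp id fun hne => ?_), rfl⟩
  rw [hb]
  exact hne.symm

end IsPQSlotSet

end SlotSet

/-! ### Convergecast cycles -/

section Cycles

variable {V : Type u} [Fintype V] [LinearOrder V] {G : SimpleGraph V} {β : Type w} [Fintype β]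
  [DecidableEq β] (T : BFSTree G) {B : BaseFragments G β} {c : Convention} {frag : β → β}
  {S : Slots V β}

theorem map_fst_aggregate {M : Type*} [DecidableEq M] (f : M → M → M) (x y : Option (M × V)) :
    (aggregate f x y).map Prod.fst = Option.merge f (x.map Prod.fst) (y.map Prod.fst) := by
  rcases x with _ | ⟨a, l⟩ <;> rcases y with _ | ⟨b, l'⟩ <;> simp [aggregate]
  split <;> simp_all

theorem label_aggregate {M : Type*} [DecidableEq M] {f : M → M → M} {x y : Option (M × V)}
    {P : V → Prop} (hx : ∀ m ∈ x, P m.2) (hy : ∀ m ∈ y, P m.2) : ∀ m ∈ aggregate f x y, P m.2 := by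
  rcases x with _ | ⟨a, l⟩ <;> rcases y with _ | ⟨b, l'⟩ <;> simp only [aggregate]
  · simp
  · exact hy
  · exact hx
  · split
    · simpa using hx _ rfl
    · simpa using hy _ rfl

/-- The label kept by `aggregate` depends on the order of aggregation, so only a property `P` shared
by all the labels can be tracked. In a window of one fragment all labels agree. -/
theorem accumulates_aggregate {M N : Type*} [DecidableEq M] [AddCommMonoid N] {f : M → M → M}
    {ρ : Option M → N → Prop} (hρ : Accumulates (Option.merge f) none ρ) (P : V → Prop) :
    Accumulates (aggregate f) none
      (fun (x : Option (M × V)) n => ρ (x.map Prod.fst) n ∧ ∀ m ∈ x, P m.2) where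
  zero := ⟨hρ.zero, by simp⟩
  add := fun hx hy => ⟨by rw [map_fst_aggregate]; exact hρ.add hx.1 hy.1,
    label_aggregate hx.2 hy.2⟩

namespace IsPQSlotSet

/-- The outcome of the extrinsic step at the leader `F`. -/
theorem extrinsic_rel (h : IsPQSlotSet B c frag S) {M N : Type*} [DecidableEq M]
    [AddCommMonoid N] {f : M → M → M} {ρ : Option M → N → Prop}
    (hρ : Accumulates (Option.merge f) none ρ) {y : V → Option M} {val : β → N}
    (hy : ∀ b, ρ (y (B.root b)) (val b)) {F : β} (hF : frag F = F) :
    ρ (extrinsic T B S f y (B.root F)) (∑ b ∈ Finset.univ.filter (fun b => frag b = F), val b) := by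
  set inj : ℕ → V → Option (M × V) := fun t v => (B.rootIndex v).bind (fun b =>
    if AtSlot T (S.fslot b) t v then (y v).map (fun m => (m, S.lbl b)) else none) with hinj
  -- Round `r` at the tree root collects exactly the base fragments whose fragment slot is `r -
  -- T.height`.
  have round : ∀ r,
      ρ ((upcast T (aggregate f) inj r T.root).map Prod.fst)
        (∑ b, if r = T.height + S.fslot b then val b else 0) ∧
      ∀ m ∈ upcast T (aggregate f) inj r T.root,
        ∃ b, r = T.height + S.fslot b ∧ m.2 = B.root (frag b) := by
    intro r
    have := upcast_root_rel T (accumulates_aggregate hρ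
      (fun l => ∃ b, r = T.height + S.fslot b ∧ l = B.root (frag b))) (inj := inj) (r := r)
      (val := fun v => (B.rootIndex v).elim 0
        (fun b => if r = T.height + S.fslot b then val b else 0)) ?_ ?_
    · rwa [B.sum_rootIndex] at this
    · intro t v ht
      simp only [hinj]
      cases hv : B.rootIndex v with
      | none => exact ⟨hρ.zero, by simp⟩
      | some b =>
        obtain rfl := B.rootIndex_eq_some.1 hv
        simp only [Option.bind_some, Option.elim_some, AtSlot, ht]
        split
        · rename_i hr
          refine ⟨?_, ?_⟩
          · rw [Option.map_map]
            convert hy b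
            exact Option.map_id'
          · intro m hm
            obtain ⟨a, -, rfl⟩ := Option.map_eq_some_iff.1 hm
            exact ⟨b, hr, (h.knows_leader b).1⟩
        · exact ⟨hρ.zero, by simp⟩
    · intro v hv
      have := T.depth_le_height v
      cases B.rootIndex v with
      | none => rfl
      | some b =>
        simp only [Option.elim_some]
        rw [if_neg (by omega)]
  have hout : ∀ r, rootOutput T (aggregate f) inj () (fun _ a => ((), a)) r =
      upcast T (aggregate f) inj r T.root := fun r => rfl
  have hF1 := (round (T.height + S.fslot F)).1
  -- Different fragments have different slots, so the window of `F` sums over `F` alone.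
  simp only [Nat.add_left_cancel_iff, eq_comm (a := S.fslot F), h.fslot_eq_iff hF,
    ← Finset.sum_filter] at hF1
  -- No other window produces a message addressed to the leader of `F`, so what it receives is
  -- unambiguous.
  have hslot : ∀ r m, upcast T (aggregate f) inj r T.root = some (m, B.root F) →
      r = T.height + S.fslot F := by
    intro r m hr
    obtain ⟨b, rfl, hb⟩ := (round r).2 _ hr
    obtain rfl := B.root_injective hb
    rw [(h.knows_leader b).2]
  unfold extrinsic
  cases hm : upcast T (aggregate f) inj (T.height + S.fslot F) T.root with
  | none =>
    rw [exchange_eq_none]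
    · rwa [hm] at hF1
    · intro r m hr
      rw [hout] at hr
      rw [hslot r m hr, hm] at hr
      cases hr
  | some ml =>
    obtain ⟨m, l⟩ := ml
    obtain ⟨b, hb, hl⟩ := (round _).2 _ hm
    have hb : frag b = F := (h.fslot_eq_iff hF).1 (by omega)
    subst hb
    simp only at hl
    subst hl
    rw [exchange_eq_some T (m := m) (r := T.height + S.fslot (frag b))]
    · rwa [hm] at hF1
    · have := h.fslot_le hF
      omega
    · rw [hout, hm]
    · intro r m' hr
      rw [hout] at hr
      rw [hslot r m' hr, hm] at hr
      simpa [eq_comm] using hr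

/-- The outcome of a convergecast cycle at the leader `F`. -/
theorem convergecast_rel (h : IsPQSlotSet B c frag S) {M N : Type*} [DecidableEq M]
    [AddCommMonoid N] {f : M → M → M} {ρ : Option M → N → Prop}
    (hρ : Accumulates (Option.merge f) none ρ) {x : V → Option M} {val : V → N}
    (hx : ∀ v, ρ (x v) (val v)) {F : β} (hF : frag F = F) :
    ρ (convergecast T B S f x (B.root F))
      (∑ v ∈ Finset.univ.filter (fun v => (B.base v).map frag = some F), val v) := by
  rw [← B.sum_fragment]
  exact h.extrinsic_rel T hρ (fun b => gather_card_rel B.isForest hρ hx _) hF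

/-- If only one vertex of the fragment `F` contributes, its leader receives this contribution. -/
theorem convergecast_sole (h : IsPQSlotSet B c frag S) {M : Type*} [DecidableEq M]
    {f : M → M → M} {x : V → Option M} {F : β} (hF : frag F = F) {v : V}
    (hv : (B.base v).map frag = some F)
    (hx : ∀ w, (B.base w).map frag = some F → w ≠ v → x w = none) :
    convergecast T B S f x (B.root F) = x v := by
  refine SoleMessage.eq ?_
  have := h.convergecast_rel T (f := f) (accumulates_soleMessage (comb := Option.merge f)
    (by simp) (by simp)) (fun v => soleMessage_self (x v)) hF
  convert this using 1
  rw [Finset.sum_eq_single v]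
  · intro w hw hne
    simp [hx w (by simpa using hw) hne]
  · intro hn
    exact absurd (Finset.mem_filter.2 ⟨Finset.mem_univ v, hv⟩) hn

theorem convergecast_none (h : IsPQSlotSet B c frag S) {M : Type*} [DecidableEq M]
    {f : M → M → M} {x : V → Option M} {F : β} (hF : frag F = F)
    (hx : ∀ w, (B.base w).map frag = some F → x w = none) :
    convergecast T B S f x (B.root F) = none := by
  refine SoleMessage.eq (y := none) ?_
  have := h.convergecast_rel T (f := f) (accumulates_soleMessage (comb := Option.merge f)
    (by simp) (by simp)) (fun v => soleMessage_self (x v)) hF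
  convert this using 1
  symm
  refine Finset.sum_eq_zero fun w hw => ?_
  simp [hx w (by simpa using hw)]

end IsPQSlotSet

/-- For sums, a missing message counts as `0`. -/
theorem accumulates_getD {M : Type*} [AddCommMonoid M] :
    Accumulates (Option.merge (· + ·)) none (fun (x : Option M) n => x.getD 0 = n) where
  zero := rfl
  add := by
    intro x y m n hx hy
    subst hx hy
    cases x <;> cases y <;> simp

/-! ### Cycles with publishing and query slots -/

/-- A tree root which stores the last published message, sends it in reply to every query and
updates it after every query. -/
def serverStep {σ Q : Type*} (upd : σ → Q → σ) (s : σ) :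
    Option (Msg V σ Q) → σ × Option (σ × V)
  | none => (s, none)
  | some (Msg.publish m) => (m, none)
  | some (Msg.query q l) => (upd s q, some (s, l))

theorem broadcastStep_eq {M : Type*} :
    broadcastStep (V := V) (M := M) = serverStep (fun s _ => s) := by
  funext s m
  rcases m with _ | ⟨m⟩ | ⟨q, l⟩ <;> rfl

theorem allocStep_eq :
    allocStep (V := V) = serverStep (fun s q => s.map (fun N => N + q)) := by
  funext s m
  rcases m with _ | ⟨m⟩ | ⟨q, l⟩ <;> rfl

namespace IsPQSlotSet

/-! ### What arrives at the tree root in each window -/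

section Stream

variable {P Q : Type*} {m : β → P} {q : β → Q}

/-- In this window only the leader of `F` sends: the other leaders have other slots, and no query
slot is a publishing slot. -/
theorem upcast_publish (h : IsPQSlotSet B c frag S) {F : β} (hF : frag F = F) :
    upcast T Option.or (pqInject T B c S m q) (T.height + S.fslot F) T.root =
      some (Msg.publish (m F)) := by
  refine upcast_root_sole T (by simp) (by simp)
    (μ := fun v => if v = B.root F then some (Msg.publish (m F)) else none) ?_ ?_
    (Or.inr ⟨B.root F, by simp, fun w hw => by simp [hw]⟩)
  · intro t v ht
    unfold pqInject
    cases hv : B.rootIndex v with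
    | none => simp [B.rootIndex_eq_none.1 hv F]
    | some b =>
      obtain rfl := B.rootIndex_eq_some.1 hv
      simp only [Option.bind_some, AtSlot, ht, Nat.add_left_cancel_iff, h.isLeader_iff,
        B.root_injective.eq_iff]
      by_cases hb : b = F
      · subst hb
        simp [hF]
      · rw [if_neg, if_neg, if_neg hb]
        · rintro ⟨hq, he⟩
          exact h.qslot_ne_fslot hq hF he.symm
        · rintro ⟨hb', he⟩
          exact hb (h.fslot_inj hb' hF he.symm)
  · intro v hv
    have := T.depth_le_height v
    omega

theorem upcast_query (h : IsPQSlotSet B c frag S) {b : β} (hq : HasQuery B c S b) :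
    upcast T Option.or (pqInject T B c S m q) (T.height + S.qslot b) T.root =
      some (Msg.query (q b) (B.root b)) := by
  refine upcast_root_sole T (by simp) (by simp)
    (μ := fun v => if v = B.root b then some (Msg.query (q b) (B.root b)) else none) ?_ ?_
    (Or.inr ⟨B.root b, by simp, fun w hw => by simp [hw]⟩)
  · intro t v ht
    unfold pqInject
    cases hv : B.rootIndex v with
    | none => simp [B.rootIndex_eq_none.1 hv b]
    | some b' =>
      obtain rfl := B.rootIndex_eq_some.1 hv
      simp only [Option.bind_some, AtSlot, ht, Nat.add_left_cancel_iff, h.isLeader_iff,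
        B.root_injective.eq_iff]
      rw [if_neg (fun ⟨hb', he⟩ => h.qslot_ne_fslot hq hb' he)]
      by_cases hb : b' = b
      · subst hb
        simp [hq]
      · rw [if_neg, if_neg hb]
        rintro ⟨hq', he⟩
        exact hb (h.qslot_inj hq' hq he.symm)
  · intro v hv
    have := T.depth_le_height v
    omega

/-- Needed for the uniqueness of replies: a query names its sender, and that sender has a single
query slot. -/
theorem upcast_query_inv (h : IsPQSlotSet B c frag S) {r : ℕ} {a : Q} {l : V}
    (hr : upcast T Option.or (pqInject T B c S m q) r T.root = some (Msg.query a l)) :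
    ∃ b, HasQuery B c S b ∧ r = T.height + S.qslot b ∧ l = B.root b := by
  by_cases h1 : ∃ F, frag F = F ∧ r = T.height + S.fslot F
  · obtain ⟨F, hF, rfl⟩ := h1
    rw [h.upcast_publish T hF] at hr
    simp at hr
  by_cases h2 : ∃ b, HasQuery B c S b ∧ r = T.height + S.qslot b
  · obtain ⟨b, hb, rfl⟩ := h2
    rw [h.upcast_query T hb] at hr
    simp only [Option.some.injEq, Msg.query.injEq] at hr
    exact ⟨b, hb, rfl, hr.2.symm⟩
  rw [upcast_root_sole T (m := none) (by simp) (by simp) (μ := fun _ => none) ?_ (by simp)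
    (Or.inl (by simp))] at hr
  · cases hr
  · intro t v ht
    unfold pqInject
    cases hv : B.rootIndex v with
    | none => rfl
    | some b =>
      simp only [Option.bind_some, AtSlot, ht, h.isLeader_iff]
      rw [if_neg (fun h' => h1 ⟨b, h'⟩), if_neg (fun h' => h2 ⟨b, h'⟩)]

end Stream

/-- The replies in a cycle with publishing and query slots. The state of the tree root before the
window of slot `i` of the fragment `F` is `st i`. -/
theorem server_reply (h : IsPQSlotSet B c frag S) {σ Q : Type*} {upd : σ → Q → σ} {m : β → σ}
    {q : β → Q} {s₀ : σ} {F : β} {st : ℕ → σ} (h0 : st (S.fslot F + 1) = m F)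
    (hst : ∀ b, frag b = F → HasQuery B c S b → st (S.qslot b + 1) = upd (st (S.qslot b)) (q b))
    {b : β} (hb : frag b = F) (hq : HasQuery B c S b) :
    exchange T (Fintype.card β) Option.or (pqInject T B c S m q) s₀ (serverStep upd) (B.root b) =
      some (st (S.qslot b)) := by
  have hF : frag F = F := by rw [← hb]; exact h.leader_mem b
  set inp : ℕ → Option (Msg V σ Q) :=
    fun t => upcast T Option.or (pqInject T B c S m q) t T.root with hinp
  have state : ∀ i, S.fslot F + 1 + i ≤ S.fslot F + (fragSize frag F + c.extra) →
      rootState (serverStep upd) s₀ inp (T.height + (S.fslot F + 1 + i)) =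
        st (S.fslot F + 1 + i) := by
    intro i
    induction i with
    | zero =>
      intro _
      -- The publication overwrites whatever other fragments have left at the tree root.
      rw [Nat.add_zero, ← Nat.add_assoc, rootState]
      simp only [hinp, h.upcast_publish T hF, h0]
      rfl
    | succ i ih =>
      intro hi
      -- The next slot holds exactly one query, and it comes from `F`, so `hst` describes the change
      -- of state.
      obtain ⟨b', hb', hq', hs⟩ := h.exists_query hF (i := S.fslot F + 1 + i) (by omega) (by omega)
      have ih := ih (by omega)
      rw [← hs] at ih
      rw [show S.fslot F + 1 + (i + 1) = S.qslot b' + 1 by omega, ← Nat.add_assoc, rootState, ih,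
        hst b' hb' hq']
      simp only [hinp, h.upcast_query T hq']
      rfl
  have hmem := (h.qslot_mem hq).1
  have hlt := h.fslot_lt_qslot hq
  rw [hb, pqRange, Finset.mem_Ico] at hmem
  rw [hb] at hlt
  have hs := state (S.qslot b - (S.fslot F + 1)) (by omega)
  rw [show S.fslot F + 1 + (S.qslot b - (S.fslot F + 1)) = S.qslot b by omega] at hs
  have hout : rootOutput T Option.or (pqInject T B c S m q) s₀ (serverStep upd)
      (T.height + S.qslot b) = some (st (S.qslot b), B.root b) := by
    unfold rootOutput
    rw [hs, h.upcast_query T hq]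
    rfl
  refine exchange_eq_some T (r := T.height + S.qslot b) ?_ hout ?_
  · have := h.qslot_le hq
    omega
  · intro r m' hr
    have hquery : ∃ a, upcast T Option.or (pqInject T B c S m q) r T.root =
        some (Msg.query a (B.root b)) := by
      unfold rootOutput at hr
      rcases hu : upcast T Option.or (pqInject T B c S m q) r T.root with _ | ⟨a⟩ | ⟨a, l⟩ <;>
        simp only [hu, serverStep, reduceCtorEq, Option.some.injEq, Prod.mk.injEq] at hr
      exact ⟨a, by rw [hr.2]⟩
    obtain ⟨a, ha⟩ := hquery
    obtain ⟨b', -, rfl, hl⟩ := h.upcast_query_inv T ha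
    obtain rfl := B.root_injective hl
    rw [hout] at hr
    simpa [eq_comm] using hr

/-- A broadcast cycle informs all vertices of a fragment. -/
theorem broadcast_eq (h : IsPQSlotSet B c frag S) {M : Type*} (m : β → Option M) (v : V) :
    broadcast T B c S m v = (B.base v).bind (fun b => m (frag b)) := by
  unfold broadcast
  cases hv : B.base v with
  | none =>
    rw [B.isForest.spread_card (B.parent_outside v hv) (Anc.refl v), B.rootIndex_eq_none.2]
    · rfl
    · rintro b rfl
      simp [B.base_root] at hv
  | some b =>
    rw [B.isForest.spread_card (B.parent_root b) (B.anc_root_iff.2 hv), B.rootIndex_root]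
    simp only [Option.bind_some]
    split
    · rename_i hl
      rw [h.isLeader_iff.1 hl]
    · rename_i hl
      -- Queries do not change a broadcast message, so the state is constant on the range.
      rw [broadcastStep_eq, h.server_reply T (F := frag b) (st := fun _ => m (frag b)) rfl
        (fun _ _ _ => rfl) rfl (Or.inr hl)]
      rfl

end IsPQSlotSet

/-- The position of `b` in the sequence of requests of its fragment. -/
def requestKey (B : BaseFragments G β) (c : Convention) (S : Slots V β) (b : β) : ℕ :=
  if HasQuery B c S b then S.qslot b else S.fslot b

theorem requestKey_of_query {b : β} (hq : HasQuery B c S b) : requestKey B c S b = S.qslot b :=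
  if_pos hq

theorem requestKey_of_not_query {b : β} (hq : ¬ HasQuery B c S b) :
    requestKey B c S b = S.fslot b :=
  if_neg hq

namespace IsPQSlotSet

/-- Query slots are distinct and come after the leader's slot, and the leader is the only base
fragment of its fragment that can lack a query slot. -/
theorem requestKey_inj (h : IsPQSlotSet B c frag S) {b b' : β} (hb : frag b = frag b')
    (he : requestKey B c S b = requestKey B c S b') : b = b' := by
  unfold requestKey at he
  split at he <;> split at he
  · exact h.qslot_inj ‹_› ‹_› he
  · rename_i h1 _
    have := h.fslot_lt_qslot h1
    rw [hb, ← (h.knows_leader b').2] at this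
    omega
  · rename_i h1
    have := h.fslot_lt_qslot h1
    rw [← hb, ← (h.knows_leader b).2] at this
    omega
  · rename_i h1 h2
    rw [h.hasQuery_iff] at h1 h2
    push Not at h1 h2
    rw [← h1.2, ← h2.2, hb]

theorem fslot_le_requestKey (h : IsPQSlotSet B c frag S) (b : β) :
    S.fslot (frag b) ≤ requestKey B c S b := by
  unfold requestKey
  split
  · exact (h.fslot_lt_qslot ‹_›).le
  · exact (h.knows_leader b).2.ge

/-- The parts of an interval claimed by the base fragments of a fragment. -/
theorem allocate_eq (h : IsPQSlotSet B c frag S) (m : β → Option ℕ) (s : β → ℕ) (b : β) :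
    allocate T B c S m s b = (m (frag b)).map (fun N => N +
      ∑ x ∈ (Finset.univ.filter (fun x => frag x = frag b)).filter
        (fun x => requestKey B c S x < requestKey B c S b), s x) := by
  unfold allocate
  dsimp only
  split
  · rename_i hq
    -- Before slot `i` the range bottom has moved past all requests with smaller keys.
    rw [allocStep_eq, h.server_reply T (F := frag b) (st := fun i => (m (frag b)).map (fun N => N +
      ∑ x ∈ (Finset.univ.filter (fun x => frag x = frag b)).filter
        (fun x => requestKey B c S x < i), s x)) ?_ ?_ rfl hq]
    · rw [requestKey_of_query hq]
      rfl
    -- Right after the publication: a leader with a query slot has published the plain bottom and no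
    -- request has been served; a leader without one has already added its own request, the only one
    -- whose key is the leader's slot.
    · by_cases hF : HasQuery B c S (frag b)
      · rw [if_pos hF, Finset.filter_eq_empty_iff.2]
        · simp
        · intro x hx
          simp only [Finset.mem_filter, Finset.mem_univ, true_and] at hx
          have hqx : HasQuery B c S x := by
            rw [h.hasQuery_iff, h.leader_mem] at hF
            exact h.hasQuery_iff.2 (Or.inl (by simpa using hF))
          have := h.fslot_lt_qslot hqx
          rw [hx] at this
          rw [requestKey_of_query hqx]
          omega
      · rw [if_neg hF]
        have : (Finset.univ.filter (fun x => frag x = frag b)).filter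
            (fun x => requestKey B c S x < S.fslot (frag b) + 1) = {frag b} := by
          ext x
          simp only [Finset.mem_filter, Finset.mem_univ, true_and, Finset.mem_singleton]
          constructor
          · rintro ⟨hx, hlt⟩
            by_contra hne
            have hqx : HasQuery B c S x := h.hasQuery_iff.2 (Or.inr (by rw [hx]; exact Ne.symm hne))
            have := h.fslot_lt_qslot hqx
            rw [hx] at this
            rw [requestKey_of_query hqx] at hlt
            omega
          · rintro rfl
            refine ⟨h.leader_mem b, ?_⟩
            rw [requestKey_of_not_query hF]
            exact Nat.lt_succ_self _
        simp only [this, Finset.sum_singleton]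
    · intro b' hb' hq'
      have : (Finset.univ.filter (fun x => frag x = frag b)).filter
          (fun x => requestKey B c S x < S.qslot b' + 1) =
          insert b' ((Finset.univ.filter (fun x => frag x = frag b)).filter
            (fun x => requestKey B c S x < S.qslot b')) := by
        ext x
        simp only [Finset.mem_filter, Finset.mem_univ, true_and, Finset.mem_insert]
        have hk := requestKey_of_query hq'
        constructor
        · rintro ⟨hx, hlt⟩
          rcases Nat.lt_succ_iff_lt_or_eq.1 hlt with hlt | he
          · exact Or.inr ⟨hx, hlt⟩
          · exact Or.inl (h.requestKey_inj (by rw [hx, hb']) (by rw [he, hk]))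
        · rintro (rfl | ⟨hx, hlt⟩)
          · exact ⟨hb', by omega⟩
          · exact ⟨hx, by omega⟩
      rw [this, Finset.sum_insert (by simp [requestKey_of_query hq']), Option.map_map]
      congr 1
      funext N
      simp only [Function.comp]
      omega
  · rename_i hq
    have hb : frag b = b := by
      rw [h.hasQuery_iff] at hq
      push Not at hq
      exact hq.2
    rw [Finset.filter_eq_empty_iff.2]
    · simp [hb]
    · intro x hx
      simp only [Finset.mem_filter, Finset.mem_univ, true_and] at hx
      have := h.fslot_le_requestKey x
      rw [hx, hb] at this
      rw [requestKey_of_not_query hq]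
      omega

/-- The intervals received by the leaders in the variant without publishing slots. -/
theorem allocateLeaders_eq (h : IsPQSlotSet B c frag S) (s : β → Option ℕ) {F : β}
    (hF : frag F = F) :
    allocateLeaders T B S s F = (s F).map (fun _ => 1 +
      ∑ x ∈ (Finset.univ.filter (fun x => frag x = x)).filter (fun x => S.fslot x < S.fslot F),
        (s x).getD 0) := by
  unfold allocateLeaders
  dsimp only
  set inj : ℕ → V → Option (Msg V (Option ℕ) ℕ) := fun t v => (B.rootIndex v).bind (fun b =>
    if IsLeader B S b ∧ AtSlot T (S.fslot b) t v then
      (s b).map (fun n => Msg.query n (B.root b)) else none) with hinj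
  have hleader : ∀ F, frag F = F → upcast T Option.or inj (T.height + S.fslot F) T.root =
      (s F).map (fun n => Msg.query n (B.root F)) := by
    intro F hF
    refine upcast_root_sole T (by simp) (by simp)
      (μ := fun v => if v = B.root F then (s F).map (fun n => Msg.query n (B.root F)) else none)
      ?_ ?_ (Or.inr ⟨B.root F, by simp, fun w hw => by simp [hw]⟩)
    · intro t v ht
      simp only [hinj]
      cases hv : B.rootIndex v with
      | none => simp [B.rootIndex_eq_none.1 hv F]
      | some b =>
        obtain rfl := B.rootIndex_eq_some.1 hv
        simp only [Option.bind_some, AtSlot, ht, Nat.add_left_cancel_iff, h.isLeader_iff,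
          B.root_injective.eq_iff]
        by_cases hb : b = F
        · subst hb
          simp [hF]
        · rw [if_neg, if_neg hb]
          rintro ⟨hb', he⟩
          exact hb (h.fslot_inj hb' hF he.symm)
    · intro v hv
      have := T.depth_le_height v
      omega
  have hother : ∀ r, (∀ F, frag F = F → r ≠ T.height + S.fslot F) →
      upcast T Option.or inj r T.root = none := by
    intro r hr
    refine upcast_root_sole T (by simp) (by simp) (μ := fun _ => none) ?_ (by simp)
      (Or.inl (by simp))
    intro t v ht
    simp only [hinj]
    cases hv : B.rootIndex v with
    | none => rfl
    | some b =>
      simp only [Option.bind_some, AtSlot, ht, h.isLeader_iff]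
      rw [if_neg (fun h' => hr b h'.1 h'.2)]
  -- Nothing is published in this variant, so a single range starting at `1` runs through the whole
  -- cycle. Idle windows leave it unchanged, and leaders without a request contribute `0`.
  have state : ∀ r, rootState allocStep (some 1) (fun t => upcast T Option.or inj t T.root) r =
      some (1 + ∑ x ∈ (Finset.univ.filter (fun x => frag x = x)).filter
        (fun x => T.height + S.fslot x < r), (s x).getD 0) := by
    intro r
    induction r with
    | zero => simp [rootState]
    | succ r ih =>
      rw [rootState, ih]
      by_cases hr : ∃ F, frag F = F ∧ r = T.height + S.fslot F
      · obtain ⟨F, hF, rfl⟩ := hr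
        have : (Finset.univ.filter (fun x => frag x = x)).filter
            (fun x => T.height + S.fslot x < T.height + S.fslot F + 1) =
            insert F ((Finset.univ.filter (fun x => frag x = x)).filter
              (fun x => T.height + S.fslot x < T.height + S.fslot F)) := by
          ext x
          simp only [Finset.mem_filter, Finset.mem_univ, true_and, Finset.mem_insert]
          constructor
          · rintro ⟨hx, hlt⟩
            rcases Nat.lt_succ_iff_lt_or_eq.1 hlt with hlt | he
            · exact Or.inr ⟨hx, hlt⟩
            · exact Or.inl (h.fslot_inj hx hF (by omega))
          · rintro (rfl | ⟨hx, hlt⟩)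
            · exact ⟨hF, by omega⟩
            · exact ⟨hx, by omega⟩
        rw [this, Finset.sum_insert (by simp), hleader F hF]
        cases s F with
        | none => simp [allocStep]
        | some n =>
          simp only [allocStep, Option.map_some, Option.getD_some, Option.some.injEq]
          omega
      · push Not at hr
        have : (Finset.univ.filter (fun x => frag x = x)).filter
            (fun x => T.height + S.fslot x < r + 1) =
            (Finset.univ.filter (fun x => frag x = x)).filter
              (fun x => T.height + S.fslot x < r) := by
          refine Finset.filter_congr fun x hx => ?_
          have := hr x (Finset.mem_filter.1 hx).2
          omega
        rw [this, hother r hr]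
        rfl
  have hslot : ∀ r m, rootOutput T Option.or inj (some 1) allocStep r = some (m, B.root F) →
      r = T.height + S.fslot F ∧ (s F).isSome := by
    intro r m hr
    unfold rootOutput at hr
    by_cases h1 : ∃ F, frag F = F ∧ r = T.height + S.fslot F
    · obtain ⟨F', hF', rfl⟩ := h1
      rw [hleader F' hF'] at hr
      cases hs : s F' with
      | none => simp [hs, allocStep] at hr
      | some n =>
        simp only [hs, allocStep, Option.map_some, Option.some.injEq, Prod.mk.injEq] at hr
        obtain rfl := B.root_injective hr.2
        exact ⟨rfl, by simp [hs]⟩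
    · push Not at h1
      rw [hother r h1] at hr
      simp [allocStep] at hr
  cases hs : s F with
  | none =>
    rw [exchange_eq_none]
    · rfl
    · intro r m hr
      have := (hslot r m hr).2
      simp [hs] at this
  | some n =>
    have hout : rootOutput T Option.or inj (some 1) allocStep (T.height + S.fslot F) =
        some (some (1 + ∑ x ∈ (Finset.univ.filter (fun x => frag x = x)).filter
          (fun x => S.fslot x < S.fslot F), (s x).getD 0), B.root F) := by
      unfold rootOutput
      rw [state, hleader F hF, hs]
      simp [allocStep]
    rw [exchange_eq_some T ?_ hout]
    · rfl
    · intro r m hr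
      rw [(hslot r m hr).1, hout] at hr
      simpa [eq_comm] using hr
    · have := h.fslot_le hF
      omega

end IsPQSlotSet

end Cycles

/-! ### Setup -/

section Setup

variable {V : Type u} [Fintype V] [LinearOrder V] {G : SimpleGraph V} {β : Type w} [Fintype β]
  [DecidableEq β] (T : BFSTree G) (B : BaseFragments G β) (c : Convention)

theorem fragSize_id (F : β) : fragSize id F = 1 := by
  have : Finset.univ.filter (fun b : β => id b = F) = {F} := by
    ext b
    simp
  rw [fragSize, this, Finset.card_singleton]

/-- The intervals of the base fragments after the setup. -/
theorem setup_intervals :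
    (∀ b, 1 ≤ (setup T B c).fslot b ∧
      (setup T B c).fslot b + (1 + c.extra) ≤ 1 + Fintype.card β * (1 + c.extra)) ∧
    ∀ b b' s, (setup T B c).fslot b ≤ s → s < (setup T B c).fslot b + (1 + c.extra) →
      (setup T B c).fslot b' ≤ s → s < (setup T B c).fslot b' + (1 + c.extra) → b = b' := by
  set own : V → ℕ := fun v => (B.rootIndex v).elim 0 (fun _ => 1 + c.extra) with hown
  set cache : V → ℕ := fun v => (gather T.parent (· + ·)
    (fun v => (B.rootIndex v).map (fun _ => 1 + c.extra)) (Fintype.card V) v).getD 0 with hcache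
  set top : V → Option ℕ := fun v => if v = T.root then some 1 else none with htop
  have hdesc : ∀ v, cache v = ∑ w ∈ desc T.parent v, own w := fun v =>
    gather_card_rel T.isForest accumulates_getD
      (x := fun v => (B.rootIndex v).map (fun _ => 1 + c.extra))
      (fun v => by simp only [hown]; cases B.rootIndex v <;> rfl) v
  have hc : ∀ v, cache v = own v + ∑ x ∈ children T.parent v, cache x := by
    intro v
    rw [hdesc, T.isForest.sum_desc_children]
    simp only [hdesc]
  set b : V → ℕ := fun v => (splitDown T.parent cache top (Fintype.card V) v).getD 0 with hb
  have hsome : ∀ v, splitDown T.parent cache top (Fintype.card V) v = some (b v) := by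
    have hex : ∀ v, ∃ N, splitDown T.parent cache top (Fintype.card V) v = some N := by
      intro v
      induction v using T.isForest.induction with
      | _ v ih =>
        cases h : T.parent v with
        | none => exact ⟨1, by rw [splitDown_of_none _ h]; exact if_pos (T.parent_eq_none.1 h)⟩
        | some p =>
          obtain ⟨N, hN⟩ := ih p h
          exact ⟨_, by rw [T.isForest.splitDown_of_par h, hN, Option.map_some]⟩
    intro v
    obtain ⟨N, hN⟩ := hex v
    simp only [hb, hN, Option.getD_some]
  have hroot : b T.root = 1 := by
    simp only [hb, splitDown_of_none _ T.parent_root]; simp [htop]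
  have htotal : cache T.root = Fintype.card β * (1 + c.extra) := by
    rw [hdesc, T.desc_root, B.sum_rootIndex]
    simp
  obtain ⟨h1, h2⟩ := T.isForest.splitDown_kept hc (b := b) (P := fun _ => True)
    (fun v _ => hsome v) (by simp) (by
      intro v w s _ _ hv hw _ _ _ _
      rw [T.parent_eq_none.1 hv, T.parent_eq_none.1 hw])
  have hslot : ∀ x, (setup T B c).fslot x =
      b (B.root x) + ∑ y ∈ children T.parent (B.root x), cache y := fun _ => rfl
  -- A base fragment keeps the top end of the interval of its root vertex, of length `1 + c.extra`.
  have hend : ∀ x, (setup T B c).fslot x + (1 + c.extra) =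
      b (B.root x) + cache (B.root x) := by
    intro x
    rw [hslot, hc (B.root x)]
    simp only [hown, B.rootIndex_root, Option.elim_some]
    omega
  constructor
  · intro x
    have := h1 T.root (B.root x) (T.anc_root _) trivial
    rw [hend, hslot]
    rw [hroot, htotal] at this
    omega
  · intro x x' s h3 h4 h5 h6
    rw [hend] at h4 h6
    rw [hslot] at h3 h5
    exact B.root_injective (h2 _ _ s trivial trivial h3 h4 h5 h6)

/-- All fragments are singletons. The bound holds since each takes `1 + c.extra ≤ 2` slots. -/
theorem isPQSlotSet_setup : IsPQSlotSet B c id (setup T B c) := by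
  obtain ⟨h1, h2⟩ := setup_intervals T B c
  refine ⟨fun _ => rfl, fun _ => ⟨rfl, rfl⟩, fun F _ i hi => ?_, fun F F' _ _ hne => ?_,
    fun F _ => ?_⟩
  · rw [pqRange, fragSize_id, Finset.mem_Ico] at hi
    have := h1 F
    have := Nat.mul_le_mul_left (Fintype.card β) (Nat.add_le_add_left c.extra_le_one 1)
    rw [Finset.mem_Icc]
    omega
  · rw [Finset.disjoint_left]
    intro i hi hi'
    rw [pqRange, fragSize_id, Finset.mem_Ico] at hi hi'
    exact hne (h2 F F' i hi.1 hi.2 hi'.1 hi'.2)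
  · have hq : (setup T B c).qslot F = (setup T B c).fslot F + c.extra := rfl
    rw [pqRange, fragSize_id]
    refine ⟨?_, ?_, ?_⟩
    · rintro b ⟨hb, hb'⟩
      obtain rfl : b = F := hb
      have : c.extra = 1 := hb'.resolve_right (fun h => h rfl)
      simp [hq, this]
    · rintro b ⟨hb, -⟩ b' ⟨hb', -⟩ _
      exact (show b = F from hb).trans (show b' = F from hb').symm
    · intro i hi
      simp only [Finset.coe_sdiff, Finset.coe_Ico, Finset.coe_singleton, Set.mem_sdiff,
        Set.mem_Ico, Set.mem_singleton_iff] at hi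
      have := c.extra_le_one
      exact ⟨F, ⟨rfl, Or.inl (by omega)⟩, by omega⟩

end Setup

/-! ### Virtual subtrees -/

section Virtual

variable {V : Type u} {G : SimpleGraph V} {β : Type w} [DecidableEq β]

/-- The parent of the fragment `F` in its virtual subtree, if there is one. -/
def virtualPar (B : BaseFragments G β) (frag : β → β) (mw : β → Option (V × V)) (F : β) :
    Option β :=
  if frag F = F then (mw F).bind (fun e => (B.base e.2).map frag) else none

/-- The child's end of the edge from the fragment `F` to its parent. -/
def childEnd (B : BaseFragments G β) (mw : β → Option (V × V)) (F : β) : V :=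
  (mw F).elim (B.root F) Prod.fst

/-- The parent's end of the edge from the fragment `F` to its parent. -/
def parentEnd (B : BaseFragments G β) (mw : β → Option (V × V)) (F : β) : V :=
  (mw F).elim (B.root F) Prod.snd

variable {B : BaseFragments G β} {frag : β → β} {mw : β → Option (V × V)}

theorem leader_of_virtualPar {F P : β} (h : virtualPar B frag mw F = some P) : frag F = F := by
  by_contra hF
  simp [virtualPar, hF] at h

theorem mw_of_virtualPar {F P : β} (h : virtualPar B frag mw F = some P) :
    mw F = some (childEnd B mw F, parentEnd B mw F) := by
  rw [virtualPar, if_pos (leader_of_virtualPar h)] at h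
  cases hm : mw F with
  | none => simp [hm] at h
  | some e => simp [childEnd, parentEnd, hm]

theorem base_parentEnd {F P : β} (h : virtualPar B frag mw F = some P) :
    (B.base (parentEnd B mw F)).map frag = some P := by
  have hm := mw_of_virtualPar h
  rw [virtualPar, if_pos (leader_of_virtualPar h), hm] at h
  exact h

theorem virtualParent_eq {F P : β} (h : virtualPar B frag mw F = some P) :
    virtualParent B frag mw F = P := by
  rw [virtualPar, if_pos (leader_of_virtualPar h)] at h
  cases hm : mw F with
  | none => simp [hm] at h
  | some e =>
    rw [hm] at h
    simp only [Option.bind_some] at h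
    simp [virtualParent, hm, h]

namespace IsSubtreePartition

theorem virtualPar_eq_none (h : IsSubtreePartition B frag mw) {F : β} (hF : frag F = F) :
    virtualPar B frag mw F = none ↔ mw F = none := by
  rw [virtualPar, if_pos hF]
  cases hm : mw F with
  | none => simp
  | some e =>
    obtain ⟨-, -, b, hb⟩ := h.edge F e.1 e.2 hF hm
    simp [hb]

theorem virtualPar_isSome (h : IsSubtreePartition B frag mw) {F : β} (hF : frag F = F) :
    (mw F).isSome ↔ ∃ P, virtualPar B frag mw F = some P := by
  rw [← Option.isSome_iff_exists, ← not_iff_not, Option.not_isSome_iff_eq_none,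
    Option.not_isSome_iff_eq_none, h.virtualPar_eq_none hF]

theorem base_childEnd (h : IsSubtreePartition B frag mw) {F P : β}
    (hP : virtualPar B frag mw F = some P) :
    (B.base (childEnd B mw F)).map frag = some F := by
  obtain ⟨-, ⟨b, hb, hbF⟩, -⟩ := h.edge F _ _ (leader_of_virtualPar hP) (mw_of_virtualPar hP)
  rw [hb, Option.map_some, hbF]

theorem childEnd_inj (h : IsSubtreePartition B frag mw) {F F' P P' : β}
    (hP : virtualPar B frag mw F = some P) (hP' : virtualPar B frag mw F' = some P')
    (he : childEnd B mw F = childEnd B mw F') : F = F' := by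
  have h1 := h.base_childEnd hP
  rw [he, h.base_childEnd hP'] at h1
  exact (Option.some.inj h1).symm

theorem virtualParent_of_none (h : IsSubtreePartition B frag mw) {F : β} (hF : frag F = F)
    (hn : virtualPar B frag mw F = none) : virtualParent B frag mw F = F := by
  simp [virtualParent, (h.virtualPar_eq_none hF).1 hn]

end IsSubtreePartition

theorem leader_virtualPar (hf : ∀ b, frag (frag b) = frag b) {F P : β}
    (h : virtualPar B frag mw F = some P) : frag P = P := by
  have := base_parentEnd h
  obtain ⟨b, -, rfl⟩ := Option.map_eq_some_iff.1 this
  exact hf b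

theorem iterate_virtualParent {k : ℕ} {F P : β}
    (h : climb (virtualPar B frag mw) k F = some P) : (virtualParent B frag mw)^[k] F = P := by
  induction k generalizing F with
  | zero => simpa [climb] using h
  | succ k ih =>
    cases hF : virtualPar B frag mw F with
    | none => simp [climb, hF] at h
    | some Q =>
      rw [climb_succ_of_par hF] at h
      rw [Function.iterate_succ_apply, virtualParent_eq hF, ih h]

theorem leader_climb (hf : ∀ b, frag (frag b) = frag b) {k : ℕ} {F P : β} (hF : frag F = F)
    (h : climb (virtualPar B frag mw) k F = some P) : frag P = P := by
  cases k with
  | zero =>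
    obtain rfl : F = P := by simpa [climb] using h
    exact hF
  | succ k =>
    rw [climb_succ_right] at h
    obtain ⟨x, -, hx⟩ := Option.bind_eq_some_iff.1 h
    exact leader_virtualPar hf hx

namespace IsSubtreePartition

/-- After `maxDepth` steps towards the root no edge is left. -/
theorem climb_maxDepth (h : IsSubtreePartition B frag mw) (hf : ∀ b, frag (frag b) = frag b)
    {F P : β} (hc : climb (virtualPar B frag mw) maxDepth F = some P) :
    virtualPar B frag mw P = none := by
  by_cases hF : frag F = F
  · rw [h.virtualPar_eq_none (leader_climb hf hF hc), ← iterate_virtualParent hc]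
    exact h.depth F hF
  -- An index that is no leader is an isolated vertex of the virtual forest.
  · have hn : virtualPar B frag mw F = none := by simp [virtualPar, hF]
    rw [maxDepth, climb_succ_of_none hn] at hc
    cases hc

/-- Acyclicity is not part of `IsSubtreePartition`; the depth bound forces it, because on a cycle
one could climb forever. -/
theorem isForest (h : IsSubtreePartition B frag mw) (hf : ∀ b, frag (frag b) = frag b) :
    IsForest (virtualPar B frag mw) := by
  intro F
  refine ⟨maxDepth + 1, ?_⟩
  rw [climb_succ_right]
  cases hc : climb (virtualPar B frag mw) maxDepth F with
  | none => rfl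
  | some P => exact h.climb_maxDepth hf hc

theorem iterate_of_none (h : IsSubtreePartition B frag mw) {R : β} (hR : frag R = R)
    (hn : virtualPar B frag mw R = none) (k : ℕ) : (virtualParent B frag mw)^[k] R = R :=
  Function.iterate_fixed (h.virtualParent_of_none hR hn) k

theorem climb_le_maxDepth (h : IsSubtreePartition B frag mw) (hf : ∀ b, frag (frag b) = frag b)
    {F P : β} {k : ℕ} (hc : climb (virtualPar B frag mw) k F = some P) : k ≤ maxDepth := by
  by_contra hk
  rw [← Nat.add_sub_cancel' (show maxDepth + 1 ≤ k by omega), climb_add, climb_succ_right] at hc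
  cases hm : climb (virtualPar B frag mw) maxDepth F with
  | none => simp [hm] at hc
  | some Q => simp [hm, h.climb_maxDepth hf hm] at hc

/-- The root fragment of the subtree is reached by `maxDepth` steps. -/
theorem iterate_eq_root (h : IsSubtreePartition B frag mw) (hf : ∀ b, frag (frag b) = frag b)
    {F R : β} (hF : frag F = F) (hn : virtualPar B frag mw R = none)
    (ha : Anc (virtualPar B frag mw) R F) : (virtualParent B frag mw)^[maxDepth] F = R := by
  obtain ⟨k, hk⟩ := ha
  have := h.climb_le_maxDepth hf hk
  rw [← Nat.sub_add_cancel this, Function.iterate_add_apply, iterate_virtualParent hk,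
    h.iterate_of_none (leader_climb hf hF hk) hn]

theorem merge_spec (h : IsSubtreePartition B frag mw) (hf : ∀ b, frag (frag b) = frag b) (b : β) :
    virtualPar B frag mw (merge B frag mw b) = none ∧
      Anc (virtualPar B frag mw) (merge B frag mw b) (frag b) ∧
      frag (merge B frag mw b) = merge B frag mw b := by
  obtain ⟨R, hR, ha⟩ := (h.isForest hf).exists_root (frag b)
  have : merge B frag mw b = R := h.iterate_eq_root hf (hf b) hR ha
  rw [this]
  obtain ⟨k, hk⟩ := ha
  exact ⟨hR, ⟨k, hk⟩, leader_climb hf (hf b) hk⟩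

theorem merge_eq_iff (h : IsSubtreePartition B frag mw) (hf : ∀ b, frag (frag b) = frag b)
    {b R : β} (hn : virtualPar B frag mw R = none) :
    merge B frag mw b = R ↔ Anc (virtualPar B frag mw) R (frag b) := by
  constructor
  · rintro rfl
    exact (h.merge_spec hf b).2.1
  · exact h.iterate_eq_root hf (hf b) hn

theorem merge_eq_self_iff (h : IsSubtreePartition B frag mw) (hf : ∀ b, frag (frag b) = frag b)
    {R : β} : merge B frag mw R = R ↔ frag R = R ∧ virtualPar B frag mw R = none := by
  constructor
  · intro hR
    have := h.merge_spec hf R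
    rw [hR] at this
    exact ⟨this.2.2, this.1⟩
  · rintro ⟨hR, hn⟩
    rw [h.merge_eq_iff hf hn, hR]
    exact Anc.refl R

end IsSubtreePartition

/-- The number of base fragments in the subtree rooted at the fragment `F`. -/
noncomputable def subtreeSize [Fintype β] (B : BaseFragments G β) (frag : β → β)
    (mw : β → Option (V × V)) (F : β) : ℕ :=
  ∑ X ∈ desc (virtualPar B frag mw) F, fragSize frag X

/-- The child fragments of `F`. -/
def childFragments [Fintype β] (B : BaseFragments G β) (frag : β → β)
    (mw : β → Option (V × V)) (F : β) : Finset β :=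
  Finset.univ.filter (fun C => virtualPar B frag mw C = some F)

theorem mem_childFragments [Fintype β] {F C : β} :
    C ∈ childFragments B frag mw F ↔ virtualPar B frag mw C = some F := by
  simp [childFragments]

namespace IsSubtreePartition

theorem subtreeSize_eq [Fintype β] (h : IsSubtreePartition B frag mw)
    (hf : ∀ b, frag (frag b) = frag b) (F : β) :
    subtreeSize B frag mw F =
      fragSize frag F + ∑ C ∈ childFragments B frag mw F, subtreeSize B frag mw C :=
  (h.isForest hf).sum_desc _ F

theorem fragSize_le_subtreeSize [Fintype β] (h : IsSubtreePartition B frag mw)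
    (hf : ∀ b, frag (frag b) = frag b) (F : β) : fragSize frag F ≤ subtreeSize B frag mw F := by
  rw [h.subtreeSize_eq hf F]
  exact Nat.le_add_right _ _

/-- The base fragments of a new fragment are sorted by their old fragments, which are the vertices
of the subtree. -/
theorem subtreeSize_root [Fintype β] (h : IsSubtreePartition B frag mw)
    (hf : ∀ b, frag (frag b) = frag b) {R : β} (hn : virtualPar B frag mw R = none) :
    subtreeSize B frag mw R = fragSize (merge B frag mw) R := by
  unfold subtreeSize fragSize
  rw [Finset.card_eq_sum_card_fiberwise (f := frag) (t := desc (virtualPar B frag mw) R)]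
  · refine Finset.sum_congr rfl fun X hX => ?_
    congr 1
    ext b
    simp only [Finset.mem_filter, Finset.mem_univ, true_and, h.merge_eq_iff hf hn]
    constructor
    · rintro rfl
      exact ⟨mem_desc.1 hX, rfl⟩
    · exact fun hb => hb.2
  · intro b hb
    simp only [Finset.coe_filter, Finset.mem_univ, true_and, Set.mem_ofPred_eq] at hb
    exact mem_desc.2 ((h.merge_eq_iff hf hn).1 hb)

end IsSubtreePartition

/-! ### The edges of the virtual subtrees -/

variable [DecidableEq V]

namespace IsSubtreePartition

theorem link_childEnd (h : IsSubtreePartition B frag mw) {F P : β}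
    (hP : virtualPar B frag mw F = some P) :
    link B frag mw (childEnd B mw F) = some (parentEnd B mw F) := by
  obtain ⟨b, hb, hbF⟩ := Option.map_eq_some_iff.1 (h.base_childEnd hP)
  rw [link, hb, Option.bind_some, hbF, mw_of_virtualPar hP]
  simp

theorem exists_child_of_link (h : IsSubtreePartition B frag mw)
    (hf : ∀ b, frag (frag b) = frag b) {x y : V} (hl : link B frag mw x = some y) :
    ∃ C P, virtualPar B frag mw C = some P ∧ childEnd B mw C = x ∧ parentEnd B mw C = y := by
  obtain ⟨b, hb, hl⟩ := Option.bind_eq_some_iff.1 hl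
  obtain ⟨e, he, hl⟩ := Option.bind_eq_some_iff.1 hl
  split at hl
  · obtain ⟨P, hP⟩ := (h.virtualPar_isSome (hf b)).1 (by simp [he])
    refine ⟨frag b, P, hP, ?_, ?_⟩
    · simpa [childEnd, he]
    · simpa [parentEnd, he] using hl
  · cases hl

/-- The only vertex of a fragment with an edge to the parent. -/
theorem eq_childEnd (h : IsSubtreePartition B frag mw) (hf : ∀ b, frag (frag b) = frag b) {F : β}
    {x y : V} (hx : (B.base x).map frag = some F) (hl : link B frag mw x = some y) :
    ∃ P, virtualPar B frag mw F = some P ∧ x = childEnd B mw F := by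
  obtain ⟨C, P, hP, rfl, rfl⟩ := h.exists_child_of_link hf hl
  rw [h.base_childEnd hP] at hx
  cases hx
  exact ⟨P, hP, rfl⟩

variable [Fintype V]

theorem mem_linked {x y : V} : x ∈ linked (link B frag mw) y ↔ link B frag mw x = some y := by
  simp [linked]

/-- Child fragments correspond to the child's ends of their edges, one to each. This turns sums over
vertices, as computed by convergecasts, into sums over child fragments. -/
theorem sum_linked [Fintype β] (h : IsSubtreePartition B frag mw)
    (hf : ∀ b, frag (frag b) = frag b) {N : Type*} [AddCommMonoid N] (F : β) (g : V → N) :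
    ∑ y ∈ Finset.univ.filter (fun y => (B.base y).map frag = some F),
      ∑ x ∈ linked (link B frag mw) y, g x =
    ∑ C ∈ childFragments B frag mw F, g (childEnd B mw C) := by
  rw [← Finset.sum_biUnion, ← Finset.sum_image (g := childEnd B mw) (f := g)]
  · refine Finset.sum_congr ?_ fun _ _ => rfl
    ext x
    simp only [Finset.mem_biUnion, Finset.mem_filter, Finset.mem_univ, true_and, mem_linked,
      Finset.mem_image, mem_childFragments]
    constructor
    · rintro ⟨y, hy, hl⟩
      obtain ⟨C, P, hP, rfl, rfl⟩ := h.exists_child_of_link hf hl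
      rw [base_parentEnd hP] at hy
      cases hy
      exact ⟨C, hP, rfl⟩
    · rintro ⟨C, hC, rfl⟩
      exact ⟨_, base_parentEnd hC, h.link_childEnd hC⟩
  · intro C hC C' hC' he
    exact h.childEnd_inj (mem_childFragments.1 hC) (mem_childFragments.1 hC') he
  · intro y _ y' _ hne
    rw [Function.onFun, Finset.disjoint_left]
    intro x hx hx'
    rw [mem_linked] at hx hx'
    rw [hx] at hx'
    exact hne (Option.some.inj hx')

end IsSubtreePartition

end Virtual

/-! ### Steps 1 and 2: requests are summed towards the roots -/

section Requests

variable {V : Type u} [Fintype V] [LinearOrder V] {G : SimpleGraph V} {β : Type w} [Fintype β]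
  [DecidableEq β] {B : BaseFragments G β} {c : Convention} {frag : β → β}
  {mw : β → Option (V × V)} {S : Slots V β}

theorem IsPQSlotSet.countChildren_eq (T : BFSTree G) (h : IsPQSlotSet B c frag S)
    (hm : IsSubtreePartition B frag mw) {F : β} (hF : frag F = F) :
    countChildren T B S (link B frag mw) F = (childFragments B frag mw F).card := by
  have h1 : countChildren T B S (link B frag mw) F = _ := h.convergecast_rel T accumulates_getD
    (x := fun y => some (linked (link B frag mw) y).card)
    (val := fun y => (linked (link B frag mw) y).card) (fun _ => rfl) hF
  rw [h1, Finset.card_eq_sum_ones, ← hm.sum_linked h.leader_mem F (fun _ => 1)]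
  simp

/-- The non-root fragment `C` has sent its request within the first `i` iterations. -/
def Sent (B : BaseFragments G β) (frag : β → β) (mw : β → Option (V × V)) : ℕ → β → Prop
  | 0, _ => False
  | i + 1, C => (∃ P, virtualPar B frag mw C = some P) ∧
      ∀ D, virtualPar B frag mw D = some C → Sent B frag mw i D

theorem Sent.mono {i : ℕ} {C : β} (hs : Sent B frag mw i C) : Sent B frag mw (i + 1) C := by
  induction i generalizing C with
  | zero => exact hs.elim
  | succ i ih => exact ⟨hs.1, fun D hD => ih (hs.2 D hD)⟩

/-- A late non-root fragment waits for a child that was late one iteration earlier. Following such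
children gives a long path below `C`. -/
theorem exists_climb_of_not_sent {i : ℕ} {C P : β} (hC : virtualPar B frag mw C = some P)
    (hs : ¬ Sent B frag mw i C) : ∃ D, climb (virtualPar B frag mw) i D = some C := by
  induction i generalizing C P with
  | zero => exact ⟨C, rfl⟩
  | succ i ih =>
    simp only [Sent, not_and, not_forall] at hs
    obtain ⟨D, hD, hs⟩ := hs ⟨P, hC⟩
    obtain ⟨X, hX⟩ := ih hD hs
    exact ⟨X, by rw [climb_succ_right, hX]; exact hD⟩

theorem IsSubtreePartition.sent_maxDepth (hm : IsSubtreePartition B frag mw)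
    (hf : ∀ b, frag (frag b) = frag b) {C P : β} (hC : virtualPar B frag mw C = some P) :
    Sent B frag mw maxDepth C := by
  by_contra hs
  obtain ⟨D, hD⟩ := exists_climb_of_not_sent hC hs
  rw [hm.climb_maxDepth hf hD] at hC
  cases hC

open Classical in
/-- The contents of the caches after `i` iterations of step 2. -/
structure CacheState (B : BaseFragments G β) (frag : β → β) (mw : β → Option (V × V)) (i : ℕ)
    (q : Requests V β) : Prop where
  edge : ∀ C P, virtualPar B frag mw C = some P → q.edgeCache (childEnd B mw C) =
    if Sent B frag mw i C then some (subtreeSize B frag mw C) else none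
  no_edge : ∀ x, link B frag mw x = none → q.edgeCache x = none
  vertex : ∀ v, q.vertexCache v = ∑ w ∈ desc B.parent v,
    ∑ x ∈ linked (link B frag mw) w, (q.edgeCache x).getD 0
  base : ∀ b, q.baseCache b = q.vertexCache (B.root b)
  sum : ∀ F, frag F = F → q.sum F =
    ∑ C ∈ childFragments B frag mw F, (q.edgeCache (childEnd B mw C)).getD 0
  count : ∀ F, frag F = F → q.count F =
    ∑ C ∈ childFragments B frag mw F, if (q.edgeCache (childEnd B mw C)).isSome then 1 else 0

open Classical in
/-- The fragments that are ready after `i` iterations are known to their vertices. -/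
def ReadyState (B : BaseFragments G β) (frag : β → β) (mw : β → Option (V × V)) (i : ℕ)
    (ready : V → Option ℕ) : Prop :=
  ∀ v, ready v = (B.base v).bind (fun b =>
    if Sent B frag mw (i + 1) (frag b) then some (subtreeSize B frag mw (frag b)) else none)

/-- Comparing the two counters is equivalent to having heard from every child, and then the received
sum is complete. A fragment ready after `i` iterations sends in the next one, hence `Sent` at `i +
1`. -/
theorem CacheState.readyState (T : BFSTree G) (h : IsPQSlotSet B c frag S)
    (hm : IsSubtreePartition B frag mw) (hsize : ∀ F, frag F = F → S.size F = fragSize frag F)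
    {i : ℕ} {q : Requests V β} (hq : CacheState B frag mw i q) :
    ReadyState B frag mw i (publishReady T B c S mw (countChildren T B S (link B frag mw))
      q.sum q.count) := by
  intro v
  rw [publishReady, h.broadcast_eq]
  congr 1
  funext b
  generalize hF : frag b = F
  have hF : frag F = F := by rw [← hF]; exact h.leader_mem b
  have hcount : q.count F = countChildren T B S (link B frag mw) F ↔
      ∀ C ∈ childFragments B frag mw F, Sent B frag mw i C := by
    rw [h.countChildren_eq T hm hF, hq.count F hF, ← Finset.card_filter,
      Finset.card_filter_eq_iff]
    refine forall₂_congr fun C hC => ?_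
    rw [hq.edge C F (mem_childFragments.1 hC)]
    split <;> simp_all
  have hready : Sent B frag mw (i + 1) F ↔
      (q.count F = countChildren T B S (link B frag mw) F ∧ (mw F).isSome) := by
    rw [hcount, Sent, hm.virtualPar_isSome hF, and_comm]
    simp only [mem_childFragments]
  by_cases hs : Sent B frag mw (i + 1) F
  · rw [if_pos hs, if_pos (hready.1 hs), hsize F hF, hq.sum F hF, hm.subtreeSize_eq h.leader_mem F]
    congr 2
    refine Finset.sum_congr rfl fun C hC => ?_
    rw [hq.edge C F (mem_childFragments.1 hC), if_pos (hs.2 C (mem_childFragments.1 hC))]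
    rfl
  · rw [if_neg hs, if_neg (fun h' => hs (hready.2 h'))]

theorem cacheState_init (T : BFSTree G) (nchild : β → ℕ) :
    CacheState B frag mw 0 (requestsInit T B c S mw nchild) := by
  constructor <;> intros <;> simp [requestsInit, Sent]

/-- Every edge carries a request only once, so all caches grow by the amounts sent in this
iteration. -/
theorem CacheState.step (T : BFSTree G) (h : IsPQSlotSet B c frag S)
    (hm : IsSubtreePartition B frag mw) {i : ℕ} {nchild : β → ℕ} {q : Requests V β}
    (hq : CacheState B frag mw i q) (hr : ReadyState B frag mw i q.ready) :
    CacheState B frag mw (i + 1)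
      (requestsStep T B c S mw (link B frag mw) nchild q) := by
  classical
  have hf := h.leader_mem
  set sent : V → Option ℕ := fun x =>
    if (link B frag mw x).isSome ∧ (q.edgeCache x).isNone then q.ready x else none with hsent
  set senders : V → Finset V :=
    fun y => (linked (link B frag mw) y).filter (fun x => (sent x).isSome) with hsenders
  set load : V → ℕ × ℕ := fun y => ∑ x ∈ linked (link B frag mw) y,
    ((sent x).getD 0, if (sent x).isSome then 1 else 0) with hload
  set up : V → Option (ℕ × ℕ) := intrinsic B (· + ·) (fun y =>
    if (senders y).Nonempty then some (∑ x ∈ senders y, (sent x).getD 0, (senders y).card)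
    else none) with hup
  -- A vertex without senders stays silent, which amounts to the pair of zeros.
  have hx : ∀ y, (if (senders y).Nonempty then
      some (∑ x ∈ senders y, (sent x).getD 0, (senders y).card) else none).getD 0 = load y := by
    intro y
    have h1 : (∑ x ∈ senders y, (sent x).getD 0, (senders y).card) = load y := by
      rw [Prod.ext_iff, hload]
      simp only [Prod.fst_sum, Prod.snd_sum, hsenders, ← Finset.card_filter, and_true]
      rw [Finset.sum_filter]
      refine Finset.sum_congr rfl fun x _ => ?_
      cases sent x <;> simp
    split
    · exact h1
    · rename_i hne
      rw [← h1, Finset.not_nonempty_iff_eq_empty.1 hne]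
      rfl
  have hupv : ∀ v, (up v).getD 0 = ∑ w ∈ desc B.parent v, load w :=
    fun v => gather_card_rel B.isForest accumulates_getD hx v
  have hgot : ∀ F, frag F = F → (extrinsic T B S (· + ·) up (B.root F)).getD 0 =
      ∑ C ∈ childFragments B frag mw F, ((sent (childEnd B mw C)).getD 0,
        if (sent (childEnd B mw C)).isSome then 1 else 0) := by
    intro F hF
    rw [h.extrinsic_rel T accumulates_getD (fun b => hupv (B.root b)) hF, B.sum_fragment]
    exact hm.sum_linked hf F
      (fun x => ((sent x).getD 0, if (sent x).isSome then 1 else 0))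
  -- At most one of the two is present, since `sent` requires an empty cache; hence `or` acts as
  -- addition.
  have hadd : ∀ x, (((q.edgeCache x).or (sent x)).getD 0 : ℕ) =
      (q.edgeCache x).getD 0 + (sent x).getD 0 := by
    intro x
    simp only [hsent]
    cases q.edgeCache x <;> simp
  have hadd' : ∀ x, (if ((q.edgeCache x).or (sent x)).isSome then 1 else 0 : ℕ) =
      (if (q.edgeCache x).isSome then 1 else 0) + (if (sent x).isSome then 1 else 0) := by
    intro x
    simp only [hsent]
    cases q.edgeCache x <;> simp
  constructor
  · intro C P hC
    change (q.edgeCache (childEnd B mw C)).or (sent (childEnd B mw C)) = _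
    obtain ⟨b, hb, hbC⟩ := Option.map_eq_some_iff.1 (hm.base_childEnd hC)
    have hr := hr (childEnd B mw C)
    rw [hb, Option.bind_some, hbC] at hr
    simp only [hsent, hm.link_childEnd hC, hq.edge C P hC, hr]
    by_cases hs : Sent B frag mw i C
    · simp [hs, hs.mono]
    · simp [hs]
  · intro x hx
    change (q.edgeCache x).or (sent x) = none
    simp [hsent, hq.no_edge x hx, hx]
  · intro v
    change q.vertexCache v + ((up v).getD 0).1 =
      ∑ w ∈ desc B.parent v, ∑ x ∈ linked (link B frag mw) w,
        ((q.edgeCache x).or (sent x)).getD 0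
    simp only [hadd, Finset.sum_add_distrib]
    rw [hq.vertex, hupv]
    simp only [hload, Prod.fst_sum]
  · intro b
    change q.baseCache b + ((up (B.root b)).getD 0).1 =
      q.vertexCache (B.root b) + ((up (B.root b)).getD 0).1
    rw [hq.base]
  · intro F hF
    change q.sum F + ((extrinsic T B S (· + ·) up (B.root F)).getD 0).1 =
      ∑ C ∈ childFragments B frag mw F,
        ((q.edgeCache (childEnd B mw C)).or (sent (childEnd B mw C))).getD 0
    rw [hgot F hF, hq.sum F hF]
    simp only [hadd, Finset.sum_add_distrib, Prod.fst_sum]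
  · intro F hF
    change q.count F + ((extrinsic T B S (· + ·) up (B.root F)).getD 0).2 =
      ∑ C ∈ childFragments B frag mw F,
        if ((q.edgeCache (childEnd B mw C)).or (sent (childEnd B mw C))).isSome then 1 else 0
    rw [hgot F hF, hq.count F hF]
    simp only [hadd', Finset.sum_add_distrib, Prod.snd_sum]

/-- The state at the end of step 2. -/
def requests (T : BFSTree G) (B : BaseFragments G β) (c : Convention) (frag : β → β)
    (mw : β → Option (V × V)) (S : Slots V β) : Requests V β :=
  (requestsStep T B c S mw (link B frag mw) (countChildren T B S (link B frag mw)))^[maxDepth]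
    (requestsInit T B c S mw (countChildren T B S (link B frag mw)))

theorem cacheState_requests (T : BFSTree G) (h : IsPQSlotSet B c frag S)
    (hm : IsSubtreePartition B frag mw) (hsize : ∀ F, frag F = F → S.size F = fragSize frag F) :
    CacheState B frag mw maxDepth (requests T B c frag mw S) := by
  have key : ∀ i, CacheState B frag mw i
        ((requestsStep T B c S mw (link B frag mw) (countChildren T B S (link B frag mw)))^[i]
          (requestsInit T B c S mw (countChildren T B S (link B frag mw)))) ∧
      ReadyState B frag mw i
        ((requestsStep T B c S mw (link B frag mw) (countChildren T B S (link B frag mw)))^[i]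
          (requestsInit T B c S mw (countChildren T B S (link B frag mw)))).ready := by
    intro i
    induction i with
    | zero =>
      have := cacheState_init T (B := B) (c := c) (frag := frag) (mw := mw) (S := S)
        (countChildren T B S (link B frag mw))
      exact ⟨this, this.readyState T h hm hsize⟩
    | succ i ih =>
      rw [Function.iterate_succ_apply']
      have := ih.1.step T h hm (nchild := countChildren T B S (link B frag mw)) ih.2
      exact ⟨this, this.readyState T h hm hsize⟩
  exact (key maxDepth).1

/-- The caches at the end of step 2. -/
structure CachesFilled (B : BaseFragments G β) (frag : β → β) (mw : β → Option (V × V))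
    (q : Requests V β) : Prop where
  edge : ∀ C P, virtualPar B frag mw C = some P →
    q.edgeCache (childEnd B mw C) = some (subtreeSize B frag mw C)
  vertex : ∀ v, q.vertexCache v = ∑ w ∈ desc B.parent v,
    ∑ x ∈ linked (link B frag mw) w, (q.edgeCache x).getD 0
  base : ∀ b, q.baseCache b = q.vertexCache (B.root b)
  sum : ∀ F, frag F = F → fragSize frag F + q.sum F = subtreeSize B frag mw F
  sum_base : ∀ F, frag F = F → ∑ b ∈ Finset.univ.filter (fun b => frag b = F), q.baseCache b =
    q.sum F

/-- By `sent_maxDepth` all requests have been sent, so the conditions in `CacheState` disappear. -/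
theorem cachesFilled_requests (T : BFSTree G) (h : IsPQSlotSet B c frag S)
    (hm : IsSubtreePartition B frag mw) (hsize : ∀ F, frag F = F → S.size F = fragSize frag F) :
    CachesFilled B frag mw (requests T B c frag mw S) := by
  have hq := cacheState_requests T h hm hsize
  have hedge : ∀ C P, virtualPar B frag mw C = some P →
      (requests T B c frag mw S).edgeCache (childEnd B mw C) =
        some (subtreeSize B frag mw C) := by
    intro C P hC
    rw [hq.edge C P hC, if_pos (hm.sent_maxDepth h.leader_mem hC)]
  refine ⟨hedge, hq.vertex, hq.base, fun F hF => ?_, fun F hF => ?_⟩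
  · rw [hq.sum F hF, hm.subtreeSize_eq h.leader_mem]
    congr 1
    refine Finset.sum_congr rfl fun C hC => ?_
    rw [hedge C F (mem_childFragments.1 hC)]
    rfl
  · simp only [hq.base, hq.vertex]
    rw [B.sum_fragment frag F
      (fun w => ∑ x ∈ linked (link B frag mw) w, ((requests T B c frag mw S).edgeCache x).getD 0),
      hm.sum_linked h.leader_mem, hq.sum F hF]

end Requests

/-! ### Steps 3 and 4: intervals are split towards the leaves -/

section Distribute

variable {V : Type u} [Fintype V] [LinearOrder V] {G : SimpleGraph V} {β : Type w} [Fintype β]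
  [DecidableEq β] {B : BaseFragments G β} {c : Convention} {frag : β → β}
  {mw : β → Option (V × V)} {S : Slots V β}

/-- The number of additional slots which the fragment `F` reserves as the root of a subtree. -/
def rootExtra (c : Convention) (mw : β → Option (V × V)) (F : β) : ℕ :=
  if (mw F).isNone then c.extra else 0

/-- The bottoms of the intervals at the vertices, when the fragments `F` divide intervals with
bottoms `rest F`. -/
def vertexBottom (T : BFSTree G) (B : BaseFragments G β) (c : Convention) (S : Slots V β)
    (q : Requests V β) (rest : β → Option ℕ) : V → Option ℕ :=
  splitDown B.parent q.vertexCache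
    (fun v => (B.rootIndex v).bind (allocate T B c S rest q.baseCache)) (Fintype.card V)

theorem vertexBottom_none (T : BFSTree G) (h : IsPQSlotSet B c frag S) {q : Requests V β}
    {rest : β → Option ℕ} {F : β} (hF : rest F = none) (v : V)
    (hv : (B.base v).map frag = some F) : vertexBottom T B c S q rest v = none := by
  induction v using B.isForest.induction with
  | _ v ih =>
    cases hp : B.parent v with
    | none =>
      obtain ⟨b, hb, hbF⟩ := Option.map_eq_some_iff.1 hv
      rw [vertexBottom, splitDown_of_none _ hp, B.eq_root_of_none hb hp, B.rootIndex_root,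
        Option.bind_some, h.allocate_eq, hbF, hF]
      rfl
    | some p =>
      have := ih p hp (by rw [B.base_parent hp, hv])
      rw [vertexBottom] at this ⊢
      rw [B.isForest.splitDown_of_par hp, this]
      rfl

theorem vertexBottom_some (T : BFSTree G) (h : IsPQSlotSet B c frag S) {q : Requests V β}
    {rest : β → Option ℕ} {F : β} {M : ℕ} (hF : rest F = some M) (v : V)
    (hv : (B.base v).map frag = some F) : ∃ N, vertexBottom T B c S q rest v = some N := by
  induction v using B.isForest.induction with
  | _ v ih =>
    cases hp : B.parent v with
    | none =>
      obtain ⟨b, hb, hbF⟩ := Option.map_eq_some_iff.1 hv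
      rw [vertexBottom, splitDown_of_none _ hp, B.eq_root_of_none hb hp, B.rootIndex_root,
        Option.bind_some, h.allocate_eq, hbF, hF]
      exact ⟨_, rfl⟩
    | some p =>
      obtain ⟨N, hN⟩ := ih p hp (by rw [B.base_parent hp, hv])
      rw [vertexBottom] at hN ⊢
      rw [B.isForest.splitDown_of_par hp, hN]
      exact ⟨_, rfl⟩

/-- The parts of the interval of `F` that are left for the edges to child fragments. -/
theorem vertexBottom_kept (T : BFSTree G) (h : IsPQSlotSet B c frag S) {q : Requests V β}
    {own : V → ℕ} (hvc : ∀ v, q.vertexCache v = ∑ w ∈ desc B.parent v, own w)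
    (hbc : ∀ b, q.baseCache b = q.vertexCache (B.root b))
    {rest : β → Option ℕ} {F : β} {M : ℕ} (hF : rest F = some M) :
    ∃ k : V → ℕ, (∀ v, (B.base v).map frag = some F →
        (vertexBottom T B c S q rest v).map
          (fun N => N + ∑ z ∈ children B.parent v, q.vertexCache z) = some (k v) ∧
        M ≤ k v ∧
        k v + own v ≤ M + ∑ b ∈ Finset.univ.filter (fun b => frag b = F), q.baseCache b) ∧
      ∀ v w s, (B.base v).map frag = some F → (B.base w).map frag = some F →
        k v ≤ s → s < k v + own v → k w ≤ s → s < k w + own w → v = w := by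
  set b : V → ℕ := fun v => (vertexBottom T B c S q rest v).getD 0 with hb
  have hbv : ∀ v, (B.base v).map frag = some F →
      vertexBottom T B c S q rest v = some (b v) := by
    intro v hv
    obtain ⟨N, hN⟩ := vertexBottom_some T h (q := q) hF v hv
    simp only [hb, hN, Option.getD_some]
  have hc : ∀ v, q.vertexCache v = own v + ∑ x ∈ children B.parent v, q.vertexCache x := by
    intro v
    rw [hvc, B.isForest.sum_desc_children]
    simp only [hvc]
  set A := Finset.univ.filter (fun b => frag b = F) with hA
  have hbr : ∀ x, frag x = F → b (B.root x) = M +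
      ∑ y ∈ A.filter (fun y => requestKey B c S y < requestKey B c S x), q.baseCache y := by
    intro x hx
    have h1 := hbv (B.root x) (by rw [B.base_root, Option.map_some, hx])
    rw [vertexBottom, splitDown_of_none _ (B.parent_root x), B.rootIndex_root, Option.bind_some,
      h.allocate_eq, hx, hF, Option.map_some] at h1
    exact (Option.some.inj h1).symm
  obtain ⟨h1, h2⟩ := B.isForest.splitDown_kept hc (b := b)
    (P := fun v => (B.base v).map frag = some F) hbv
    (fun v u hu => by rw [B.base_parent hu]) (by
      intro v w s hv hw hpv hpw h1 h2 h3 h4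
      obtain ⟨x, hx, hxF⟩ := Option.map_eq_some_iff.1 hv
      obtain ⟨y, hy, hyF⟩ := Option.map_eq_some_iff.1 hw
      rw [B.eq_root_of_none hx hpv, hbr x hxF] at h1
      rw [B.eq_root_of_none hx hpv, hbr x hxF, ← hbc] at h2
      rw [B.eq_root_of_none hy hpw, hbr y hyF] at h3
      rw [B.eq_root_of_none hy hpw, hbr y hyF, ← hbc] at h4
      rw [B.eq_root_of_none hx hpv, B.eq_root_of_none hy hpw,
        prefix_interval_inj A (requestKey B c S) q.baseCache (by simp [hA, hxF])
          (by simp [hA, hyF]) (h.requestKey_inj (by rw [hxF, hyF])) h1 h2 h3 h4])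
  -- After serving its tree children, `v` has exactly `own v` left at the top of its interval.
  refine ⟨fun v => b v + ∑ z ∈ children B.parent v, q.vertexCache z, fun v hv => ⟨?_, ?_⟩,
    fun v w s hv hw h3 h4 h5 h6 => h2 v w s hv hw h3 ?_ h5 ?_⟩
  · rw [hbv v hv]
    rfl
  · obtain ⟨x, hx, hxF⟩ := Option.map_eq_some_iff.1 hv
    have h3 := h1 (B.root x) v (B.anc_root_iff.2 hx) hv
    have h4 := prefix_sum_add_le_total A (requestKey B c S) q.baseCache (i := x) (by simp [hA, hxF])
    rw [hbr x hxF, ← hbc] at h3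
    have h5 := hc v
    dsimp only
    omega
  · have := hc v
    dsimp only at h4
    omega
  · have := hc w
    dsimp only at h6
    omega

/-- In a child fragment only the child's end of the edge to the parent holds an answer, so the
convergecast merely transports it to the leader. -/
theorem distributeStep_child (T : BFSTree G) (h : IsPQSlotSet B c frag S)
    (hm : IsSubtreePartition B frag mw) {q : Requests V β} (hq : CachesFilled B frag mw q)
    (fresh : β → Option ℕ) {F C : β} (hC : virtualPar B frag mw C = some F) :
    distributeStep T B c S mw (link B frag mw) q fresh C =
      ((vertexBottom T B c S q (fun F => (fresh F).map
        (fun N => N + S.size F + rootExtra c mw F)) (parentEnd B mw C)).map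
        (fun N => N + ∑ z ∈ children B.parent (parentEnd B mw C), q.vertexCache z)).map
        (fun N => N + ∑ z ∈ (linked (link B frag mw) (parentEnd B mw C)).filter
          (fun z => z < childEnd B mw C), (q.edgeCache z).getD 0) := by
  unfold distributeStep
  dsimp only
  rw [h.convergecast_sole T (leader_of_virtualPar hC) (hm.base_childEnd hC)]
  · rw [hq.edge C F hC, hm.link_childEnd hC]
    simp only [Option.bind_some, Option.map_map]
    rfl
  · intro w hw hne
    cases hl : link B frag mw w with
    | none => cases q.edgeCache w <;> rfl
    | some y =>
      obtain ⟨P, hP, rfl⟩ := hm.eq_childEnd h.leader_mem hw hl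
      exact absurd rfl hne

theorem distributeStep_root (T : BFSTree G) (h : IsPQSlotSet B c frag S)
    (hm : IsSubtreePartition B frag mw) (q : Requests V β) (fresh : β → Option ℕ) {F : β}
    (hF : frag F = F) (hn : virtualPar B frag mw F = none) :
    distributeStep T B c S mw (link B frag mw) q fresh F = none := by
  unfold distributeStep
  dsimp only
  refine h.convergecast_none T hF fun w hw => ?_
  cases hl : link B frag mw w with
  | none => cases q.edgeCache w <;> rfl
  | some y =>
    obtain ⟨P, hP, rfl⟩ := hm.eq_childEnd h.leader_mem hw hl
    rw [hn] at hP
    cases hP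

theorem distributeStep_none (T : BFSTree G) (h : IsPQSlotSet B c frag S)
    (hm : IsSubtreePartition B frag mw) {q : Requests V β} (hq : CachesFilled B frag mw q)
    {fresh : β → Option ℕ} {F C : β} (hC : virtualPar B frag mw C = some F)
    (hF : fresh F = none) : distributeStep T B c S mw (link B frag mw) q fresh C = none := by
  rw [distributeStep_child T h hm hq fresh hC,
    vertexBottom_none T h (by rw [hF]; rfl) _ (base_parentEnd hC)]
  rfl

/-- The intervals which the child fragments of `F` receive from `F`. -/
theorem distributeStep_some (T : BFSTree G) (h : IsPQSlotSet B c frag S)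
    (hm : IsSubtreePartition B frag mw) (hsize : ∀ F, frag F = F → S.size F = fragSize frag F)
    {q : Requests V β} (hq : CachesFilled B frag mw q)
    {fresh : β → Option ℕ} {F : β} {N : ℕ} (hF : frag F = F) (hN : fresh F = some N) :
    ∃ a : β → ℕ, (∀ C, virtualPar B frag mw C = some F →
        distributeStep T B c S mw (link B frag mw) q fresh C = some (a C) ∧
        N + fragSize frag F + rootExtra c mw F ≤ a C ∧
        a C + subtreeSize B frag mw C ≤ N + subtreeSize B frag mw F + rootExtra c mw F) ∧
      ∀ C C' s, virtualPar B frag mw C = some F → virtualPar B frag mw C' = some F →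
        a C ≤ s → s < a C + subtreeSize B frag mw C →
        a C' ≤ s → s < a C' + subtreeSize B frag mw C' → C = C' := by
  obtain ⟨k, hk, hinj⟩ := vertexBottom_kept T h hq.vertex hq.base
    (rest := fun F => (fresh F).map (fun N => N + S.size F + rootExtra c mw F))
    (F := F) (M := N + S.size F + rootExtra c mw F) (by rw [hN]; rfl)
  rw [hsize F hF, hq.sum_base F hF] at hk
  -- Several children may be attached to one vertex, which serves them in the order of their ends.
  set a : β → ℕ := fun C => k (parentEnd B mw C) +
    ∑ z ∈ (linked (link B frag mw) (parentEnd B mw C)).filter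
      (fun z => z < childEnd B mw C), (q.edgeCache z).getD 0 with ha
  have hsub : ∀ C, virtualPar B frag mw C = some F →
      a C + subtreeSize B frag mw C ≤ k (parentEnd B mw C) +
        ∑ x ∈ linked (link B frag mw) (parentEnd B mw C), (q.edgeCache x).getD 0 := by
    intro C hC
    have h1 := prefix_sum_add_le_total (linked (link B frag mw) (parentEnd B mw C)) id
      (fun x => (q.edgeCache x).getD 0) (IsSubtreePartition.mem_linked.2 (hm.link_childEnd hC))
    simp only [id, hq.edge C F hC, Option.getD_some] at h1
    simp only [ha]
    omega
  have hle : ∀ C, k (parentEnd B mw C) ≤ a C := fun C => Nat.le_add_right _ _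
  have hsum := hq.sum F hF
  refine ⟨a, fun C hC => ?_, fun C C' s hC hC' h1 h2 h3 h4 => ?_⟩
  · obtain ⟨h1, h2, h3⟩ := hk _ (base_parentEnd hC)
    have h4 := hsub C hC
    have h5 := hle C
    refine ⟨?_, ?_, ?_⟩
    · rw [distributeStep_child T h hm hq fresh hC, h1]
      rfl
    · omega
    · omega
  · have h5 := hsub C hC
    have h6 := hsub C' hC'
    have h7 := hle C
    have h8 := hle C'
    -- Parts kept by different vertices are disjoint, so children with a common slot share the
    -- parent's end; there the consecutive pieces separate them.
    have he := hinj _ _ s (base_parentEnd hC) (base_parentEnd hC') (by omega) (by omega)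
      (by omega) (by omega)
    refine hm.childEnd_inj hC hC' ?_
    simp only [ha] at h1 h2 h3 h4
    rw [← he] at h3 h4
    refine prefix_interval_inj (linked (link B frag mw) (parentEnd B mw C)) id
      (fun x => (q.edgeCache x).getD 0)
      (IsSubtreePartition.mem_linked.2 (hm.link_childEnd hC))
      (IsSubtreePartition.mem_linked.2 (he ▸ hm.link_childEnd hC')) id h1 ?_ h3 ?_
    · simpa only [id, hq.edge C F hC, Option.getD_some] using h2
    · simpa only [id, hq.edge C' F hC', Option.getD_some] using h4

/-! ### The iterations of step 4, level by level -/

variable {q : Requests V β} {start : β → Option ℕ}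

/-- The intervals received in iteration `i` belong to the fragments at depth `i`. -/
theorem distribute_fresh (T : BFSTree G) (h : IsPQSlotSet B c frag S)
    (hm : IsSubtreePartition B frag mw) (hsize : ∀ F, frag F = F → S.size F = fragSize frag F)
    (hq : CachesFilled B frag mw q)
    (hstart : ∀ F, frag F = F → ((start F).isSome ↔ virtualPar B frag mw F = none))
    (i : ℕ) {F : β} (hF : frag F = F) :
    (∃ N, (distribute T B c S mw (link B frag mw) q start i).1 F = some N) ↔
      ∃ R, climb (virtualPar B frag mw) i F = some R ∧ virtualPar B frag mw R = none := by
  induction i generalizing F with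
  | zero =>
    rw [← Option.isSome_iff_exists]
    refine (hstart F hF).trans ?_
    simp [climb]
  | succ i ih =>
    change (∃ N, distributeStep T B c S mw (link B frag mw) q
      (distribute T B c S mw (link B frag mw) q start i).1 F = some N) ↔ _
    cases hP : virtualPar B frag mw F with
    | none =>
      rw [distributeStep_root T h hm q _ hF hP]
      simp [climb, hP]
    | some P =>
      have hPl := leader_virtualPar h.leader_mem hP
      rw [climb_succ_of_par hP, ← ih hPl]
      constructor
      · rintro ⟨N, hN⟩
        cases hf : (distribute T B c S mw (link B frag mw) q start i).1 P with
        | none =>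
          rw [distributeStep_none T h hm hq hP hf] at hN
          cases hN
        | some M => exact ⟨M, rfl⟩
      · rintro ⟨M, hM⟩
        obtain ⟨a, ha, -⟩ := distributeStep_some T h hm hsize hq hPl hM
        exact ⟨_, (ha F hP).1⟩

theorem exists_fresh_of_total (T : BFSTree G) {n : ℕ} {F : β} {N : ℕ}
    (hN : (distribute T B c S mw (link B frag mw) q start n).2 F = some N) :
    ∃ i ≤ n, (distribute T B c S mw (link B frag mw) q start i).1 F = some N := by
  induction n with
  | zero => exact ⟨0, le_rfl, hN⟩
  | succ n ih =>
    rcases Option.or_eq_some_iff.1 hN with h1 | ⟨-, h1⟩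
    · obtain ⟨i, hi, h1⟩ := ih h1
      exact ⟨i, by omega, h1⟩
    · exact ⟨n + 1, le_rfl, h1⟩

/-- A leader receives something only in the iteration that equals its depth, so `or` never discards
an interval. -/
theorem distribute_total (T : BFSTree G) (h : IsPQSlotSet B c frag S)
    (hm : IsSubtreePartition B frag mw) (hsize : ∀ F, frag F = F → S.size F = fragSize frag F)
    (hq : CachesFilled B frag mw q)
    (hstart : ∀ F, frag F = F → ((start F).isSome ↔ virtualPar B frag mw F = none))
    {n : ℕ} {F : β} (hF : frag F = F) {N i : ℕ} (hi : i ≤ n)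
    (h1 : (distribute T B c S mw (link B frag mw) q start i).1 F = some N) :
    (distribute T B c S mw (link B frag mw) q start n).2 F = some N := by
  induction n with
  | zero =>
    obtain rfl : i = 0 := by omega
    exact h1
  | succ n ih =>
    change ((distribute T B c S mw (link B frag mw) q start n).2 F).or
      ((distribute T B c S mw (link B frag mw) q start (n + 1)).1 F) = some N
    rcases Nat.lt_or_eq_of_le hi with hi | rfl
    · rw [ih (by omega)]
      rfl
    · rw [h1]
      cases h2 : (distribute T B c S mw (link B frag mw) q start n).2 F with
      | none => rfl
      | some M =>
        obtain ⟨j, hj, h3⟩ := exists_fresh_of_total T h2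
        obtain ⟨R, hR, hRn⟩ := (distribute_fresh T h hm hsize hq hstart _ hF).1 ⟨_, h1⟩
        obtain ⟨R', hR', hRn'⟩ := (distribute_fresh T h hm hsize hq hstart _ hF).1 ⟨_, h3⟩
        rw [← Nat.add_sub_cancel' (show j + 1 ≤ n + 1 by omega), climb_add, climb_succ_right,
          hR', Option.bind_some, hRn'] at hR
        cases hR

/-- The intervals received in step 4 are nested in the same way as the virtual subtrees. -/
theorem distribute_spec (T : BFSTree G) (h : IsPQSlotSet B c frag S)
    (hm : IsSubtreePartition B frag mw) (hsize : ∀ F, frag F = F → S.size F = fragSize frag F)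
    (hq : CachesFilled B frag mw q)
    (hstart : ∀ F, frag F = F → ((start F).isSome ↔ virtualPar B frag mw F = none)) :
    ∃ a : β → ℕ,
      (∀ F, frag F = F →
        (distribute T B c S mw (link B frag mw) q start maxDepth).2 F = some (a F)) ∧
      (∀ F, frag F = F → virtualPar B frag mw F = none → start F = some (a F)) ∧
      (∀ C F, virtualPar B frag mw C = some F →
        a F + fragSize frag F + rootExtra c mw F ≤ a C ∧
        a C + subtreeSize B frag mw C ≤ a F + subtreeSize B frag mw F + rootExtra c mw F) ∧
      ∀ C C' F s, virtualPar B frag mw C = some F → virtualPar B frag mw C' = some F →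
        a C ≤ s → s < a C + subtreeSize B frag mw C →
        a C' ≤ s → s < a C' + subtreeSize B frag mw C' → C = C' := by
  have hf := h.leader_mem
  set total := (distribute T B c S mw (link B frag mw) q start maxDepth).2 with htotal
  have hfresh : ∀ F, frag F = F → ∀ i ≤ maxDepth, ∀ N,
      (distribute T B c S mw (link B frag mw) q start i).1 F = some N →
      total F = some N := fun F hF i hi N hN =>
    distribute_total T h hm hsize hq hstart hF hi hN
  have hlevel : ∀ F, frag F = F → ∃ i ≤ maxDepth, ∃ N,
      (distribute T B c S mw (link B frag mw) q start i).1 F = some N := by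
    intro F hF
    obtain ⟨R, hR, k, hk⟩ := (hm.isForest hf).exists_root F
    exact ⟨k, hm.climb_le_maxDepth hf hk,
      (distribute_fresh T h hm hsize hq hstart k hF).2 ⟨R, hk, hR⟩⟩
  -- The children of `F` are served in the iteration after the one in which `F` was; both are within
  -- the bound, because the children too have depth at most `maxDepth`.
  have hchild : ∀ F, frag F = F → ∃ a : β → ℕ,
      (∀ C, virtualPar B frag mw C = some F → total C = some (a C) ∧
        (total F).getD 0 + fragSize frag F + rootExtra c mw F ≤ a C ∧
        a C + subtreeSize B frag mw C ≤
          (total F).getD 0 + subtreeSize B frag mw F + rootExtra c mw F) ∧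
      ∀ C C' s, virtualPar B frag mw C = some F → virtualPar B frag mw C' = some F →
        a C ≤ s → s < a C + subtreeSize B frag mw C →
        a C' ≤ s → s < a C' + subtreeSize B frag mw C' → C = C' := by
    intro F hF
    obtain ⟨i, hi, N, hN⟩ := hlevel F hF
    obtain ⟨a, ha, hinj⟩ := distributeStep_some T h hm hsize hq hF hN
    refine ⟨a, fun C hC => ?_, hinj⟩
    rw [hfresh F hF i hi N hN]
    refine ⟨?_, (ha C hC).2⟩
    have hC1 : (distribute T B c S mw (link B frag mw) q start (i + 1)).1 C = some (a C) :=
      (ha C hC).1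
    obtain ⟨R, hR, -⟩ := (distribute_fresh T h hm hsize hq hstart (i + 1)
      (leader_of_virtualPar hC)).1 ⟨_, hC1⟩
    exact hfresh C (leader_of_virtualPar hC) (i + 1) (hm.climb_le_maxDepth hf hR) _ hC1
  refine ⟨fun F => (total F).getD 0, fun F hF => ?_, fun F hF hn => ?_, fun C F hC => ?_,
    fun C C' F s hC hC' h1 h2 h3 h4 => ?_⟩
  · obtain ⟨i, hi, N, hN⟩ := hlevel F hF
    simp only [hfresh F hF i hi N hN, Option.getD_some]
  · obtain ⟨N, hN⟩ := Option.isSome_iff_exists.1 ((hstart F hF).2 hn)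
    simp only [hfresh F hF 0 (Nat.zero_le _) N hN, hN, Option.getD_some]
  · obtain ⟨a, ha, -⟩ := hchild F (leader_virtualPar hf hC)
    obtain ⟨h1, h2⟩ := ha C hC
    simp only [h1, Option.getD_some]
    exact h2
  · obtain ⟨a, ha, hinj⟩ := hchild F (leader_virtualPar hf hC)
    simp only [(ha C hC).1, (ha C' hC').1, Option.getD_some] at h1 h2 h3 h4
    exact hinj C C' s hC hC' h1 h2 h3 h4

end Distribute

/-! ### The intervals of all fragments -/

section Intervals

variable {V : Type u} [Fintype V] [LinearOrder V] {G : SimpleGraph V} {β : Type w} [Fintype β]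
  [DecidableEq β] {B : BaseFragments G β} {c : Convention} {frag : β → β}
  {mw : β → Option (V × V)} {S : Slots V β}

/-- The lengths of the intervals which the new leaders request in step 3. -/
def leaderRequest (T : BFSTree G) (B : BaseFragments G β) (c : Convention) (frag : β → β)
    (mw : β → Option (V × V)) (S : Slots V β) (b : β) : Option ℕ :=
  if (mw b).isNone then some (S.size b + (requests T B c frag mw S).sum b + c.extra) else none

/-- The bottoms of the intervals which the old leaders have received after step 4. -/
def newBottom (T : BFSTree G) (B : BaseFragments G β) (c : Convention) (frag : β → β)
    (mw : β → Option (V × V)) (S : Slots V β) : β → Option ℕ :=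
  (distribute T B c S mw (link B frag mw) (requests T B c frag mw S)
    (allocateLeaders T B S (leaderRequest T B c frag mw S)) maxDepth).2

/-- The fragments have received intervals with bottoms `a`, nested as the virtual subtrees. -/
structure NestedIntervals (T : BFSTree G) (B : BaseFragments G β) (c : Convention)
    (frag : β → β) (mw : β → Option (V × V)) (S : Slots V β) (a : β → ℕ) : Prop where
  bottom : ∀ F, frag F = F → newBottom T B c frag mw S F = some (a F)
  one_le : ∀ R, frag R = R → virtualPar B frag mw R = none → 1 ≤ a R
  le_total : ∀ R, frag R = R → virtualPar B frag mw R = none →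
    a R + (subtreeSize B frag mw R + c.extra) ≤ 1 + 2 * Fintype.card β
  root_inj : ∀ R R' s, frag R = R → frag R' = R' → virtualPar B frag mw R = none →
    virtualPar B frag mw R' = none →
    a R ≤ s → s < a R + (subtreeSize B frag mw R + c.extra) →
    a R' ≤ s → s < a R' + (subtreeSize B frag mw R' + c.extra) → R = R'
  child : ∀ C F, virtualPar B frag mw C = some F →
    a F + fragSize frag F + rootExtra c mw F ≤ a C ∧
    a C + subtreeSize B frag mw C ≤ a F + subtreeSize B frag mw F + rootExtra c mw F
  sibling : ∀ C C' F s, virtualPar B frag mw C = some F → virtualPar B frag mw C' = some F →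
    a C ≤ s → s < a C + subtreeSize B frag mw C →
    a C' ≤ s → s < a C' + subtreeSize B frag mw C' → C = C'

theorem rootExtra_of_root (hm : IsSubtreePartition B frag mw) {F : β} (hF : frag F = F)
    (hn : virtualPar B frag mw F = none) : rootExtra c mw F = c.extra := by
  simp [rootExtra, (hm.virtualPar_eq_none hF).1 hn]

theorem rootExtra_of_child {F P : β} (hP : virtualPar B frag mw F = some P) :
    rootExtra c mw F = 0 := by
  simp [rootExtra, mw_of_virtualPar hP]

theorem leaderRequest_of_root (T : BFSTree G) (h : IsPQSlotSet B c frag S)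
    (hm : IsSubtreePartition B frag mw) (hsize : ∀ F, frag F = F → S.size F = fragSize frag F)
    {R : β} (hR : frag R = R) (hn : virtualPar B frag mw R = none) :
    leaderRequest T B c frag mw S R = some (subtreeSize B frag mw R + c.extra) := by
  rw [leaderRequest, (hm.virtualPar_eq_none hR).1 hn, hsize R hR,
    (cachesFilled_requests T h hm hsize).sum R hR]
  rfl

theorem leaderRequest_of_child (T : BFSTree G) {F P : β}
    (hP : virtualPar B frag mw F = some P) : leaderRequest T B c frag mw S F = none := by
  simp [leaderRequest, mw_of_virtualPar hP]

/-- A new fragment with `k ≥ 1` base fragments requests `k + c.extra ≤ 2 * k` slots, and the numbers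
`k` add up to `Fintype.card β`. -/
theorem sum_leaderRequest_le (T : BFSTree G) (h : IsPQSlotSet B c frag S)
    (hm : IsSubtreePartition B frag mw) (hsize : ∀ F, frag F = F → S.size F = fragSize frag F) :
    ∑ F ∈ Finset.univ.filter (fun F => frag F = F), (leaderRequest T B c frag mw S F).getD 0 ≤
      2 * Fintype.card β := by
  have hcard : Fintype.card β = ∑ F, fragSize (merge B frag mw) F := by
    rw [← Finset.card_univ]
    exact Finset.card_eq_sum_card_fiberwise (fun _ _ => Finset.mem_coe.2 (Finset.mem_univ _))
  rw [hcard, Finset.mul_sum]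
  refine (Finset.sum_le_sum fun F hF => ?_).trans
    (Finset.sum_le_sum_of_subset (Finset.filter_subset _ _))
  have hF := (Finset.mem_filter.1 hF).2
  cases hP : virtualPar B frag mw F with
  | none =>
    rw [leaderRequest_of_root T h hm hsize hF hP, hm.subtreeSize_root h.leader_mem hP,
      Option.getD_some]
    have := one_le_fragSize ((hm.merge_eq_self_iff h.leader_mem).2 ⟨hF, hP⟩)
    have := c.extra_le_one
    omega
  | some P => simp [leaderRequest_of_child T hP]

theorem exists_nestedIntervals (T : BFSTree G) (h : IsPQSlotSet B c frag S)
    (hm : IsSubtreePartition B frag mw) (hsize : ∀ F, frag F = F → S.size F = fragSize frag F) :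
    ∃ a, NestedIntervals T B c frag mw S a := by
  set s := leaderRequest T B c frag mw S with hs
  have hstart : ∀ F, frag F = F →
      ((allocateLeaders T B S s F).isSome ↔ virtualPar B frag mw F = none) := by
    intro F hF
    rw [h.allocateLeaders_eq T s hF, Option.isSome_map]
    cases hP : virtualPar B frag mw F with
    | none => simp [hs, leaderRequest_of_root T h hm hsize hF hP]
    | some P => simp [hs, leaderRequest_of_child T hP]
  obtain ⟨a, h1, h2, h3, h4⟩ :=
    distribute_spec T h hm hsize (cachesFilled_requests T h hm hsize) hstart
  set A := Finset.univ.filter (fun F : β => frag F = F) with hA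
  have ha : ∀ R, frag R = R → virtualPar B frag mw R = none → a R = 1 +
      ∑ x ∈ A.filter (fun x => S.fslot x < S.fslot R), (s x).getD 0 := by
    intro R hR hn
    have := h2 R hR hn
    rw [h.allocateLeaders_eq T s hR, hs, leaderRequest_of_root T h hm hsize hR hn,
      Option.map_some] at this
    exact (Option.some.inj this).symm
  have hlen : ∀ R, frag R = R → virtualPar B frag mw R = none →
      (s R).getD 0 = subtreeSize B frag mw R + c.extra := by
    intro R hR hn
    rw [hs, leaderRequest_of_root T h hm hsize hR hn, Option.getD_some]
  refine ⟨a, h1, fun R hR hn => ?_, fun R hR hn => ?_, ?_, h3, h4⟩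
  · rw [ha R hR hn]
    exact Nat.le_add_right _ _
  · have h5 := prefix_sum_add_le_total A S.fslot (fun x => (s x).getD 0) (i := R) (by simp [hA, hR])
    have h6 : ∑ x ∈ A, (s x).getD 0 ≤ 2 * Fintype.card β := sum_leaderRequest_le T h hm hsize
    rw [ha R hR hn, ← hlen R hR hn]
    omega
  · intro R R' i hR hR' hn hn' h5 h6 h7 h8
    rw [ha R hR hn] at h5 h6
    rw [ha R' hR' hn'] at h7 h8
    rw [← hlen R hR hn] at h6
    rw [← hlen R' hR' hn'] at h8
    exact prefix_interval_inj A S.fslot (fun x => (s x).getD 0) (by simp [hA, hR])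
      (by simp [hA, hR']) (h.fslot_inj hR hR') h5 h6 h7 h8

namespace NestedIntervals

variable {T : BFSTree G} {a : β → ℕ}

/-- The interval of a fragment is part of the interval of the root fragment of its subtree. -/
theorem le_of_anc (ha : NestedIntervals T B c frag mw S a) (hm : IsSubtreePartition B frag mw)
    (hf : ∀ b, frag (frag b) = frag b) {F R : β} (hR : Anc (virtualPar B frag mw) R F) :
    a R ≤ a F ∧ a F + subtreeSize B frag mw F + rootExtra c mw F ≤
      a R + subtreeSize B frag mw R + rootExtra c mw R := by
  induction F using (hm.isForest hf).induction with
  | _ F ih =>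
    cases hP : virtualPar B frag mw F with
    | none =>
      rw [hR.eq_of_none hP]
      exact ⟨le_rfl, le_rfl⟩
    | some P =>
      rcases hR.cases_par hP with rfl | hR
      · exact ⟨le_rfl, le_rfl⟩
      · have h1 := ih P hP hR
        have h2 := ha.child F P hP
        have h3 := rootExtra_of_child (c := c) hP
        omega

/-- The slots which the fragments keep for themselves are disjoint. -/
theorem own_inj (ha : NestedIntervals T B c frag mw S a) (hm : IsSubtreePartition B frag mw)
    (hf : ∀ b, frag (frag b) = frag b) {F F' : β} {s : ℕ} (hF : frag F = F) (hF' : frag F' = F')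
    (h1 : a F ≤ s) (h2 : s < a F + fragSize frag F + rootExtra c mw F)
    (h3 : a F' ≤ s) (h4 : s < a F' + fragSize frag F' + rootExtra c mw F') : F = F' := by
  -- The interval of a subtree root is longer than its subtree by `c.extra`, and the root keeps this
  -- surplus for itself.
  refine (hm.isForest hf).reserved_disjoint (P := fun F => frag F = F)
    (I := fun F => {s | a F ≤ s ∧ s < a F + subtreeSize B frag mw F + rootExtra c mw F})
    (O := fun F => {s | a F ≤ s ∧ s < a F + fragSize frag F + rootExtra c mw F})
    (fun _ _ h _ => leader_virtualPar hf h) ?_ ?_ ?_ ?_ ?_ hF hF' (s := s) ⟨h1, h2⟩ ⟨h3, h4⟩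
  · rintro C F hC s ⟨h1, h2⟩
    have h3 := ha.child C F hC
    have h4 := rootExtra_of_child (c := c) hC
    exact ⟨by omega, by omega⟩
  · rintro C C' F s hC hC' ⟨h1, h2⟩ ⟨h3, h4⟩
    rw [rootExtra_of_child hC] at h2
    rw [rootExtra_of_child hC'] at h4
    exact ha.sibling C C' F s hC hC' h1 h2 h3 h4
  · rintro R R' s hR hR' hn hn' ⟨h1, h2⟩ ⟨h3, h4⟩
    rw [rootExtra_of_root hm hR hn] at h2
    rw [rootExtra_of_root hm hR' hn'] at h4
    exact ha.root_inj R R' s hR hR' hn hn' h1 (by omega) h3 (by omega)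
  · rintro F s ⟨h1, h2⟩
    have := hm.fragSize_le_subtreeSize hf F
    exact ⟨h1, by omega⟩
  · rintro C F s hC ⟨h1, h2⟩ ⟨h3, h4⟩
    have := ha.child C F hC
    omega

end NestedIntervals

/-! ### Step 5 and the announcement of the new leaders -/

/-- The lengths requested by the base fragments in step 5. -/
def queryRequest (B : BaseFragments G β) (c : Convention) (mw : β → Option (V × V))
    (S : Slots V β) (b : β) : ℕ :=
  if IsLeader B S b ∧ (mw b).isNone then c.extra else 1

theorem generate_qslot (T : BFSTree G) (b : β) :
    (generate T B c frag mw S).qslot b = (allocate T B c S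
      (fun b => (newBottom T B c frag mw S b).map (fun N => N + (if (mw b).isNone then 1 else 0)))
      (queryRequest B c mw S) b).getD 0 := rfl

theorem queryRequest_eq_one (h : IsPQSlotSet B c frag S) (hm : IsSubtreePartition B frag mw)
    {b : β} (hb : c.extra = 1 ∨ b ≠ merge B frag mw b) : queryRequest B c mw S b = 1 := by
  rw [queryRequest]
  split
  · rename_i hl
    refine hb.resolve_right fun hne => hne ?_
    have hF := h.isLeader_iff.1 hl.1
    refine ((hm.merge_eq_self_iff h.leader_mem).2 ⟨hF, ?_⟩).symm
    rw [hm.virtualPar_eq_none hF]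
    simpa using hl.2
  · rfl

/-- The reserved part is used up exactly. A subtree root spends one slot on the new leader,
`c.extra` on that leader's base fragment and one on each other base fragment; any other fragment
spends one per base fragment. -/
theorem sum_queryRequest (h : IsPQSlotSet B c frag S) {F : β} (hF : frag F = F) :
    (if (mw F).isNone then 1 else 0) +
      ∑ b ∈ Finset.univ.filter (fun b => frag b = F), queryRequest B c mw S b =
      fragSize frag F + rootExtra c mw F := by
  have hmem : F ∈ Finset.univ.filter (fun b => frag b = F) := by simp [hF]
  have h1 := one_le_fragSize hF
  have h2 : ∑ b ∈ (Finset.univ.filter (fun b => frag b = F)).erase F, queryRequest B c mw S b =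
      fragSize frag F - 1 := by
    rw [fragSize, ← Finset.card_erase_of_mem hmem, Finset.card_eq_sum_ones]
    refine Finset.sum_congr rfl fun b hb => ?_
    obtain ⟨hne, hb⟩ := Finset.mem_erase.1 hb
    have hb := (Finset.mem_filter.1 hb).2
    rw [queryRequest, if_neg]
    rintro ⟨hl, -⟩
    exact hne ((h.isLeader_iff.1 hl).symm.trans hb)
  rw [← Finset.add_sum_erase _ _ hmem, h2, queryRequest, rootExtra]
  simp only [h.isLeader_iff, hF, true_and]
  split <;> omega

variable {T : BFSTree G} {a : β → ℕ}

/-- The new query slots. -/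
theorem NestedIntervals.qslot_spec (ha : NestedIntervals T B c frag mw S a)
    (h : IsPQSlotSet B c frag S) (hm : IsSubtreePartition B frag mw) :
    (∀ b, (c.extra = 1 ∨ b ≠ merge B frag mw b) →
      a (frag b) + (if (mw (frag b)).isNone then 1 else 0) ≤
        (generate T B c frag mw S).qslot b ∧
      (generate T B c frag mw S).qslot b <
        a (frag b) + fragSize frag (frag b) + rootExtra c mw (frag b)) ∧
    ∀ b b', (c.extra = 1 ∨ b ≠ merge B frag mw b) → (c.extra = 1 ∨ b' ≠ merge B frag mw b') →
      frag b = frag b' →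
      (generate T B c frag mw S).qslot b = (generate T B c frag mw S).qslot b' → b = b' := by
  have hq : ∀ b, (generate T B c frag mw S).qslot b =
      a (frag b) + (if (mw (frag b)).isNone then 1 else 0) +
      ∑ x ∈ (Finset.univ.filter (fun x => frag x = frag b)).filter
        (fun x => requestKey B c S x < requestKey B c S b), queryRequest B c mw S x := by
    intro b
    rw [generate_qslot, h.allocate_eq, ha.bottom _ (h.leader_mem b)]
    rfl
  refine ⟨fun b hb => ?_, fun b b' hb hb' hf he => ?_⟩
  · have h1 := prefix_sum_add_le_total (Finset.univ.filter (fun x => frag x = frag b))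
      (requestKey B c S) (queryRequest B c mw S) (i := b) (by simp)
    have h2 := sum_queryRequest (mw := mw) h (h.leader_mem b)
    rw [queryRequest_eq_one h hm hb] at h1
    rw [hq b]
    omega
  · refine prefix_interval_inj (Finset.univ.filter (fun x => frag x = frag b))
      (requestKey B c S) (queryRequest B c mw S)
      (N := a (frag b) + (if (mw (frag b)).isNone then 1 else 0))
      (s := (generate T B c frag mw S).qslot b) (by simp) (by simp [hf]) (h.requestKey_inj hf)
      ?_ ?_ ?_ ?_
    · rw [hq b]
    · rw [hq b, queryRequest_eq_one h hm hb]
      exact Nat.lt_succ_self _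
    · rw [he, hq b', hf]
    · rw [he, hq b', queryRequest_eq_one h hm hb', hf]
      exact Nat.lt_succ_self _

theorem announceStep_eq (T : BFSTree G) (h : IsPQSlotSet B c frag S)
    (hm : IsSubtreePartition B frag mw) (known : β → Option (ℕ × V)) {F : β} (hF : frag F = F) :
    announceStep T B c S (link B frag mw) known F =
      (known F).or ((virtualPar B frag mw F).bind known) := by
  unfold announceStep
  dsimp only
  congr 1
  cases hP : virtualPar B frag mw F with
  | none =>
    refine h.convergecast_none T hF fun w hw => ?_
    cases hl : link B frag mw w with
    | none => rfl
    | some y =>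
      obtain ⟨P, hP', rfl⟩ := hm.eq_childEnd h.leader_mem hw hl
      rw [hP] at hP'
      cases hP'
  | some P =>
    rw [h.convergecast_sole T hF (hm.base_childEnd hP), hm.link_childEnd hP]
    · obtain ⟨b, hb, rfl⟩ := Option.map_eq_some_iff.1 (base_parentEnd hP)
      rw [Option.bind_some, h.broadcast_eq, hb]
      rfl
    · intro w hw hne
      cases hl : link B frag mw w with
      | none => rfl
      | some y =>
        obtain ⟨P, hP', rfl⟩ := hm.eq_childEnd h.leader_mem hw hl
        exact absurd rfl hne

/-- What the new leaders announce. -/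
def announceInit (T : BFSTree G) (B : BaseFragments G β) (c : Convention) (frag : β → β)
    (mw : β → Option (V × V)) (S : Slots V β) (b : β) : Option (ℕ × V) :=
  if IsLeader B S b ∧ (mw b).isNone then
    (newBottom T B c frag mw S b).map (fun N => (N, B.root b)) else none

theorem IsSubtreePartition.merge_virtualPar (hm : IsSubtreePartition B frag mw)
    (hf : ∀ b, frag (frag b) = frag b) {F P : β} (hP : virtualPar B frag mw F = some P) :
    merge B frag mw F = merge B frag mw P := by
  obtain ⟨h1, h2, -⟩ := hm.merge_spec hf P
  rw [leader_virtualPar hf hP] at h2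
  rw [hm.merge_eq_iff hf h1, leader_of_virtualPar hP]
  exact h2.trans (Anc.of_par hP)

/-- Whatever is known is correct, and fragments of depth at most `i` do know. The first half is
needed because `or` keeps the earlier value. -/
theorem NestedIntervals.announce (ha : NestedIntervals T B c frag mw S a)
    (h : IsPQSlotSet B c frag S) (hm : IsSubtreePartition B frag mw) (i : ℕ) {F : β}
    (hF : frag F = F) :
    ((announceStep T B c S (link B frag mw))^[i] (announceInit T B c frag mw S) F = none ∨
      (announceStep T B c S (link B frag mw))^[i] (announceInit T B c frag mw S) F =
        some (a (merge B frag mw F), B.root (merge B frag mw F))) ∧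
    ∀ R k, k ≤ i → climb (virtualPar B frag mw) k F = some R → virtualPar B frag mw R = none →
      (announceStep T B c S (link B frag mw))^[i] (announceInit T B c frag mw S) F =
        some (a (merge B frag mw F), B.root (merge B frag mw F)) := by
  have hf := h.leader_mem
  induction i generalizing F with
  | zero =>
    have hroot : virtualPar B frag mw F = none → announceInit T B c frag mw S F =
        some (a (merge B frag mw F), B.root (merge B frag mw F)) := by
      intro hn
      have hl := h.isLeader_iff.2 hF
      rw [announceInit, if_pos ⟨hl, by simp [(hm.virtualPar_eq_none hF).1 hn]⟩, ha.bottom F hF,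
        (hm.merge_eq_self_iff hf).2 ⟨hF, hn⟩]
      rfl
    constructor
    · cases hP : virtualPar B frag mw F with
      | none => exact Or.inr (hroot hP)
      | some P =>
        left
        simp [announceInit, mw_of_virtualPar hP]
    · intro R k hk hR hn
      obtain rfl : k = 0 := by omega
      obtain rfl : F = R := by simpa [climb] using hR
      exact hroot hn
  | succ i ih =>
    rw [Function.iterate_succ_apply', announceStep_eq T h hm _ hF]
    have ihF := ih hF
    cases hP : virtualPar B frag mw F with
    | none =>
      rw [Option.bind_none, Option.or_none]
      refine ⟨ihF.1, fun R k hk hR hn => ihF.2 F 0 (Nat.zero_le _) rfl hP⟩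
    | some P =>
      have ihP := ih (leader_virtualPar hf hP)
      rw [← hm.merge_virtualPar hf hP] at ihP
      rw [Option.bind_some]
      rcases ihF.1 with h1 | h1
      · rw [h1, Option.none_or]
        refine ⟨ihP.1, fun R k hk hR hn => ?_⟩
        cases k with
        | zero =>
          obtain rfl : F = R := by simpa [climb] using hR
          rw [hn] at hP
          cases hP
        | succ k =>
          rw [climb_succ_of_par hP] at hR
          exact ihP.2 R k (by omega) hR hn
      · rw [h1]
        exact ⟨Or.inr rfl, fun _ _ _ _ _ => rfl⟩

theorem NestedIntervals.heard (ha : NestedIntervals T B c frag mw S a)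
    (h : IsPQSlotSet B c frag S) (hm : IsSubtreePartition B frag mw) (b : β) :
    (generate T B c frag mw S).fslot b = a (merge B frag mw b) ∧
      (generate T B c frag mw S).lbl b = B.root (merge B frag mw b) := by
  have hb : broadcast T B c S ((announceStep T B c S (link B frag mw))^[maxDepth]
      (announceInit T B c frag mw S)) (B.root b) =
      some (a (merge B frag mw b), B.root (merge B frag mw b)) := by
    rw [h.broadcast_eq, B.base_root, Option.bind_some]
    obtain ⟨R, hR, k, hk⟩ := (hm.isForest h.leader_mem).exists_root (frag b)
    rw [(ha.announce h hm maxDepth (h.leader_mem b)).2 R k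
      (hm.climb_le_maxDepth h.leader_mem hk) hk hR]
    have : merge B frag mw (frag b) = merge B frag mw b := by
      rw [merge, h.leader_mem, merge]
    rw [this]
  constructor
  · change ((broadcast T B c S ((announceStep T B c S (link B frag mw))^[maxDepth]
      (announceInit T B c frag mw S)) (B.root b)).map Prod.fst).getD 0 = _
    rw [hb]
    rfl
  · change ((broadcast T B c S ((announceStep T B c S (link B frag mw))^[maxDepth]
      (announceInit T B c frag mw S)) (B.root b)).map Prod.snd).getD (S.lbl b) = _
    rw [hb]
    rfl

/-! ### Correctness of a phase -/

/-- Only new leaders are covered: an old leader that loses its role stores the size of its own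
subtree, which is not used again. -/
theorem generate_size (T : BFSTree G) (h : IsPQSlotSet B c frag S)
    (hm : IsSubtreePartition B frag mw) (hsize : ∀ F, frag F = F → S.size F = fragSize frag F)
    {F : β} (hF : merge B frag mw F = F) :
    (generate T B c frag mw S).size F = fragSize (merge B frag mw) F := by
  obtain ⟨hF, hn⟩ := (hm.merge_eq_self_iff h.leader_mem).1 hF
  change S.size F + (requests T B c frag mw S).sum F = _
  rw [hsize F hF, (cachesFilled_requests T h hm hsize).sum F hF,
    hm.subtreeSize_root h.leader_mem hn]

theorem isPQSlotSet_generate (T : BFSTree G) (h : IsPQSlotSet B c frag S)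
    (hm : IsSubtreePartition B frag mw) (hsize : ∀ F, frag F = F → S.size F = fragSize frag F) :
    IsPQSlotSet B c (merge B frag mw) (generate T B c frag mw S) := by
  have hf := h.leader_mem
  obtain ⟨a, ha⟩ := exists_nestedIntervals T h hm hsize
  obtain ⟨hq, hqinj⟩ := ha.qslot_spec h hm
  have hmm : ∀ b, merge B frag mw (merge B frag mw b) = merge B frag mw b := fun b =>
    (hm.merge_eq_self_iff hf).2 ⟨(hm.merge_spec hf b).2.2, (hm.merge_spec hf b).1⟩
  have hrange : ∀ R, merge B frag mw R = R →
      pqRange c (merge B frag mw) (generate T B c frag mw S) R =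
        Finset.Ico (a R) (a R + (subtreeSize B frag mw R + c.extra)) := by
    intro R hR
    rw [pqRange, (ha.heard h hm R).1, hR,
      hm.subtreeSize_root hf ((hm.merge_eq_self_iff hf).1 hR).2]
  refine ⟨hmm, fun b => ⟨(ha.heard h hm b).2, ?_⟩, fun R hR i hi => ?_, fun R R' hR hR' hne => ?_,
    fun R hR => ?_⟩
  · rw [(ha.heard h hm b).1, (ha.heard h hm _).1, hmm]
  · obtain ⟨hRl, hn⟩ := (hm.merge_eq_self_iff hf).1 hR
    rw [hrange R hR, Finset.mem_Ico] at hi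
    have h1 := ha.one_le R hRl hn
    have h2 := ha.le_total R hRl hn
    rw [Finset.mem_Icc]
    omega
  · obtain ⟨hRl, hn⟩ := (hm.merge_eq_self_iff hf).1 hR
    obtain ⟨hRl', hn'⟩ := (hm.merge_eq_self_iff hf).1 hR'
    rw [hrange R hR, hrange R' hR', Finset.disjoint_left]
    intro i hi hi'
    rw [Finset.mem_Ico] at hi hi'
    exact hne (ha.root_inj R R' i hRl hRl' hn hn' hi.1 hi.2 hi'.1 hi'.2)
  · obtain ⟨hRl, hn⟩ := (hm.merge_eq_self_iff hf).1 hR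
    set q := (generate T B c frag mw S).qslot with hqdef
    have hfs : (generate T B c frag mw S).fslot R = a R := by rw [(ha.heard h hm R).1, hR]
    set X := Finset.univ.filter (fun b => merge B frag mw b = R ∧ (c.extra = 1 ∨ b ≠ R)) with hX
    have hXc : ∀ b ∈ X, merge B frag mw b = R ∧ (c.extra = 1 ∨ b ≠ merge B frag mw b) := by
      intro b hb
      obtain ⟨h1, h2⟩ := (Finset.mem_filter.1 hb).2
      exact ⟨h1, by rwa [h1]⟩
    have hset : {b | merge B frag mw b = R ∧ (c.extra = 1 ∨ b ≠ R)} = (X : Set β) := by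
      ext b
      simp [hX]
    have hRe := rootExtra_of_root (c := c) hm hRl hn
    have hRn : (mw R).isNone = true := by simp [(hm.virtualPar_eq_none hRl).1 hn]
    have hR1 := one_le_fragSize hRl
    have hmaps : Set.MapsTo q (X : Set β)
        (pqRange c (merge B frag mw) (generate T B c frag mw S) R \
          {(generate T B c frag mw S).fslot R} : Finset ℕ) := by
      intro b hb
      obtain ⟨hbR, hbc⟩ := hXc b hb
      obtain ⟨h1, h2⟩ := hq b hbc
      have h3 := ha.le_of_anc hm hf ((hm.merge_eq_iff hf hn).1 hbR)
      have h4 := hm.fragSize_le_subtreeSize hf (frag b)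
      rw [Finset.mem_coe, Finset.mem_sdiff, hrange R hR, hfs, Finset.mem_Ico,
        Finset.mem_singleton]
      refine ⟨by omega, fun he => ?_⟩
      -- The first slot is reserved by the root fragment, so only its own base fragments could hit
      -- it; their slots start one higher.
      have h5 : frag b = R := ha.own_inj hm hf (s := q b) (hf b) hRl (by omega) h2 (by omega)
        (by omega)
      rw [h5, hRn, if_pos rfl] at h1
      omega
    have hinj : Set.InjOn q (X : Set β) := by
      intro b hb b' hb' he
      have hbc := (hXc b hb).2
      have hbc' := (hXc b' hb').2
      obtain ⟨h1, h2⟩ := hq b hbc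
      obtain ⟨h3, h4⟩ := hq b' hbc'
      rw [← hqdef] at *
      refine hqinj b b' hbc hbc' (ha.own_inj hm hf (s := q b) (hf b) (hf b') ?_ h2 ?_ ?_) he
      · omega
      · omega
      · omega
    -- Without its first slot the range has `k + c.extra - 1` elements: `k - 1` if the base fragment
    -- of the leader is excluded, and `k` otherwise.
    have hcard : (pqRange c (merge B frag mw) (generate T B c frag mw S) R \
        {(generate T B c frag mw S).fslot R}).card ≤ X.card := by
      have hmem : R ∈ Finset.univ.filter (fun b => merge B frag mw b = R) := by simp [hR]
      rw [Finset.card_sdiff_of_subset (by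
        rw [Finset.singleton_subset_iff]
        exact fslot_mem_pqRange hR), pqRange, Nat.card_Ico, Finset.card_singleton]
      have h1 := c.extra_le_one
      rcases Nat.le_one_iff_eq_zero_or_eq_one.1 h1 with he | he
      · have : X = (Finset.univ.filter (fun b => merge B frag mw b = R)).erase R := by
          ext b
          simp [hX, he, and_comm]
        rw [this, Finset.card_erase_of_mem hmem]
        unfold fragSize
        omega
      · have : X = Finset.univ.filter (fun b => merge B frag mw b = R) := by
          ext b
          simp [hX, he]
        rw [this]
        unfold fragSize
        omega
    rw [hset]
    exact ⟨hmaps, hinj, Finset.surjOn_of_injOn_of_card_le _ hmaps hinj hcard⟩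

end Intervals

end SlotGen

theorem claim5p6 {V β : Type*} [Fintype V] [LinearOrder V] [Fintype β] [DecidableEq β]
    (G : SimpleGraph V) (T : SlotGen.BFSTree G) (B : SlotGen.BaseFragments G β)
    (c : SlotGen.Convention) (mw : ℕ → β → Option (V × V)) (t : ℕ)
    (hmw : ∀ s < t, SlotGen.IsSubtreePartition B (SlotGen.fragAfter B mw s) (mw s)) :
    SlotGen.IsPQSlotSet B c (SlotGen.fragAfter B mw t) (SlotGen.slotsAfter T B c mw t) := by
  -- The sizes stored by the leaders are carried along, since the next phase computes its requests
  -- from them.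
  suffices h : SlotGen.IsPQSlotSet B c (SlotGen.fragAfter B mw t) (SlotGen.slotsAfter T B c mw t) ∧
      ∀ F, SlotGen.fragAfter B mw t F = F → (SlotGen.slotsAfter T B c mw t).size F =
        SlotGen.fragSize (SlotGen.fragAfter B mw t) F from h.1
  induction t with
  | zero =>
    exact ⟨SlotGen.isPQSlotSet_setup T B c, fun F _ => (SlotGen.fragSize_id F).symm⟩
  | succ t ih =>
    obtain ⟨h, hsize⟩ := ih fun s hs => hmw s (by omega)
    have hm := hmw t (Nat.lt_succ_self t)
    exact ⟨SlotGen.isPQSlotSet_generate T h hm hsize,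
      fun F hF => SlotGen.generate_size T h hm hsize hF⟩
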